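/- **Setting.** Let a quantum system have a finite-dimensional Hilbert space, Hamiltonian $H=H^\dagger$, jump operators $L_k$ ($k$ in a finite set) and feedback channels $\mathcal F_k$, each a unital completely positive trace-preserving map, applied right after a jump in channel $k$. Let $k\mapsto k^*$ be an involution of the channels such that local detailed balance $L_k=e^{\Delta s_k/2}L_{k^*}^\dagger$ holds with real numbers $\Delta s_k$. On $[0,\tau]$, $\tau>0$, let the density matrix $\varrho_t$ with initial value $\varrho_0$ solve $$\dot\varrho_t=-i[H,\varrho_t]+\sum_k\Big(\mathcal F_k[L_k\varrho_tL_k^\dagger]-\tfrac12\{L_k^\dagger L_k,\varrho_t\}\Big),$$ and assume that $\varrho_t$ has full rank for $0<t<\tau$. Write $r_k(t)=\operatorname{tr}(L_k\varrho_tL_k^\dagger)$ and $S(X)=-\operatorname{tr}(X\ln X)$. *Current.* For a step $h>0$ put $M_0=\mathbb 1-h\,(iH+\frac12\sum_kL_k^\dagger L_k)$, $M_k=\sqrt h\,L_k$, and $\mathcal F_0=\mathrm{id}$. Divide $[0,\tau]$ into $N$ steps of length $h=\tau/N$; a trajectory $\Gamma=(k_1,\dots,k_N)$ (with $k_i=0$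 for no jump) has weight $p_N(\Gamma)=\operatorname{tr}\,\mathcal F_{k_N}[M_{k_N}\cdots\mathcal F_{k_1}[M_{k_1}\varrho_0M_{k_1}^\dagger]\cdots M_{k_N}^\dagger]$. Let $c_k$ be real with $c_{k^*}=-c_k$, put $c_0=0$ and $J(\Gamma)=\sum_ic_{k_i}$. Define $\langle J^m\rangle=\lim_{N\to\infty}\sum_\Gamma J(\Gamma)^mp_N(\Gamma)$ and $\operatorname{Var}[J]=\langle J^2\rangle-\langle J\rangle^2$. *Thermodynamic quantities.* The dynamical activity is $A=\int_0^\tau\sum_kr_k(t)\,dt$, and $$\Sigma=S(\varrho_\tau)-S(\varrho_0)+\int_0^\tau\sum_k\Delta s_k\,r_k(t)\,dt-\int_0^\tau\dot I_t\,dt .$$ Here $\dot I_t=\lim_{h\to0^+}\big(I_{t,h}-I^-_{t,h}\big)/h$, where $I^-_{t,h}$ and $I_{t,h}$ are the Holevo informations $S(\sum_kp_k\omega_k)-\sum_kp_kS(\omega_k)$ of the ensembles formed by the conditional states $\omega_k$ of a measurement step of length $h$ on $\varrho_t$, before and after feedback: in both $p_k=\operatorname{tr}(M_k\varrho_tM_k^\dagger)$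 ($k\ge0$), with $\omega_k=M_k\varrho_tM_k^\dagger/p_k$ before feedback and $\omega_k=\mathcal F_k[M_k\varrho_tM_k^\dagger/p_k]$ after it. *Linear response.* Let $\ell_k(t)=\dfrac{r_k(t)-r_{k^*}(t)}{r_k(t)+r_{k^*}(t)}$ (with value $0$ if both rates vanish). For $|\theta|<1$ let $\varrho_{t,\theta}$ be the solution on $[0,\tau]$, with $\varrho_{0,\theta}=\varrho_0$, of the master equation with each $L_k$ replaced by $\sqrt{1+\ell_k(t)\theta}\,L_k$. Put $\varphi_t=\partial_\theta\varrho_{t,\theta}|_{\theta=0}$, $\langle J\rangle_\varphi=\int_0^\tau\sum_kc_k\operatorname{tr}(L_k\varphi_tL_k^\dagger)\,dt$ and $\delta_J=\langle J\rangle_\varphi/\langle J\rangle$. Finally let $\Phi$ be the inverse function of $x\mapsto x\tanh x$ on $[0,\infty)$. **Theorem.** The limits defining $\langle J\rangle$, $\langle J^2\rangle$ and (for $0<t<\tau$) $\dot I_t$ exist, $\dot I$ is integrable on $[0,\tau]$, $\varphi_t$ exists for every $t\in[0,\tau]$, and the integrand of $\langle J\rangle_\varphi$ is integrable. If $\langle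 J\rangle\neq0$, then $A>0$, $\Sigma>0$ and $$\frac{\operatorname{Var}[J]}{\langle J\rangle^2}\;\ge\;(1+\delta_J)^2\,\frac{4A}{\Sigma^2}\,\Phi\!\Big(\frac{\Sigma}{2A}\Big)^2\;\ge\;\frac{2(1+\delta_J)^2}{\Sigma}.$$ -/

import Mathlib

open Filter Topology Matrix
open scoped ComplexOrder

noncomputable section

/-- A linear map on matrices is completely positive if `id ⊗ F` preserves positive
semidefiniteness of block matrices, for every number `m` of blocks. -/
def IsCompletelyPositive {n : Type*} (F : Matrix n n ℂ →ₗ[ℂ] Matrix n n ℂ) : Prop :=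
  ∀ (m : ℕ) (X : Matrix (Fin m × n) (Fin m × n) ℂ), X.PosSemidef →
    (Matrix.of fun p q : Fin m × n =>
      F (Matrix.of fun a b => X (p.1, a) (q.1, b)) p.2 q.2).PosSemidef

/-- Completely positive, trace preserving and unital. -/
structure IsUnitalCPTP {n : Type*} [Fintype n] [DecidableEq n]
    (F : Matrix n n ℂ →ₗ[ℂ] Matrix n n ℂ) : Prop where
  completelyPositive : IsCompletelyPositive F
  tracePreserving : ∀ X, (F X).trace = X.trace
  unital : F 1 = 1

/-- Data of Markovian quantum-jump-feedback dynamics on the Hilbert space `ℂⁿ`, with jump channels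
labelled by a finite type `K`: Hamiltonian, jump operators, feedback channels, the pairing
`k ↦ k*` of each jump with its reverse, the environmental entropy changes `Δs k`, and the
initial density matrix. -/
structure FeedbackSystem (n K : Type*) [Fintype n] [DecidableEq n] where
  /-- Hamiltonian -/
  H : Matrix n n ℂ
  /-- jump operators -/
  L : K → Matrix n n ℂ
  /-- feedback channel applied right after a jump in channel `k` -/
  F : K → (Matrix n n ℂ →ₗ[ℂ] Matrix n n ℂ)
  /-- reversed jump channel -/
  rev : K → K
  /-- environmental entropy change of a jump -/
  Δs : K → ℝ
  /-- initial state -/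
  ρ₀ : Matrix n n ℂ
  isHermitian_H : H.IsHermitian
  isUnitalCPTP_F : ∀ k, IsUnitalCPTP (F k)
  rev_rev : ∀ k, rev (rev k) = k
  /-- local detailed balance -/
  localDetailedBalance : ∀ k, L k = (Real.exp (Δs k / 2) : ℂ) • (L (rev k))ᴴ
  posSemidef_ρ₀ : ρ₀.PosSemidef
  trace_ρ₀ : ρ₀.trace = 1

/-- Von Neumann entropy `-tr (X ln X)` of a positive semidefinite matrix. -/
def vonNeumannEntropy {n : Type*} [Fintype n] [DecidableEq n] (X : Matrix n n ℂ) : ℝ :=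
  -(X * cfc Real.log X).trace.re

/-- Holevo information `S (∑ p_k X_k) - ∑ p_k S (X_k)` of an ensemble: the mutual information
between the system and a classical memory holding `k`. -/
def holevoInformation {n : Type*} [Fintype n] [DecidableEq n] {ι : Type*} [Fintype ι]
    (p : ι → ℝ) (X : ι → Matrix n n ℂ) : ℝ :=
  vonNeumannEntropy (∑ k, (p k : ℂ) • X k) - ∑ k, p k * vonNeumannEntropy (X k)

/-- The inverse function of `x ↦ x tanh x` on `[0, ∞)`. -/
def Phi : ℝ → ℝ :=
  Function.invFunOn (fun x : ℝ => x * Real.tanh x) (Set.Ici 0)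

namespace FeedbackSystem

variable {n K : Type*} [Fintype n] [DecidableEq n] [Fintype K] (S : FeedbackSystem n K)

/-- The generator of the feedback master equation, with jump operators `L'`:
`-i[H, X] + ∑_k (F_k[L'_k X L'_k†] - ½ {L'_k† L'_k, X})`. -/
def generator (L' : K → Matrix n n ℂ) (X : Matrix n n ℂ) : Matrix n n ℂ :=
  -Complex.I • (S.H * X - X * S.H) +
    ∑ k, (S.F k (L' k * X * (L' k)ᴴ) -
      (1 / 2 : ℂ) • ((L' k)ᴴ * L' k * X + X * ((L' k)ᴴ * L' k)))

/-- `ρ` solves the feedback master equation on `[0, τ]` from the initial state. -/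
def IsEvolution (τ : ℝ) (ρ : ℝ → Matrix n n ℂ) : Prop :=
  ρ 0 = S.ρ₀ ∧
    ∀ t ∈ Set.Icc 0 τ, HasDerivWithinAt ρ (S.generator S.L (ρ t)) (Set.Icc 0 τ) t

/-- Jump rate `tr (L_k X L_k†)`. -/
def rate (X : Matrix n n ℂ) (k : K) : ℝ := (S.L k * X * (S.L k)ᴴ).trace.re

/-! ### The counting current along quantum-jump trajectories -/

/-- Kraus operators of a measurement step of duration `h`; `none` means that no jump occurs. -/
def kraus (h : ℝ) : Option K → Matrix n n ℂ
  | none => 1 - (h : ℂ) • (Complex.I • S.H + (1 / 2 : ℂ) • ∑ k, (S.L k)ᴴ * S.L k)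
  | some k => (Real.sqrt h : ℂ) • S.L k

/-- Feedback conditioned on the recorded outcome; no feedback without a jump. -/
def feedback : Option K → Matrix n n ℂ → Matrix n n ℂ
  | none => fun X => X
  | some k => fun X => S.F k X

/-- Unnormalised state after the outcomes in the list (earliest first), for time step `h`. -/
def trajectoryState (h : ℝ) (Γ : List (Option K)) : Matrix n n ℂ :=
  Γ.foldl (fun X k => S.feedback k (S.kraus h k * X * (S.kraus h k)ᴴ)) S.ρ₀

/-- Probability of the trajectory `Γ` when `[0, τ]` is divided into `N` steps. -/
def trajectoryProb (τ : ℝ) {N : ℕ} (Γ : Fin N → Option K) : ℝ :=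
  (S.trajectoryState (τ / N) (List.ofFn Γ)).trace.re

/-- The counting current `J(Γ) = ∑_i c_{k_i}`, where a step without a jump counts `0`. -/
def current (c : K → ℝ) {N : ℕ} (Γ : Fin N → Option K) : ℝ :=
  ∑ i, (Γ i).elim 0 c

/-- The `m`-th moment of the current when `[0, τ]` is divided into `N` steps. -/
def discreteMoment (c : K → ℝ) (τ : ℝ) (m N : ℕ) : ℝ :=
  ∑ Γ : Fin N → Option K, current c Γ ^ m * S.trajectoryProb τ Γ

/-- The `m`-th moment `⟨J^m⟩` of the current, in the continuous-time limit. -/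
def currentMoment (c : K → ℝ) (τ : ℝ) (m : ℕ) : ℝ :=
  limUnder atTop (S.discreteMoment c τ m)

/-- `⟨J⟩` -/
def meanCurrent (c : K → ℝ) (τ : ℝ) : ℝ := S.currentMoment c τ 1

/-- `Var[J] = ⟨J²⟩ - ⟨J⟩²` -/
def varCurrent (c : K → ℝ) (τ : ℝ) : ℝ := S.currentMoment c τ 2 - S.meanCurrent c τ ^ 2

/-! ### Thermodynamic quantities -/

/-- Probability of outcome `k` of a measurement step of duration `h` on the state `X`. -/
def outcomeProb (X : Matrix n n ℂ) (h : ℝ) (k : Option K) : ℝ :=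
  (S.kraus h k * X * (S.kraus h k)ᴴ).trace.re

/-- Normalised state after outcome `k`, before feedback. -/
def measuredState (X : Matrix n n ℂ) (h : ℝ) (k : Option K) : Matrix n n ℂ :=
  ((S.outcomeProb X h k)⁻¹ : ℂ) • (S.kraus h k * X * (S.kraus h k)ᴴ)

/-- Change, in the feedback step, of the mutual information between system and memory, for a
measurement of duration `h` on the state `X`. -/
def mutualInfoChange (X : Matrix n n ℂ) (h : ℝ) : ℝ :=
  holevoInformation (S.outcomeProb X h) (fun k => S.feedback k (S.measuredState X h k)) -
    holevoInformation (S.outcomeProb X h) (S.measuredState X h)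

/-- Rate of change of the mutual information in the continuous-time limit. -/
def mutualInfoRate (X : Matrix n n ℂ) : ℝ :=
  limUnder (𝓝[>] (0 : ℝ)) (fun h => S.mutualInfoChange X h / h)

/-- Dynamical activity `A`: the mean number of jumps. -/
def activity (τ : ℝ) (ρ : ℝ → Matrix n n ℂ) : ℝ :=
  ∫ t in (0 : ℝ)..τ, ∑ k, S.rate (ρ t) k

/-- Total entropy production: entropy change of the system plus that of the environment. -/
def totalEntropyProduction (τ : ℝ) (ρ : ℝ → Matrix n n ℂ) : ℝ :=
  (vonNeumannEntropy (ρ τ) - vonNeumannEntropy (ρ 0)) +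
    ∫ t in (0 : ℝ)..τ, ∑ k, S.Δs k * S.rate (ρ t) k

/-- `Σ`: total entropy production minus mutual-information change. -/
def entropyProduction (τ : ℝ) (ρ : ℝ → Matrix n n ℂ) : ℝ :=
  S.totalEntropyProduction τ ρ - ∫ t in (0 : ℝ)..τ, S.mutualInfoRate (ρ t)

/-! ### Perturbed dynamics and linear response -/

/-- Relative bias of a jump with respect to its reverse. If both rates vanish the value is `0`;
both jumps are then without effect on `X`. -/
def bias (X : Matrix n n ℂ) (k : K) : ℝ :=
  (S.rate X k - S.rate X (S.rev k)) / (S.rate X k + S.rate X (S.rev k))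

/-- `ρθ` solves on `[0, τ]` the master equation in which each jump operator `L_k` is replaced by
`√(1 + ℓ_k(t) θ) L_k`, with `ℓ_k(t)` the bias in the unperturbed state `ρ t`. -/
def IsPerturbedEvolution (τ : ℝ) (ρ : ℝ → Matrix n n ℂ) (θ : ℝ) (ρθ : ℝ → Matrix n n ℂ) : Prop :=
  ρθ 0 = S.ρ₀ ∧
    ∀ t ∈ Set.Icc 0 τ,
      HasDerivWithinAt ρθ
        (S.generator (fun k => (Real.sqrt (1 + S.bias (ρ t) k * θ) : ℂ) • S.L k) (ρθ t))
        (Set.Icc 0 τ) t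

/-- First-order response `φ_t` of the perturbed state: `ρ_{t,θ} = ρ_t + θ φ_t + o(θ)`. -/
def response (ρp : ℝ → ℝ → Matrix n n ℂ) (t : ℝ) : Matrix n n ℂ :=
  deriv (fun θ => ρp θ t) 0

/-- The correction `δ_J = ⟨J⟩_φ / ⟨J⟩`, `⟨J⟩_φ = ∫ ∑_k c_k tr (L_k φ_t L_k†) dt`. -/
def correction (c : K → ℝ) (τ : ℝ) (ρp : ℝ → ℝ → Matrix n n ℂ) : ℝ :=
  (∫ t in (0 : ℝ)..τ, ∑ k, c k * S.rate (response ρp t) k) / S.meanCurrent c τ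

end FeedbackSystem

end

/-!
The variance of the current is bounded below by an estimate of Cramér–Rao type. Let `N t` be the
expected future current, the solution of the backward equation with the adjoint generator. Up to
the variance of the initial state, the variance of the current is the time integral of a second
moment, and Kadison's inequality for the unital channels `F k` bounds that second moment below by
the squares of the jump defects `(c k + F_k†[N]) L_k - L_k N`. Testing the defects against the
operators `ℓ_k L_k` and applying the Cauchy–Schwarz inequality gives
`(⟨J⟩ + ⟨J⟩_φ)² ≤ Var[J] * ∫ ∑ k, ℓ_k² r_k`: the numerator is the linear response of the current,
by Duhamel's formula, because `ℓ_k` is odd and `ℓ_k (r_k + r_{k*}) = r_k - r_{k*}`.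

Thermodynamics bounds the Fisher information `∫ ∑ k, ℓ_k² r_k`. Each pair of reversed channels has
`ℓ = tanh x` with `x = ½ log (r / s)`, while Klein's inequality, together with the fact that a
unital channel does not lower the entropy, shows that the entropy production rate is at least
`∑ k, r_k log (r_k / r_{k*})`, to which the pair contributes `2 x tanh x` times its activity
`r + s`. Since `tanh² x` is a concave function of `x tanh x`, its tangent at `x₀ = Phi (Σ / 2A)`
gives `∫ ∑ k, ℓ_k² r_k ≤ A tanh² x₀ = Σ² / (4 A x₀²)`.
-/

/-! ### The function `x ↦ x tanh x` and its inverse -/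

theorem hasDerivAt_tanh (x : ℝ) : HasDerivAt Real.tanh (1 / Real.cosh x ^ 2) x := by
  rw [funext Real.tanh_eq_sinh_div_cosh]
  refine ((Real.hasDerivAt_sinh x).div (Real.hasDerivAt_cosh x)
    (Real.cosh_pos x).ne').congr_deriv ?_
  rw [← Real.cosh_sq_sub_sinh_sq x, pow_two, pow_two]

@[fun_prop]
theorem continuous_tanh : Continuous Real.tanh :=
  continuous_iff_continuousAt.2 fun x => (hasDerivAt_tanh x).continuousAt

theorem tanh_nonneg {x : ℝ} (hx : 0 ≤ x) : 0 ≤ Real.tanh x := by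
  rw [Real.tanh_eq_sinh_div_cosh]
  exact div_nonneg (Real.sinh_nonneg_iff.2 hx) (Real.cosh_pos x).le

theorem tanh_le_self {x : ℝ} (hx : 0 ≤ x) : Real.tanh x ≤ x := by
  have hmono : MonotoneOn (fun y => y - Real.tanh y) (Set.Ici 0) := by
    refine monotoneOn_of_hasDerivWithinAt_nonneg (f' := fun y => 1 - 1 / Real.cosh y ^ 2)
      (convex_Ici 0) (by fun_prop) (fun y _ => ?_) (fun y _ => ?_)
    · exact ((hasDerivAt_id y).sub (hasDerivAt_tanh y)).hasDerivWithinAt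
    · rw [sub_nonneg]
      exact div_le_one_of_le₀ (one_le_pow₀ (Real.one_le_cosh y)) (sq_nonneg _)
  simpa using hmono (Set.mem_Ici.2 le_rfl) (Set.mem_Ici.2 hx) hx

theorem tanh_sq_le_mul_tanh (x : ℝ) : Real.tanh x ^ 2 ≤ x * Real.tanh x := by
  wlog hx : 0 ≤ x generalizing x
  · simpa [Real.tanh_neg] using this (-x) (by linarith)
  · rw [pow_two]
    exact mul_le_mul_of_nonneg_right (tanh_le_self hx) (tanh_nonneg hx)

theorem exists_mul_tanh_eq {s : ℝ} (hs : 0 ≤ s) : ∃ x ∈ Set.Ici (0 : ℝ), x * Real.tanh x = s := by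
  have hend : s ≤ (s + 1) * Real.tanh (s + 1) := by
    rw [Real.tanh_eq_sinh_div_cosh, mul_div_assoc', le_div_iff₀ (Real.cosh_pos _)]
    have hsinh : s + 1 ≤ Real.sinh (s + 1) := Real.self_le_sinh_iff.2 (by linarith)
    have hexp : Real.cosh (s + 1) - Real.sinh (s + 1) ≤ 1 := by
      rw [Real.cosh_sub_sinh, Real.exp_le_one_iff]
      linarith
    nlinarith
  obtain ⟨x, hx, hxs⟩ := intermediate_value_Icc (f := fun x => x * Real.tanh x)
    (by linarith : (0 : ℝ) ≤ s + 1) (by fun_prop) ⟨by simpa using hs, hend⟩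
  exact ⟨x, hx.1, hxs⟩

theorem Phi_nonneg {s : ℝ} (hs : 0 ≤ s) : 0 ≤ Phi s :=
  Function.invFunOn_mem (exists_mul_tanh_eq hs)

theorem Phi_mul_tanh_Phi {s : ℝ} (hs : 0 ≤ s) : Phi s * Real.tanh (Phi s) = s :=
  Function.invFunOn_eq (exists_mul_tanh_eq hs)

theorem Phi_pos {s : ℝ} (hs : 0 < s) : 0 < Phi s := by
  refine (Phi_nonneg hs.le).lt_of_ne fun h => hs.ne ?_
  rw [← Phi_mul_tanh_Phi hs.le, ← h, zero_mul]

theorem le_Phi_sq {s : ℝ} (hs : 0 ≤ s) : s ≤ Phi s ^ 2 :=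
  calc s = Phi s * Real.tanh (Phi s) := (Phi_mul_tanh_Phi hs).symm
    _ ≤ Phi s * Phi s := mul_le_mul_of_nonneg_left (tanh_le_self (Phi_nonneg hs)) (Phi_nonneg hs)
    _ = Phi s ^ 2 := (pow_two _).symm

theorem monotoneOn_mul_cosh_div_sinh :
    MonotoneOn (fun x : ℝ => x * Real.cosh x / Real.sinh x) (Set.Ioi 0) := by
  have hderiv : ∀ x : ℝ, 0 < x → HasDerivAt (fun x : ℝ => x * Real.cosh x / Real.sinh x)
      (((1 * Real.cosh x + x * Real.sinh x) * Real.sinh x - x * Real.cosh x * Real.cosh x) /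
        Real.sinh x ^ 2) x := fun x hx =>
    ((hasDerivAt_id x).mul (Real.hasDerivAt_cosh x)).div (Real.hasDerivAt_sinh x)
      (Real.sinh_pos_iff.2 hx).ne'
  refine monotoneOn_of_hasDerivWithinAt_nonneg (convex_Ioi 0)
    (fun x hx => (hderiv x hx).continuousAt.continuousWithinAt)
    (fun x hx => (hderiv x (by simpa using hx)).hasDerivWithinAt) (fun x hx => ?_)
  rw [interior_Ioi, Set.mem_Ioi] at hx
  have hsinh : x ≤ Real.sinh x := Real.self_le_sinh_iff.2 hx.le
  have hcosh := Real.one_le_cosh x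
  refine div_nonneg ?_ (sq_nonneg _)
  nlinarith [Real.cosh_sq x, mul_nonneg (sub_nonneg.2 hsinh) (sub_nonneg.2 hcosh)]

/-- Twice the reciprocal of the slope `d(tanh² x) / d(x tanh x)` of the curve `(x tanh x, tanh² x)`.
That it increases with `x` says that this curve is concave. -/
noncomputable def inverseSlope (x : ℝ) : ℝ := Real.cosh x ^ 2 + x * Real.cosh x / Real.sinh x

theorem inverseSlope_pos {x : ℝ} (hx : 0 < x) : 0 < inverseSlope x := by
  have := Real.sinh_pos_iff.2 hx
  have := Real.cosh_pos x
  unfold inverseSlope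
  positivity

theorem monotoneOn_inverseSlope : MonotoneOn inverseSlope (Set.Ioi 0) := fun x hx _ hy hxy =>
  add_le_add
    (pow_le_pow_left₀ (Real.cosh_pos x).le
      (Real.cosh_strictMonoOn.monotoneOn (Set.mem_Ioi.1 hx).le (Set.mem_Ioi.1 hy).le hxy) 2)
    (monotoneOn_mul_cosh_div_sinh hx hy hxy)

theorem hasDerivAt_mul_tanh_sub_tanh_sq (m : ℝ) {x : ℝ} (hx : 0 < x) :
    HasDerivAt (fun x => m * (x * Real.tanh x) - Real.tanh x ^ 2)
      (Real.tanh x / Real.cosh x ^ 2 * (m * inverseSlope x - 2)) x := by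
  refine ((((hasDerivAt_id x).mul (hasDerivAt_tanh x)).const_mul m).sub
    ((hasDerivAt_tanh x).pow 2)).congr_deriv ?_
  have hsinh := (Real.sinh_pos_iff.2 hx).ne'
  have hcosh := (Real.cosh_pos x).ne'
  simp only [id, inverseSlope, Real.tanh_eq_sinh_div_cosh]
  norm_num
  field_simp

theorem mul_tanh_sub_tanh_sq_le {x₀ x : ℝ} (hx₀ : 0 < x₀) (hx : 0 ≤ x) :
    2 / inverseSlope x₀ * (x₀ * Real.tanh x₀) - Real.tanh x₀ ^ 2 ≤
      2 / inverseSlope x₀ * (x * Real.tanh x) - Real.tanh x ^ 2 := by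
  set m := 2 / inverseSlope x₀
  have hm_pos : 0 < m := div_pos two_pos (inverseSlope_pos hx₀)
  have hm_mul : m * inverseSlope x₀ = 2 := div_mul_cancel₀ _ (inverseSlope_pos hx₀).ne'
  have hfactor : ∀ x : ℝ, 0 < x → 0 ≤ Real.tanh x / Real.cosh x ^ 2 := fun x hx =>
    div_nonneg (tanh_nonneg hx.le) (sq_nonneg _)
  rcases le_total x x₀ with h | h
  · refine antitoneOn_of_hasDerivWithinAt_nonpos (convex_Icc 0 x₀) (by fun_prop)
      (f := fun x => m * (x * Real.tanh x) - Real.tanh x ^ 2)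
      (fun y hy => (hasDerivAt_mul_tanh_sub_tanh_sq m (interior_Icc.subset hy).1).hasDerivWithinAt)
      (fun y hy => ?_) ⟨hx, h⟩ ⟨hx₀.le, le_rfl⟩ h
    rw [interior_Icc] at hy
    have := mul_le_mul_of_nonneg_left (monotoneOn_inverseSlope hy.1 hx₀ hy.2.le) hm_pos.le
    exact mul_nonpos_of_nonneg_of_nonpos (hfactor y hy.1) (by linarith)
  · refine monotoneOn_of_hasDerivWithinAt_nonneg (convex_Ici x₀) (by fun_prop)
      (f := fun x => m * (x * Real.tanh x) - Real.tanh x ^ 2)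
      (fun y hy => (hasDerivAt_mul_tanh_sub_tanh_sq m
        (hx₀.trans (interior_Ici.subset hy))).hasDerivWithinAt)
      (fun y hy => ?_) (Set.mem_Ici.2 le_rfl) h h
    rw [interior_Ici, Set.mem_Ioi] at hy
    have := mul_le_mul_of_nonneg_left
      (monotoneOn_inverseSlope hx₀ (hx₀.trans hy) hy.le) hm_pos.le
    exact mul_nonneg (hfactor y (hx₀.trans hy)) (by linarith)

theorem exists_tanh_sq_le_tangent {x₀ : ℝ} (hx₀ : 0 < x₀) :
    ∃ m : ℝ, 0 ≤ m ∧ ∀ x : ℝ,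
      Real.tanh x ^ 2 ≤ Real.tanh x₀ ^ 2 + m * (x * Real.tanh x - x₀ * Real.tanh x₀) := by
  refine ⟨2 / inverseSlope x₀, (div_pos two_pos (inverseSlope_pos hx₀)).le, fun x => ?_⟩
  wlog hx : 0 ≤ x generalizing x
  · simpa [Real.tanh_neg] using this (-x) (by linarith)
  · linarith [mul_tanh_sub_tanh_sq_le hx₀ hx]

theorem tanh_half_log_div {r s : ℝ} (hr : 0 < r) (hs : 0 < s) :
    Real.tanh (1 / 2 * Real.log (r / s)) = (r - s) / (r + s) := by
  have hrs : 0 < r + s := add_pos hr hs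
  have hlow : -1 < (r - s) / (r + s) := by rw [lt_div_iff₀ hrs]; linarith
  have hupp : (r - s) / (r + s) < 1 := by rw [div_lt_one hrs]; linarith
  have hratio : (1 + (r - s) / (r + s)) / (1 - (r - s) / (r + s)) = r / s := by
    have : 1 - (r - s) / (r + s) = 2 * s / (r + s) := by field_simp; ring
    rw [this]
    field_simp
    ring
  rw [← hratio, ← Real.artanh_eq_half_log ⟨hlow.le, hupp.le⟩, Real.tanh_artanh ⟨hlow, hupp⟩]

theorem add_mul_tanh_half_log_div_sq {r s : ℝ} (hr : 0 < r) (hs : 0 < s) :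
    (r + s) * Real.tanh (1 / 2 * Real.log (r / s)) ^ 2 = (r - s) ^ 2 / (r + s) := by
  rw [tanh_half_log_div hr hs]
  field_simp

theorem add_mul_half_log_div_mul_tanh {r s : ℝ} (hr : 0 < r) (hs : 0 < s) :
    (r + s) * (1 / 2 * Real.log (r / s) * Real.tanh (1 / 2 * Real.log (r / s))) =
      1 / 2 * ((r - s) * Real.log (r / s)) := by
  rw [tanh_half_log_div hr hs]
  field_simp

theorem sq_div_add_le_mul_log {r s : ℝ} (hr : 0 < r) (hs : 0 < s) :
    (r - s) ^ 2 / (r + s) ≤ 1 / 2 * ((r - s) * Real.log (r / s)) := by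
  rw [← add_mul_tanh_half_log_div_sq hr hs, ← add_mul_half_log_div_mul_tanh hr hs]
  exact mul_le_mul_of_nonneg_left (tanh_sq_le_mul_tanh _) (add_pos hr hs).le

theorem exists_sq_div_add_le_tangent {x₀ : ℝ} (hx₀ : 0 < x₀) :
    ∃ m : ℝ, 0 ≤ m ∧ ∀ r s : ℝ, 0 < r → 0 < s → (r - s) ^ 2 / (r + s) ≤
      (r + s) * Real.tanh x₀ ^ 2 +
        m * (1 / 2 * ((r - s) * Real.log (r / s)) - x₀ * Real.tanh x₀ * (r + s)) := by
  obtain ⟨m, hm, htangent⟩ := exists_tanh_sq_le_tangent hx₀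
  refine ⟨m, hm, fun r s hr hs => ?_⟩
  rw [← add_mul_tanh_half_log_div_sq hr hs, ← add_mul_half_log_div_mul_tanh hr hs]
  linarith [mul_le_mul_of_nonneg_left (htangent (1 / 2 * Real.log (r / s))) (add_pos hr hs).le]

/-! ### Positive maps and the von Neumann entropy -/

open scoped Matrix.Norms.L2Operator

section SpectralContinuity

variable {A X : Type*} [CStarAlgebra A] {l : Filter X} {a : X → A} {a₀ : A} {s : Set ℝ}

theorem eventually_spectrum_subset (hs : IsOpen s) (ha : Tendsto a l (𝓝 a₀))
    (hsp : spectrum ℝ a₀ ⊆ s) : ∀ᶠ x in l, spectrum ℝ (a x) ⊆ s :=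
  (ha.eventually ((upperHemicontinuous_spectrum ℝ A).upperHemicontinuousAt a₀ _
    (hs.mem_nhdsSet.2 hsp))).mono fun _ => subset_of_mem_nhdsSet

theorem tendsto_cfc_of_isOpen (hs : IsOpen s) {f : ℝ → ℝ} (hf : ContinuousOn f s)
    (ha : Tendsto a l (𝓝 a₀)) (hsa : ∀ᶠ x in l, IsSelfAdjoint (a x)) (hsa₀ : IsSelfAdjoint a₀)
    (hsp : spectrum ℝ a₀ ⊆ s) : Tendsto (fun x => cfc f (a x)) l (𝓝 (cfc f a₀)) := by
  obtain ⟨k, ⟨hk_nhds, hk_compact⟩, hks⟩ :=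
    (spectrum.isCompact (𝕜 := ℝ) a₀).nhdsSet_basis_isCompact.mem_iff.mp (hs.mem_nhdsSet.2 hsp)
  have hsub := (upperHemicontinuous_spectrum ℝ A).upperHemicontinuousAt a₀ _ hk_nhds
  exact ha.cfc hk_compact f ((ha.eventually hsub).mono fun _ => subset_of_mem_nhdsSet) hsa
    (subset_of_mem_nhdsSet hk_nhds) hsa₀ (hf.mono hks)

end SpectralContinuity

/-- A linear map on matrices that preserves positive semidefiniteness. Unlike Mathlib's
bundled `PositiveLinearMap`, this is a property of the linear map, to which the feedback channels
are given. -/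
def IsPositiveMap {n : Type*} (F : Matrix n n ℂ →ₗ[ℂ] Matrix n n ℂ) : Prop :=
  ∀ X : Matrix n n ℂ, X.PosSemidef → (F X).PosSemidef

theorem IsCompletelyPositive.isPositiveMap {n : Type*} {F : Matrix n n ℂ →ₗ[ℂ] Matrix n n ℂ}
    (hF : IsCompletelyPositive F) : IsPositiveMap F := fun X hX =>
  (hF 1 (X.submatrix Prod.snd Prod.snd) (hX.submatrix _)).submatrix fun i : n => ((0 : Fin 1), i)

theorem IsPositiveMap.map_conjTranspose {n : Type*} [Finite n] {F : Matrix n n ℂ →ₗ[ℂ] Matrix n n ℂ}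
    (hF : IsPositiveMap F) (Z : Matrix n n ℂ) : F Zᴴ = (F Z)ᴴ := by
  classical
  have := Fintype.ofFinite n
  open scoped MatrixOrder in
  exact map_star (PositiveLinearMap.mk₀ F fun X hX =>
    (hF X (Matrix.nonneg_iff_posSemidef.1 hX)).nonneg) Z

section PositiveMap

variable {n : Type*} [Fintype n]

theorem trace_mul_nonneg {X Y : Matrix n n ℂ} (hX : X.PosSemidef) (hY : Y.PosSemidef) :
    0 ≤ (X * Y).trace := by
  classical
  obtain ⟨B, rfl⟩ : ∃ B : Matrix n n ℂ, Y = Bᴴ * B := by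
    open scoped MatrixOrder in
    exact CStarAlgebra.nonneg_iff_eq_star_mul_self.1 hY.nonneg
  rw [← Matrix.mul_assoc, Matrix.trace_mul_comm, ← Matrix.mul_assoc]
  exact (hX.mul_mul_conjTranspose_same B).trace_nonneg

theorem re_trace_mul_nonneg {X Y : Matrix n n ℂ} (hX : X.PosSemidef) (hY : Y.PosSemidef) :
    0 ≤ (X * Y).trace.re :=
  (Complex.nonneg_iff.1 (trace_mul_nonneg hX hY)).1

@[fun_prop]
theorem continuous_trace_re : Continuous fun X : Matrix n n ℂ => X.trace.re :=
  Complex.continuous_re.comp (Continuous.matrix_trace continuous_id)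

/-- The linear map `X ↦ L X L†`. -/
def conjMap (L : Matrix n n ℂ) : Matrix n n ℂ →ₗ[ℂ] Matrix n n ℂ where
  toFun X := L * X * Lᴴ
  map_add' X Y := by rw [Matrix.mul_add, Matrix.add_mul]
  map_smul' a X := by rw [Matrix.mul_smul, Matrix.smul_mul, RingHom.id_apply]

theorem conjMap_apply (L X : Matrix n n ℂ) : conjMap L X = L * X * Lᴴ := rfl

theorem isPositiveMap_conjMap (L : Matrix n n ℂ) : IsPositiveMap (conjMap L) :=
  fun _ hX => hX.mul_mul_conjTranspose_same L

variable [DecidableEq n]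

theorem cfc_mul_cfc (A : Matrix n n ℂ) (f g : ℝ → ℝ) :
    cfc f A * cfc g A = cfc (fun x => f x * g x) A :=
  (cfc_mul f g A (Matrix.finite_real_spectrum.continuousOn f)
    (Matrix.finite_real_spectrum.continuousOn g)).symm

theorem mul_cfc {A : Matrix n n ℂ} (hA : A.IsHermitian) (f : ℝ → ℝ) :
    A * cfc f A = cfc (fun x => x * f x) A := by
  conv_lhs => rw [← cfc_id' ℝ A hA.isSelfAdjoint, cfc_id' ℝ A hA.isSelfAdjoint]
  rw [← cfc_mul_cfc A (fun x => x) f, cfc_id' ℝ A hA.isSelfAdjoint]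

/-- The rank-one projection onto the `i`-th vector of an orthonormal eigenbasis of `A`. -/
noncomputable def eigenprojection {A : Matrix n n ℂ} (hA : A.IsHermitian) (i : n) : Matrix n n ℂ :=
  Matrix.vecMulVec (hA.eigenvectorBasis i) (star (hA.eigenvectorBasis i : n → ℂ))

section Eigenprojection

variable {A : Matrix n n ℂ} (hA : A.IsHermitian)

theorem posSemidef_eigenprojection (i : n) : (eigenprojection hA i).PosSemidef :=
  Matrix.posSemidef_vecMulVec_self_star _

theorem cfc_eq_sum_smul_eigenprojection (f : ℝ → ℝ) :
    cfc f A = ∑ i, (f (hA.eigenvalues i) : ℂ) • eigenprojection hA i := by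
  rw [hA.cfc_eq, Matrix.IsHermitian.cfc, Unitary.conjStarAlgAut_apply]
  ext a b
  rw [Matrix.mul_apply, Matrix.sum_apply]
  refine Finset.sum_congr rfl fun i _ => ?_
  simp only [Matrix.mul_diagonal, Matrix.smul_apply, Matrix.star_apply, eigenprojection,
    Matrix.IsHermitian.eigenvectorUnitary_apply, Matrix.vecMulVec_apply, Pi.star_apply,
    Function.comp_apply, smul_eq_mul, Complex.coe_algebraMap]
  ring

theorem sum_eigenprojection : ∑ i, eigenprojection hA i = 1 := by
  simpa [cfc_const_one ℝ A hA.isSelfAdjoint] using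
    (cfc_eq_sum_smul_eigenprojection hA fun _ => 1).symm

theorem sum_eigenvalues_smul_eigenprojection :
    ∑ i, (hA.eigenvalues i : ℂ) • eigenprojection hA i = A := by
  rw [← cfc_eq_sum_smul_eigenprojection hA fun x => x, cfc_id' ℝ A hA.isSelfAdjoint]

theorem sum_eigenvalues_sq_smul_eigenprojection :
    ∑ i, ((hA.eigenvalues i : ℂ) * hA.eigenvalues i) • eigenprojection hA i = A * A := by
  have h := cfc_eq_sum_smul_eigenprojection hA fun x => x * x
  rw [← mul_cfc hA fun x => x, cfc_id' ℝ A hA.isSelfAdjoint] at h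
  simpa using h.symm

end Eigenprojection

section Klein

variable {F : Matrix n n ℂ →ₗ[ℂ] Matrix n n ℂ}

theorem IsPositiveMap.exists_weights (hF : IsPositiveMap F) {A B : Matrix n n ℂ}
    (hA : A.IsHermitian) (hB : B.IsHermitian) :
    ∃ w : n → n → ℝ, (∀ i j, 0 ≤ w i j) ∧ ∀ f g : ℝ → ℝ,
      (F (cfc f A) * cfc g B).trace.re =
        ∑ i, ∑ j, w i j * (f (hA.eigenvalues i) * g (hB.eigenvalues j)) := by
  refine ⟨fun i j => (F (eigenprojection hA i) * eigenprojection hB j).trace.re, fun i j =>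
    re_trace_mul_nonneg (hF _ (posSemidef_eigenprojection hA i)) (posSemidef_eigenprojection hB j),
    fun f g => ?_⟩
  simp only [cfc_eq_sum_smul_eigenprojection hA, cfc_eq_sum_smul_eigenprojection hB, map_sum,
    map_smul, Finset.sum_mul, Finset.mul_sum, Matrix.trace_sum, Complex.re_sum, Matrix.smul_mul,
    Matrix.mul_smul, Matrix.trace_smul, smul_eq_mul, Complex.re_ofReal_mul]
  exact Finset.sum_comm.trans (Finset.sum_congr rfl fun i _ => Finset.sum_congr rfl fun j _ => by
    ring)

theorem sub_le_mul_log_sub_mul_log {x y : ℝ} (hx : 0 < x) (hy : 0 < y) :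
    x - y ≤ x * Real.log x - x * Real.log y := by
  have h := mul_le_mul_of_nonneg_left (Real.log_le_sub_one_of_pos (div_pos hy hx)) hx.le
  rw [Real.log_div hy.ne' hx.ne', mul_sub_one, mul_div_cancel₀ _ hx.ne'] at h
  linarith

theorem IsPositiveMap.klein (hF : IsPositiveMap F) {A B : Matrix n n ℂ} (hA : A.PosDef)
    (hB : B.PosDef) {c : ℝ} (hc : 0 < c) :
    (F A).trace.re - c * (F 1 * B).trace.re ≤
      (F (A * cfc Real.log A)).trace.re - (F A * cfc Real.log B).trace.re -
        Real.log c * (F A).trace.re := by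
  obtain ⟨w, hw, hweights⟩ := hF.exists_weights hA.1 hB.1
  have trace_mul_log := hweights (fun x => x * Real.log x) (fun _ => 1)
  have trace_log := hweights (fun x => x) Real.log
  have trace_left := hweights (fun x => x) (fun _ => 1)
  have trace_right := hweights (fun _ => 1) (fun x => x)
  simp only [← mul_cfc hA.1, cfc_id' ℝ A hA.1.isSelfAdjoint, cfc_id' ℝ B hB.1.isSelfAdjoint,
    cfc_const_one ℝ A hA.1.isSelfAdjoint, cfc_const_one ℝ B hB.1.isSelfAdjoint, Matrix.mul_one]
    at trace_mul_log trace_log trace_left trace_right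
  rw [trace_mul_log, trace_log, trace_left, trace_right]
  simp only [Finset.mul_sum, ← Finset.sum_sub_distrib]
  refine Finset.sum_le_sum fun i _ => Finset.sum_le_sum fun j _ => ?_
  have ha := hA.eigenvalues_pos i
  have hb := hB.eigenvalues_pos j
  have hscalar := sub_le_mul_log_sub_mul_log ha (mul_pos hc hb)
  rw [Real.log_mul hc.ne' hb.ne'] at hscalar
  linarith [mul_le_mul_of_nonneg_left hscalar (hw i j)]

end Klein

section Entropy

theorem vonNeumannEntropy_eq_cfc {A : Matrix n n ℂ} (hA : A.IsHermitian) :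
    vonNeumannEntropy A = (cfc Real.negMulLog A).trace.re := by
  have hcfc : cfc Real.negMulLog A = -(A * cfc Real.log A) := by
    rw [mul_cfc hA, ← cfc_neg]
    simp only [Real.negMulLog_def, neg_mul]
  rw [hcfc, vonNeumannEntropy, Matrix.trace_neg, Complex.neg_re]

theorem spectrum_subset_Ioi {A : Matrix n n ℂ} (hA : A.PosDef) : spectrum ℝ A ⊆ Set.Ioi 0 := by
  open scoped MatrixOrder in
  exact fun _ => hA.isStrictlyPositive.spectrum_pos

theorem eventually_posDef {n X : Type*} [Finite n] {l : Filter X} {a : X → Matrix n n ℂ}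
    {a₀ : Matrix n n ℂ} (ha : Tendsto a l (𝓝 a₀)) (hH : ∀ᶠ x in l, (a x).IsHermitian)
    (h₀ : a₀.PosDef) : ∀ᶠ x in l, (a x).PosDef := by
  classical
  have := Fintype.ofFinite n
  filter_upwards [eventually_spectrum_subset isOpen_Ioi ha (spectrum_subset_Ioi h₀), hH]
    with x hsp hx
  exact hx.posDef_iff_eigenvalues_pos.2 fun i => hsp (hx.eigenvalues_mem_spectrum_real i)

section Limits

variable {X : Type*} {l : Filter X} {a : X → Matrix n n ℂ} {a₀ : Matrix n n ℂ}

theorem tendsto_log (ha : Tendsto a l (𝓝 a₀)) (hH : ∀ᶠ x in l, (a x).IsHermitian)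
    (h₀ : a₀.PosDef) : Tendsto (fun x => cfc Real.log (a x)) l (𝓝 (cfc Real.log a₀)) :=
  tendsto_cfc_of_isOpen isOpen_Ioi (Real.continuousOn_log.mono fun _ hx => ne_of_gt hx) ha hH
    h₀.1.isSelfAdjoint (spectrum_subset_Ioi h₀)

theorem tendsto_vonNeumannEntropy (ha : Tendsto a l (𝓝 a₀)) (hH : ∀ᶠ x in l, (a x).IsHermitian)
    (h₀ : a₀.IsHermitian) :
    Tendsto (fun x => vonNeumannEntropy (a x)) l (𝓝 (vonNeumannEntropy a₀)) := by
  have hcfc := tendsto_cfc_of_isOpen isOpen_univ Real.continuous_negMulLog.continuousOn ha hH h₀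
    (Set.subset_univ _)
  rw [vonNeumannEntropy_eq_cfc h₀]
  refine ((continuous_trace_re.tendsto _).comp hcfc).congr' ?_
  filter_upwards [hH] with x hx
  exact (vonNeumannEntropy_eq_cfc hx).symm

end Limits

theorem vonNeumannEntropy_sub_le {Y Z : Matrix n n ℂ} (hY : Y.PosDef) (hZ : Z.PosDef) :
    vonNeumannEntropy Y - vonNeumannEntropy Z ≤ -((Y - Z) * (cfc Real.log Z + 1)).trace.re := by
  have hid : IsPositiveMap (LinearMap.id : Matrix n n ℂ →ₗ[ℂ] Matrix n n ℂ) := fun _ h => h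
  have h := hid.klein hY hZ one_pos
  simp only [LinearMap.id_apply, Real.log_one, Matrix.one_mul] at h
  simp only [vonNeumannEntropy, Matrix.mul_add, Matrix.sub_mul, Matrix.trace_add, Matrix.trace_sub,
    Matrix.mul_one, Complex.add_re, Complex.sub_re]
  linarith

theorem tendsto_vonNeumannEntropy_slope {X : Type*} {l : Filter X} {Y Z : X → Matrix n n ℂ}
    {h : X → ℝ} {A W : Matrix n n ℂ} (hW : W.PosDef) (hY : Tendsto Y l (𝓝 W))
    (hZ : Tendsto Z l (𝓝 W)) (hYH : ∀ᶠ x in l, (Y x).IsHermitian)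
    (hZH : ∀ᶠ x in l, (Z x).IsHermitian) (hh : ∀ᶠ x in l, 0 < h x)
    (hA : Tendsto (fun x => (h x)⁻¹ • (Y x - Z x)) l (𝓝 A)) :
    Tendsto (fun x => (vonNeumannEntropy (Y x) - vonNeumannEntropy (Z x)) / h x) l
      (𝓝 (-(A * (cfc Real.log W + 1)).trace.re)) := by
  have tendsto_bound : ∀ V : X → Matrix n n ℂ, Tendsto V l (𝓝 W) →
      (∀ᶠ x in l, (V x).IsHermitian) →
      Tendsto (fun x => -(((h x)⁻¹ • (Y x - Z x)) * (cfc Real.log (V x) + 1)).trace.re) l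
        (𝓝 (-(A * (cfc Real.log W + 1)).trace.re)) := fun V hV hVH =>
    ((continuous_trace_re.tendsto _).comp (hA.mul ((tendsto_log hV hVH hW).add_const 1))).neg
  refine tendsto_of_tendsto_of_tendsto_of_le_of_le' (tendsto_bound Y hY hYH)
    (tendsto_bound Z hZ hZH) ?_ ?_
  all_goals
    filter_upwards [eventually_posDef hY hYH hW, eventually_posDef hZ hZH hW, hh]
      with x hYx hZx hx
    rw [Matrix.smul_mul, Matrix.trace_smul, Complex.smul_re, smul_eq_mul, inv_mul_eq_div,
      ← neg_div]
    refine div_le_div_of_nonneg_right ?_ hx.le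
  · have hle := vonNeumannEntropy_sub_le hZx hYx
    rw [← neg_sub (Y x), Matrix.neg_mul, Matrix.trace_neg, Complex.neg_re] at hle
    linarith
  · exact vonNeumannEntropy_sub_le hYx hZx

theorem IsPositiveMap.vonNeumannEntropy_le_of_posDef {F : Matrix n n ℂ →ₗ[ℂ] Matrix n n ℂ}
    (hF : IsPositiveMap F) (htr : ∀ X, (F X).trace = X.trace) (hone : F 1 = 1)
    {A : Matrix n n ℂ} (hA : A.PosDef) (hFA : (F A).PosDef) :
    vonNeumannEntropy A ≤ vonNeumannEntropy (F A) := by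
  have h := hF.klein hA hFA one_pos
  rw [htr, htr, hone, Matrix.one_mul, htr, Real.log_one] at h
  rw [vonNeumannEntropy, vonNeumannEntropy]
  linarith

theorem IsPositiveMap.vonNeumannEntropy_le {F : Matrix n n ℂ →ₗ[ℂ] Matrix n n ℂ}
    (hF : IsPositiveMap F) (htr : ∀ X, (F X).trace = X.trace) (hone : F 1 = 1)
    {A : Matrix n n ℂ} (hA : A.PosSemidef) : vonNeumannEntropy A ≤ vonNeumannEntropy (F A) := by
  have posDef_smul_one : ∀ ε : ℝ, 0 < ε → ((ε : ℂ) • (1 : Matrix n n ℂ)).PosDef := fun ε hε =>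
    Matrix.PosDef.one.smul (by exact_mod_cast hε)
  have tendsto_regularized : ∀ B : Matrix n n ℂ, B.PosSemidef →
      Tendsto (fun ε : ℝ => vonNeumannEntropy (B + (ε : ℂ) • 1)) (𝓝[>] 0)
        (𝓝 (vonNeumannEntropy B)) := by
    intro B hB
    have hcont : Continuous fun ε : ℝ => B + (ε : ℂ) • (1 : Matrix n n ℂ) := by fun_prop
    refine tendsto_vonNeumannEntropy
      ((hcont.tendsto' 0 B (by simp)).mono_left nhdsWithin_le_nhds) ?_ hB.1
    filter_upwards [self_mem_nhdsWithin] with ε hε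
    exact hB.1.add (posDef_smul_one ε hε).1
  refine le_of_tendsto_of_tendsto (tendsto_regularized A hA) (tendsto_regularized (F A) (hF A hA))
    (eventually_nhdsWithin_of_forall fun ε hε => ?_)
  have hmap : F (A + (ε : ℂ) • 1) = F A + (ε : ℂ) • 1 := by rw [map_add, map_smul, hone]
  simp only [← hmap]
  refine hF.vonNeumannEntropy_le_of_posDef htr hone
    (Matrix.PosDef.posSemidef_add hA (posDef_smul_one ε hε)) ?_
  rw [hmap]
  exact Matrix.PosDef.posSemidef_add (hF A hA) (posDef_smul_one ε hε)

end Entropy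

/-- The adjoint of a linear map on matrices for the bilinear pairing `(X, Y) ↦ tr (X Y)`. On
Hermiticity-preserving maps it is the Hilbert–Schmidt adjoint, which takes a generator from the
Schrödinger to the Heisenberg picture. -/
def traceAdjoint (F : Matrix n n ℂ →ₗ[ℂ] Matrix n n ℂ) : Matrix n n ℂ →ₗ[ℂ] Matrix n n ℂ where
  toFun X := Matrix.of fun i j => (X * F (Matrix.single j i 1)).trace
  map_add' X Y := by ext; simp [Matrix.add_mul]
  map_smul' a X := by ext; simp

theorem trace_traceAdjoint_mul (F : Matrix n n ℂ →ₗ[ℂ] Matrix n n ℂ) (X Z : Matrix n n ℂ) :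
    (traceAdjoint F X * Z).trace = (X * F Z).trace := by
  have hlin : Matrix.traceLinearMap n ℂ ℂ ∘ₗ LinearMap.mulLeft ℂ (traceAdjoint F X) =
      Matrix.traceLinearMap n ℂ ℂ ∘ₗ LinearMap.mulLeft ℂ X ∘ₗ F :=
    Matrix.ext_linearMap ℂ fun i j => LinearMap.ext_ring <| by
      simp [traceAdjoint, Matrix.trace_mul_single]
  exact LinearMap.congr_fun hlin Z

theorem traceAdjoint_conjTranspose {F : Matrix n n ℂ →ₗ[ℂ] Matrix n n ℂ}
    (hF : ∀ Z, F Zᴴ = (F Z)ᴴ) (X : Matrix n n ℂ) : traceAdjoint F Xᴴ = (traceAdjoint F X)ᴴ := by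
  refine Matrix.ext_iff_trace_mul_right.2 fun Z => ?_
  calc (traceAdjoint F Xᴴ * Z).trace = (Xᴴ * (F Zᴴ)ᴴ).trace := by
        rw [trace_traceAdjoint_mul, hF, Matrix.conjTranspose_conjTranspose]
    _ = star (traceAdjoint F X * Zᴴ).trace := by
        rw [Matrix.trace_mul_comm, ← Matrix.conjTranspose_mul, Matrix.trace_conjTranspose,
          trace_traceAdjoint_mul]
    _ = ((traceAdjoint F X)ᴴ * Z).trace := by
        rw [← Matrix.trace_conjTranspose, Matrix.conjTranspose_mul,
          Matrix.conjTranspose_conjTranspose, Matrix.trace_mul_comm]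

theorem sum_trace_eigenprojection_mul_map (F : Matrix n n ℂ →ₗ[ℂ] Matrix n n ℂ)
    {N : Matrix n n ℂ} (hN : N.IsHermitian) (Y Z : Matrix n n ℂ) :
    ∑ i, (eigenprojection hN i *
        F (((hN.eigenvalues i : ℂ) • 1 - Y) * Z * ((hN.eigenvalues i : ℂ) • 1 - Y))).trace =
      (N * N * F Z).trace - (N * F (Z * Y)).trace - (N * F (Y * Z)).trace +
        (F (Y * Z * Y)).trace := by
  have expand : ∀ i, (eigenprojection hN i *
      F (((hN.eigenvalues i : ℂ) • 1 - Y) * Z * ((hN.eigenvalues i : ℂ) • 1 - Y))).trace =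
      ((((hN.eigenvalues i : ℂ) * hN.eigenvalues i) • eigenprojection hN i) * F Z).trace -
        (((hN.eigenvalues i : ℂ) • eigenprojection hN i) * F (Z * Y)).trace -
        (((hN.eigenvalues i : ℂ) • eigenprojection hN i) * F (Y * Z)).trace +
        (eigenprojection hN i * F (Y * Z * Y)).trace := by
    intro i
    simp only [Matrix.sub_mul, Matrix.mul_sub, Matrix.smul_mul, Matrix.mul_smul, Matrix.one_mul,
      Matrix.mul_one, map_sub, map_smul, Matrix.trace_sub, Matrix.trace_smul, smul_sub, smul_eq_mul]
    ring
  simp only [expand, Finset.sum_add_distrib, Finset.sum_sub_distrib, ← Matrix.trace_sum,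
    ← Finset.sum_mul, sum_eigenprojection, sum_eigenvalues_smul_eigenprojection,
    sum_eigenvalues_sq_smul_eigenprojection, Matrix.one_mul]

theorem IsPositiveMap.kadison {F : Matrix n n ℂ →ₗ[ℂ] Matrix n n ℂ}
    (hF : IsPositiveMap F) (htr : ∀ X, (F X).trace = X.trace) {N Z : Matrix n n ℂ}
    (hN : N.IsHermitian) (hZ : Z.PosSemidef) :
    (traceAdjoint F N * traceAdjoint F N * Z).trace.re ≤ (N * N * F Z).trace.re := by
  set Y := traceAdjoint F N with hY
  have hYH : Yᴴ = Y := by rw [hY, ← traceAdjoint_conjTranspose hF.map_conjTranspose, hN.eq]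
  have hsum : ∑ i, (eigenprojection hN i *
      F (((hN.eigenvalues i : ℂ) • 1 - Y) * Z * ((hN.eigenvalues i : ℂ) • 1 - Y))).trace =
      (N * N * F Z).trace - (Y * Y * Z).trace := by
    rw [sum_trace_eigenprojection_mul_map, htr (Y * Z * Y), ← trace_traceAdjoint_mul F N (Z * Y),
      ← trace_traceAdjoint_mul F N (Y * Z), ← hY, ← Matrix.mul_assoc, ← Matrix.mul_assoc]
    ring
  have hpos : 0 ≤ ∑ i, (eigenprojection hN i *
      F (((hN.eigenvalues i : ℂ) • 1 - Y) * Z * ((hN.eigenvalues i : ℂ) • 1 - Y))).trace.re := by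
    refine Finset.sum_nonneg fun i _ => re_trace_mul_nonneg (posSemidef_eigenprojection hN i) ?_
    have hH : ((hN.eigenvalues i : ℂ) • 1 - Y)ᴴ = (hN.eigenvalues i : ℂ) • 1 - Y := by
      simp [hYH]
    have hconj := hZ.mul_mul_conjTranspose_same ((hN.eigenvalues i : ℂ) • 1 - Y)
    rw [hH] at hconj
    exact hF _ hconj
  rw [← Complex.re_sum, hsum, Complex.sub_re] at hpos
  linarith

end PositiveMap

section Flow

theorem norm_pow_sub_pow_le {R : Type*} [NormedRing R] {x y : R} {κ : ℝ} (hx : ‖x‖ ≤ κ)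
    (hy : ‖y‖ ≤ κ) (N : ℕ) : ‖x ^ N - y ^ N‖ ≤ N * κ ^ (N - 1) * ‖x - y‖ := by
  have hκ : 0 ≤ κ := (norm_nonneg x).trans hx
  induction N with
  | zero => simp
  | succ N ih =>
    have hpow : κ * (N * κ ^ (N - 1)) = N * κ ^ N := by
      rcases N with _ | N
      · simp
      · rw [Nat.add_sub_cancel, pow_succ]; ring
    have hleft : ‖x * (x ^ N - y ^ N)‖ ≤ κ * (N * κ ^ (N - 1) * ‖x - y‖) :=
      (norm_mul_le _ _).trans (mul_le_mul hx ih (norm_nonneg _) hκ)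
    have hright : ‖(x - y) * y ^ N‖ ≤ ‖x - y‖ * κ ^ N := by
      rcases N.eq_zero_or_pos with rfl | hN
      · simp
      · exact (norm_mul_le _ _).trans (mul_le_mul_of_nonneg_left
          ((norm_pow_le' y hN).trans (pow_le_pow_left₀ (norm_nonneg y) hy N)) (norm_nonneg _))
    calc ‖x ^ (N + 1) - y ^ (N + 1)‖ = ‖x * (x ^ N - y ^ N) + (x - y) * y ^ N‖ := by
          rw [pow_succ', pow_succ']; noncomm_ring
      _ ≤ κ * (N * κ ^ (N - 1) * ‖x - y‖) + ‖x - y‖ * κ ^ N :=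
          (norm_add_le _ _).trans (add_le_add hleft hright)
      _ = (N + 1 : ℕ) * κ ^ (N + 1 - 1) * ‖x - y‖ := by
          rw [← mul_assoc, hpow, Nat.add_sub_cancel]; push_cast; ring

variable {E : Type*} [NormedAddCommGroup E] [NormedSpace ℝ E]

theorem flow_zero (A : E →L[ℝ] E) (v : E) : NormedSpace.exp ((0 : ℝ) • A) v = v := by
  simp [NormedSpace.exp_zero]

theorem norm_one_add_smul_add_sq_smul_le (A B : E →L[ℝ] E) {h τ : ℝ} (hh : 0 ≤ h)
    (hτ : h ≤ τ) : ‖1 + h • A + h ^ 2 • B‖ ≤ Real.exp (h * (‖A‖ + τ * ‖B‖)) :=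
  calc ‖1 + h • A + h ^ 2 • B‖ ≤ 1 + h * ‖A‖ + h ^ 2 * ‖B‖ := by
        refine norm_add₃_le.trans
          (add_le_add (add_le_add ContinuousLinearMap.norm_id_le ?_) ?_)
        · rw [norm_smul, Real.norm_of_nonneg hh]
        · rw [norm_smul, Real.norm_of_nonneg (by positivity)]
    _ ≤ 1 + h * ‖A‖ + h * τ * ‖B‖ := by rw [pow_two]; gcongr
    _ = h * (‖A‖ + τ * ‖B‖) + 1 := by ring
    _ ≤ Real.exp (h * (‖A‖ + τ * ‖B‖)) := Real.add_one_le_exp _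

variable [CompleteSpace E]

theorem hasDerivAt_flow (A : E →L[ℝ] E) (v : E) (t : ℝ) :
    HasDerivAt (fun s : ℝ => NormedSpace.exp (s • A) v) (A (NormedSpace.exp (t • A) v)) t :=
  ((hasDerivAt_exp_smul_const' (𝕂 := ℝ) A t).clm_apply (hasDerivAt_const t v)).congr_deriv
    (by simp)

theorem exp_smul_exp_neg_smul (A : E →L[ℝ] E) (t : ℝ) (v : E) :
    NormedSpace.exp (t • A) (NormedSpace.exp ((-t) • A) v) = v := by
  let : NormedAlgebra ℚ (E →L[ℝ] E) := .restrictScalars ℚ ℝ _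
  rw [← mul_apply_eq_comp,
    ← NormedSpace.exp_add_of_commute ((Commute.refl A).smul_left t |>.smul_right (-t)),
    ← add_smul, add_neg_cancel, zero_smul, NormedSpace.exp_zero, one_apply_eq_self]

theorem hasDerivWithinAt_exp_neg_smul {A : E →L[ℝ] E} {u : ℝ → E} {f : E} {s : Set ℝ} {t : ℝ}
    (hu : HasDerivWithinAt u (A (u t) + f) s t) :
    HasDerivWithinAt (fun r => NormedSpace.exp ((-r) • A) (u r)) (NormedSpace.exp ((-t) • A) f)
      s t := by
  have hexp : HasDerivAt (fun r : ℝ => NormedSpace.exp ((-r) • A))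
      (-(NormedSpace.exp ((-t) • A) * A)) t :=
    ((hasDerivAt_exp_smul_const (𝕂 := ℝ) A (-t)).scomp t (hasDerivAt_neg t)).congr_deriv
      (by simp)
  exact (hexp.hasDerivWithinAt.clm_apply hu).congr_deriv (by simp)

theorem eq_flow_add_integral {A : E →L[ℝ] E} {u f : ℝ → E} {τ : ℝ}
    (hu : ∀ t ∈ Set.Icc 0 τ, HasDerivWithinAt u (A (u t) + f t) (Set.Icc 0 τ) t)
    (hf : IntervalIntegrable (fun s => NormedSpace.exp ((-s) • A) (f s))
      MeasureTheory.volume 0 τ) {t : ℝ} (ht : t ∈ Set.Icc 0 τ) :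
    u t = NormedSpace.exp (t • A)
      (u 0 + ∫ s in (0 : ℝ)..t, NormedSpace.exp ((-s) • A) (f s)) := by
  have hg (s) (hs : s ∈ Set.Icc 0 τ) := hasDerivWithinAt_exp_neg_smul (hu s hs)
  have hsub : Set.uIcc 0 t ⊆ Set.uIcc 0 τ := by
    rw [Set.uIcc_of_le ht.1, Set.uIcc_of_le (ht.1.trans ht.2)]
    exact Set.Icc_subset_Icc_right ht.2
  rw [intervalIntegral.integral_eq_sub_of_hasDerivAt_of_le ht.1
    (fun s hs => (hg s ⟨hs.1, hs.2.trans ht.2⟩).continuousWithinAt.mono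
      (Set.Icc_subset_Icc_right ht.2))
    (fun s hs => (hg s ⟨hs.1.le, hs.2.le.trans ht.2⟩).hasDerivAt
      (Icc_mem_nhds hs.1 (hs.2.trans_le ht.2))) (hf.mono_set hsub)]
  simp only [neg_zero, flow_zero, add_sub_cancel, exp_smul_exp_neg_smul]

theorem eq_flow {A : E →L[ℝ] E} {u : ℝ → E} {τ : ℝ}
    (hu : ∀ t ∈ Set.Icc 0 τ, HasDerivWithinAt u (A (u t)) (Set.Icc 0 τ) t) {t : ℝ}
    (ht : t ∈ Set.Icc 0 τ) : u t = NormedSpace.exp (t • A) (u 0) := by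
  simpa using eq_flow_add_integral (f := fun _ => (0 : E)) (A := A) (u := u) (by simpa using hu)
    (by simp) ht

theorem exists_hasDerivAt_affine (A : E →L[ℝ] E) (b : E) :
    ∃ u : ℝ → E, u 0 = 0 ∧ ∀ t, HasDerivAt u (A (u t) + b) t := by
  have hcont : Continuous fun s : ℝ => NormedSpace.exp (s • A) b :=
    continuous_iff_continuousAt.2 fun s => (hasDerivAt_flow A b s).continuousAt
  refine ⟨fun t => ∫ s in (0 : ℝ)..t, NormedSpace.exp (s • A) b, by simp, fun t => ?_⟩
  have hA : A (∫ s in (0 : ℝ)..t, NormedSpace.exp (s • A) b) = NormedSpace.exp (t • A) b - b := by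
    rw [← A.intervalIntegral_comp_comm (hcont.intervalIntegrable 0 t),
      intervalIntegral.integral_eq_sub_of_hasDerivAt (fun s _ => hasDerivAt_flow A b s)
        ((A.continuous.comp hcont).intervalIntegrable 0 t), flow_zero]
  rw [hA, sub_add_cancel]
  exact (hcont.integral_hasStrictDerivAt 0 t).hasDerivAt

theorem norm_exp_smul_le (A : E →L[ℝ] E) {h : ℝ} (hh : 0 ≤ h) :
    ‖NormedSpace.exp (h • A)‖ ≤ Real.exp (h * ‖A‖) := by
  have hd : ∀ t : ℝ, HasDerivAt (fun s : ℝ => NormedSpace.exp (s • A))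
      (A * NormedSpace.exp (t • A)) t := hasDerivAt_exp_smul_const' (𝕂 := ℝ) A
  have hexp := norm_le_gronwallBound_of_norm_deriv_right_le (δ := 1) (K := ‖A‖) (ε := 0)
    (fun t _ => (hd t).continuousAt.continuousWithinAt) (fun t _ => (hd t).hasDerivWithinAt)
    (by rw [zero_smul, NormedSpace.exp_zero]; exact ContinuousLinearMap.norm_id_le)
    (fun t _ => by simpa using norm_mul_le A _) h ⟨hh, le_rfl⟩
  rwa [gronwallBound_ε0, sub_zero, one_mul, mul_comm] at hexp

theorem exp_smul_eq_exp_smul_div_pow (A : E →L[ℝ] E) (τ : ℝ) {N : ℕ} (hN : N ≠ 0) :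
    NormedSpace.exp (τ • A) = NormedSpace.exp ((τ / N) • A) ^ N := by
  let : NormedAlgebra ℚ (E →L[ℝ] E) := .restrictScalars ℚ ℝ _
  rw [← NormedSpace.exp_nsmul, ← Nat.cast_smul_eq_nsmul ℝ, smul_smul,
    mul_div_cancel₀ τ (Nat.cast_ne_zero.2 hN)]

theorem norm_euler_sub_exp_le (A B : E →L[ℝ] E) {τ : ℝ} (hτ : 0 ≤ τ) {N : ℕ} (hN : N ≠ 0) :
    ‖(1 + (τ / N) • A + (τ / N) ^ 2 • B) ^ N - NormedSpace.exp (τ • A)‖ ≤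
      Real.exp (τ * (‖A‖ + τ * ‖B‖)) *
        (N * ‖1 + (τ / N) • A + (τ / N) ^ 2 • B - NormedSpace.exp ((τ / N) • A)‖) := by
  set h := τ / N
  set κ := ‖A‖ + τ * ‖B‖
  have hN1 : (1 : ℝ) ≤ N := by exact_mod_cast Nat.one_le_iff_ne_zero.2 hN
  have hh : 0 ≤ h := by positivity
  have hNh : N * h = τ := mul_div_cancel₀ τ (Nat.cast_ne_zero.2 hN)
  have _hκ : 0 ≤ κ := by positivity
  have hexp : ‖NormedSpace.exp (h • A)‖ ≤ Real.exp (h * κ) :=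
    (norm_exp_smul_le A hh).trans (Real.exp_le_exp.2
      (mul_le_mul_of_nonneg_left (le_add_of_nonneg_right (by positivity)) hh))
  have hpow : Real.exp (h * κ) ^ (N - 1) ≤ Real.exp (τ * κ) := by
    rw [← hNh, mul_assoc, Real.exp_nat_mul]
    exact pow_le_pow_right₀ (Real.one_le_exp (by positivity)) (Nat.sub_le N 1)
  rw [exp_smul_eq_exp_smul_div_pow A τ hN]
  refine (norm_pow_sub_pow_le
    (norm_one_add_smul_add_sq_smul_le A B hh (div_le_self hτ hN1)) hexp N).trans ?_
  rw [mul_comm (N : ℝ), mul_assoc]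
  gcongr

theorem tendsto_euler (A B : E →L[ℝ] E) {τ : ℝ} (hτ : 0 < τ) :
    Tendsto (fun N : ℕ => (1 + (τ / N) • A + (τ / N) ^ 2 • B) ^ N) atTop
      (𝓝 (NormedSpace.exp (τ • A))) := by
  set d : ℝ → E →L[ℝ] E := fun h => 1 + h • A + h ^ 2 • B - NormedSpace.exp (h • A)
  have hd : HasDerivAt d 0 0 := by
    have hstep : HasDerivAt (fun h : ℝ => 1 + h • A + h ^ 2 • B) A 0 :=
      ((((hasDerivAt_id (0 : ℝ)).smul_const A).const_add (1 : E →L[ℝ] E)).add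
        (((hasDerivAt_id (0 : ℝ)).pow 2).smul_const B)).congr_deriv (by simp)
    exact (hstep.sub (hasDerivAt_exp_smul_const' (𝕂 := ℝ) A 0)).congr_deriv
      (by simp [NormedSpace.exp_zero])
  have hh : Tendsto (fun N : ℕ => τ / (N : ℝ)) atTop (𝓝[≠] 0) := by
    refine tendsto_nhdsWithin_iff.2 ⟨tendsto_const_div_atTop_nhds_zero_nat τ, ?_⟩
    filter_upwards [eventually_gt_atTop 0] with N hN
    exact (div_pos hτ (Nat.cast_pos.2 hN)).ne'
  have hslope := ((hd.tendsto_slope.comp hh).norm.const_mul τ).const_mul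
    (Real.exp (τ * (‖A‖ + τ * ‖B‖)))
  rw [tendsto_iff_norm_sub_tendsto_zero]
  refine squeeze_zero' (Eventually.of_forall fun _ => norm_nonneg _) ?_
    (by simpa only [norm_zero, mul_zero] using hslope)
  filter_upwards [eventually_gt_atTop 0] with N hN
  have hN0 : (0 : ℝ) < N := Nat.cast_pos.2 hN
  refine (norm_euler_sub_exp_le A B hτ.le hN.ne').trans_eq ?_
  have hd0 : d 0 = 0 := by simp [d, NormedSpace.exp_zero]
  rw [Function.comp_apply, slope_def_module, hd0, sub_zero, sub_zero, norm_smul, norm_inv,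
    Real.norm_of_nonneg (div_pos hτ hN0).le, ← mul_assoc τ, inv_div, mul_div_cancel₀ _ hτ.ne']

end Flow

/-- A complex linear map between finite-dimensional complex spaces as a continuous real linear
map: states depend on a real time, so their evolution is real analysis. -/
noncomputable def realCLM {E E' : Type*} [NormedAddCommGroup E] [NormedSpace ℂ E]
    [FiniteDimensional ℂ E] [NormedAddCommGroup E'] [NormedSpace ℂ E'] (T : E →ₗ[ℂ] E') :
    E →L[ℝ] E' :=
  (LinearMap.toContinuousLinearMap T).restrictScalars ℝ

@[simp]
theorem realCLM_apply {E E' : Type*} [NormedAddCommGroup E] [NormedSpace ℂ E]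
    [FiniteDimensional ℂ E] [NormedAddCommGroup E'] [NormedSpace ℂ E'] (T : E →ₗ[ℂ] E')
    (x : E) : realCLM T x = T x := rfl

/-! ### Moments of the current -/

namespace FeedbackSystem

variable {n K : Type*} [Fintype n] [DecidableEq n] (S : FeedbackSystem n K)

/-- The unnormalised effect `X ↦ F_k (L_k X L_k†)` of a jump in channel `k` together with its
feedback, as a linear map. -/
noncomputable def jump (k : K) : Matrix n n ℂ →ₗ[ℂ] Matrix n n ℂ := S.F k ∘ₗ conjMap (S.L k)

theorem jump_apply (k : K) (X : Matrix n n ℂ) : S.jump k X = S.F k (S.L k * X * (S.L k)ᴴ) := rfl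

theorem trace_jump (k : K) (X : Matrix n n ℂ) :
    (S.jump k X).trace = (S.L k * X * (S.L k)ᴴ).trace :=
  (S.isUnitalCPTP_F k).tracePreserving _

theorem rate_eq_trace_jump (k : K) (X : Matrix n n ℂ) :
    S.rate X k = (S.jump k X).trace.re := by
  rw [trace_jump, rate]

variable [Fintype K]

/-- The generator of the unperturbed master equation, bundled as a linear map. -/
noncomputable def gen : Matrix n n ℂ →ₗ[ℂ] Matrix n n ℂ where
  toFun := S.generator S.L
  map_add' X Y := by
    simp only [generator, Matrix.mul_add, Matrix.add_mul, map_add, smul_add, smul_sub,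
      Finset.sum_add_distrib, Finset.sum_sub_distrib]
    abel
  map_smul' a X := by
    simp only [generator, Matrix.mul_smul, Matrix.smul_mul, map_smul, smul_add, smul_sub,
      RingHom.id_apply, Finset.smul_sum, smul_comm a]

theorem gen_apply (X : Matrix n n ℂ) : S.gen X = S.generator S.L X := rfl

/-- The superoperator `∑ k, c k • jump k`, whose trace against a state is the instantaneous mean
current. -/
noncomputable def weightedJump (c : K → ℝ) : Matrix n n ℂ →ₗ[ℂ] Matrix n n ℂ :=
  ∑ k, (c k : ℂ) • S.jump k

theorem weightedJump_apply (c : K → ℝ) (X : Matrix n n ℂ) :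
    S.weightedJump c X = ∑ k, (c k : ℂ) • S.jump k X := by
  simp [weightedJump]

theorem re_trace_weightedJump (c : K → ℝ) (X : Matrix n n ℂ) :
    (S.weightedJump c X).trace.re = ∑ k, c k * S.rate X k := by
  rw [weightedJump_apply, Matrix.trace_sum, Complex.re_sum]
  refine Finset.sum_congr rfl fun k _ => ?_
  rw [Matrix.trace_smul, smul_eq_mul, Complex.re_ofReal_mul, rate_eq_trace_jump]

/-- The operator `G = i H + ½ ∑ k, L_k† L_k` of the no-jump evolution `X ↦ -(G X + X G†)`; the
Kraus operator of a step without a jump is `1 - h G`. -/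
noncomputable def decay : Matrix n n ℂ := Complex.I • S.H + (1 / 2 : ℂ) • ∑ k, (S.L k)ᴴ * S.L k

theorem decay_conjTranspose :
    S.decayᴴ = -Complex.I • S.H + (1 / 2 : ℂ) • ∑ k, (S.L k)ᴴ * S.L k := by
  rw [decay, Matrix.conjTranspose_add, Matrix.conjTranspose_smul, Matrix.conjTranspose_smul,
    Matrix.conjTranspose_sum, S.isHermitian_H]
  simp [Matrix.conjTranspose_mul]

theorem gen_eq (X : Matrix n n ℂ) :
    S.gen X = ∑ k, S.jump k X - (S.decay * X + X * S.decayᴴ) := by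
  rw [gen_apply, generator, decay_conjTranspose, decay]
  simp only [jump_apply, Matrix.add_mul, Matrix.mul_add, Matrix.smul_mul, Matrix.mul_smul,
    Finset.sum_sub_distrib, Finset.sum_add_distrib, ← Finset.smul_sum, Finset.sum_mul,
    Finset.mul_sum, smul_add, smul_sub, neg_smul, Matrix.mul_neg]
  abel

/-- The unnormalised effect of a measurement step of duration `h` with the given outcome, followed
by feedback, as a linear map. -/
noncomputable def stepMap (h : ℝ) : Option K → (Matrix n n ℂ →ₗ[ℂ] Matrix n n ℂ)
  | none => conjMap (S.kraus h none)
  | some k => S.F k ∘ₗ conjMap (S.kraus h (some k))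

theorem feedback_kraus (h : ℝ) (a : Option K) (X : Matrix n n ℂ) :
    S.feedback a (S.kraus h a * X * (S.kraus h a)ᴴ) = S.stepMap h a X := by
  cases a <;> rfl

theorem kraus_some_conj {h : ℝ} (hh : 0 ≤ h) (k : K) (X : Matrix n n ℂ) :
    S.kraus h (some k) * X * (S.kraus h (some k))ᴴ = (h : ℂ) • (S.L k * X * (S.L k)ᴴ) := by
  have hsqrt : (Real.sqrt h : ℂ) * (Real.sqrt h : ℂ) = h := by
    exact_mod_cast Real.mul_self_sqrt hh
  rw [kraus, Matrix.conjTranspose_smul]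
  simp only [Matrix.smul_mul, Matrix.mul_smul, smul_smul, Complex.star_def, Complex.conj_ofReal,
    hsqrt]

theorem stepMap_some {h : ℝ} (hh : 0 ≤ h) (k : K) (X : Matrix n n ℂ) :
    S.stepMap h (some k) X = (h : ℂ) • S.jump k X := by
  rw [← feedback_kraus, kraus_some_conj S hh, jump_apply]
  exact map_smul _ _ _

theorem stepMap_none (h : ℝ) (X : Matrix n n ℂ) :
    S.stepMap h none X = X - (h : ℂ) • (S.decay * X + X * S.decayᴴ) +
      ((h : ℂ) ^ 2) • (S.decay * X * S.decayᴴ) := by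
  have hkraus : S.kraus h none = 1 - (h : ℂ) • S.decay := rfl
  rw [← feedback_kraus, hkraus, feedback, Matrix.conjTranspose_sub, Matrix.conjTranspose_smul,
    Matrix.conjTranspose_one]
  simp only [Matrix.sub_mul, Matrix.mul_sub, Matrix.smul_mul, Matrix.mul_smul, Matrix.one_mul,
    Matrix.mul_one, Complex.star_def, Complex.conj_ofReal, smul_add, smul_smul, smul_sub, pow_two]
  abel

theorem sum_stepMap {h : ℝ} (hh : 0 ≤ h) (X : Matrix n n ℂ) :
    ∑ a, S.stepMap h a X = X + (h : ℂ) • S.gen X + ((h : ℂ) ^ 2) • conjMap S.decay X := by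
  rw [Fintype.sum_option, stepMap_none, gen_eq, conjMap_apply]
  simp only [S.stepMap_some hh, ← Finset.smul_sum, smul_sub]
  abel

/-- The `j`-th moment of the current after `N` steps of duration `h`, with the unnormalised final
state in place of the probability of a trajectory; its trace is the `j`-th moment. Unlike the
scalar moments, these satisfy a recursion in `N`. -/
noncomputable def stateMoment (c : K → ℝ) (h : ℝ) (j N : ℕ) : Matrix n n ℂ :=
  ∑ Γ : Fin N → Option K, ((current c Γ : ℂ) ^ j) • S.trajectoryState h (List.ofFn Γ)

theorem re_trace_stateMoment (c : K → ℝ) (τ : ℝ) (m N : ℕ) :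
    (S.stateMoment c (τ / N) m N).trace.re = S.discreteMoment c τ m N := by
  rw [stateMoment, Matrix.trace_sum, Complex.re_sum, discreteMoment]
  refine Finset.sum_congr rfl fun Γ _ => ?_
  rw [Matrix.trace_smul, smul_eq_mul, ← Complex.ofReal_pow, Complex.re_ofReal_mul, trajectoryProb]

theorem stateMoment_succ (c : K → ℝ) (h : ℝ) (j N : ℕ) :
    S.stateMoment c h j (N + 1) = ∑ a : Option K, ∑ Γ : Fin N → Option K,
      (((current c Γ + a.elim 0 c : ℝ) : ℂ) ^ j) •
        S.stepMap h a (S.trajectoryState h (List.ofFn Γ)) := by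
  rw [stateMoment, ← (Fin.snocEquiv (fun _ => Option K)).sum_comp, Fintype.sum_prod_type]
  refine Finset.sum_congr rfl fun a _ => Finset.sum_congr rfl fun Γ _ => ?_
  have hcurrent : current c (Fin.snoc (α := fun _ => Option K) Γ a) = current c Γ + a.elim 0 c := by
    simp [current, Fin.sum_univ_castSucc]
  have hstate : S.trajectoryState h (List.ofFn (Fin.snoc (α := fun _ => Option K) Γ a)) =
      S.stepMap h a (S.trajectoryState h (List.ofFn Γ)) := by
    rw [← feedback_kraus, List.ofFn_succ']
    simp [trajectoryState, List.concat_eq_append]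
  simp only [Fin.snocEquiv, Equiv.coe_fn_mk]
  rw [hcurrent, hstate]

theorem sum_weight_stepMap {h : ℝ} (hh : 0 ≤ h) (c : K → ℝ) (X : Matrix n n ℂ) :
    ∑ a : Option K, ((a.elim 0 c : ℝ) : ℂ) • S.stepMap h a X = (h : ℂ) • S.weightedJump c X := by
  rw [Fintype.sum_option]
  simp only [S.stepMap_some hh, Option.elim_none, Option.elim_some, Complex.ofReal_zero, zero_smul,
    zero_add, weightedJump_apply, Finset.smul_sum]
  exact Finset.sum_congr rfl fun k _ => smul_comm _ _ _

theorem sum_pow_weight_stepMap {h : ℝ} (hh : 0 ≤ h) (c : K → ℝ) {m : ℕ} (hm : m ≠ 0)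
    (X : Matrix n n ℂ) :
    ∑ a : Option K, ((a.elim 0 c : ℝ) : ℂ) ^ m • S.stepMap h a X =
      (h : ℂ) • S.weightedJump (fun k => c k ^ m) X := by
  rw [← S.sum_weight_stepMap hh]
  refine Finset.sum_congr rfl fun a _ => ?_
  cases a <;> simp [hm]

theorem stateMoment_succ_eq_sum (c : K → ℝ) {h : ℝ} (hh : 0 ≤ h) (j N : ℕ) :
    S.stateMoment c h j (N + 1) = S.stateMoment c h j N + (h : ℂ) • S.gen (S.stateMoment c h j N) +
      ((h : ℂ) ^ 2) • conjMap S.decay (S.stateMoment c h j N) +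
      (h : ℂ) • ∑ i ∈ Finset.range j,
        (j.choose i : ℂ) • S.weightedJump (fun k => c k ^ (j - i)) (S.stateMoment c h i N) := by
  have hexpand : S.stateMoment c h j (N + 1) = ∑ i ∈ Finset.range (j + 1), (j.choose i : ℂ) •
      ∑ a : Option K, ((a.elim 0 c : ℝ) : ℂ) ^ (j - i) •
        S.stepMap h a (S.stateMoment c h i N) := by
    rw [stateMoment_succ]
    simp only [Complex.ofReal_add, add_pow, Finset.sum_smul, stateMoment, map_sum,
      map_smul, Finset.smul_sum, smul_smul]
    refine (Finset.sum_congr rfl fun a _ => Finset.sum_comm).trans (Finset.sum_comm.trans ?_)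
    refine Finset.sum_congr rfl fun i _ => Finset.sum_congr rfl fun a _ =>
      Finset.sum_congr rfl fun Γ _ => ?_
    congr 1
    ring
  rw [hexpand, Finset.sum_range_succ, Nat.choose_self, Nat.sub_self, add_comm]
  simp only [pow_zero, Nat.cast_one, one_smul]
  rw [S.sum_stepMap hh, Finset.smul_sum]
  refine congrArg _ (Finset.sum_congr rfl fun i hi => ?_)
  rw [S.sum_pow_weight_stepMap hh c (Nat.sub_ne_zero_of_lt (Finset.mem_range.1 hi)), smul_comm]

variable (n) in
/-- The space of triples of state-valued moments of orders `0`, `1` and `2`. -/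
abbrev MomentSpace := Matrix n n ℂ × Matrix n n ℂ × Matrix n n ℂ

/-- The generator of the joint evolution of the state-valued moments of orders `0`, `1` and `2`:
each evolves under `gen` and is driven by the moments of lower order. -/
noncomputable def momentGen (c : K → ℝ) : MomentSpace n →ₗ[ℂ] MomentSpace n :=
  (S.gen ∘ₗ LinearMap.fst ℂ _ _).prod
    ((S.gen ∘ₗ LinearMap.fst ℂ _ _ ∘ₗ LinearMap.snd ℂ _ _ +
        S.weightedJump c ∘ₗ LinearMap.fst ℂ _ _).prod
      (S.gen ∘ₗ LinearMap.snd ℂ _ _ ∘ₗ LinearMap.snd ℂ _ _ +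
        ((2 : ℂ) • S.weightedJump c ∘ₗ LinearMap.fst ℂ _ _ ∘ₗ LinearMap.snd ℂ _ _ +
          S.weightedJump (fun k => c k ^ 2) ∘ₗ LinearMap.fst ℂ _ _)))

theorem momentGen_apply (c : K → ℝ) (x : MomentSpace n) :
    S.momentGen c x = (S.gen x.1, S.gen x.2.1 + S.weightedJump c x.1,
      S.gen x.2.2 + ((2 : ℂ) • S.weightedJump c x.2.1 +
        S.weightedJump (fun k => c k ^ 2) x.1)) := rfl

/-- The second-order term in the step length of the joint recursion for the state-valued moments,
which does not contribute in the continuous-time limit. -/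
noncomputable def momentRemainder : MomentSpace n →ₗ[ℂ] MomentSpace n :=
  (conjMap S.decay).prodMap ((conjMap S.decay).prodMap (conjMap S.decay))

theorem momentRemainder_apply (x : MomentSpace n) :
    S.momentRemainder x = (conjMap S.decay x.1, conjMap S.decay x.2.1, conjMap S.decay x.2.2) := rfl

/-- The state-valued moments of orders `0`, `1` and `2` in continuous time; that of order `0` is the
state itself. -/
noncomputable def moments (c : K → ℝ) (t : ℝ) : MomentSpace n :=
  NormedSpace.exp (t • realCLM (S.momentGen c)) (S.ρ₀, 0, 0)

theorem stateMoments_eq (c : K → ℝ) {h : ℝ} (hh : 0 ≤ h) (N : ℕ) :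
    ((S.stateMoment c h 0 N, S.stateMoment c h 1 N, S.stateMoment c h 2 N) : MomentSpace n) =
      ((1 + h • realCLM (S.momentGen c) + h ^ 2 • realCLM S.momentRemainder) ^ N) (S.ρ₀, 0, 0) := by
  induction N with
  | zero =>
    simp [stateMoment, current, trajectoryState]
  | succ N ih =>
    rw [pow_succ', mul_apply_eq_comp, ← ih]
    simp only [S.stateMoment_succ_eq_sum c hh]
    have hsmul : ∀ X : Matrix n n ℂ, h • X = (h : ℂ) • X := fun X => (Complex.coe_smul h X).symm
    have hsmul_sq : ∀ X : Matrix n n ℂ, h ^ 2 • X = (h : ℂ) ^ 2 • X := fun X => by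
      rw [← Complex.ofReal_pow, Complex.coe_smul]
    simp only [_root_.add_apply, _root_.smul_apply, realCLM_apply,
      one_apply_eq_self, momentGen_apply, momentRemainder_apply, Prod.smul_mk, Prod.mk_add_mk,
      hsmul, hsmul_sq]
    refine Prod.ext ?_ (Prod.ext ?_ ?_)
    · simp
    · simp
      abel
    · simp [Finset.sum_range_succ]
      abel

theorem tendsto_stateMoments (c : K → ℝ) {τ : ℝ} (hτ : 0 < τ) :
    Tendsto (fun N : ℕ => ((S.stateMoment c (τ / N) 0 N, S.stateMoment c (τ / N) 1 N,
      S.stateMoment c (τ / N) 2 N) : MomentSpace n)) atTop (𝓝 (S.moments c τ)) := by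
  have h := (tendsto_euler (realCLM (S.momentGen c)) (realCLM S.momentRemainder) hτ)
  have h2 := ((ContinuousLinearMap.apply ℝ (MomentSpace n)
    ((S.ρ₀, 0, 0) : MomentSpace n)).continuous.tendsto _).comp h
  refine h2.congr fun N => ?_
  rw [stateMoments_eq S c (by positivity)]
  rfl

theorem tendsto_discreteMoment_one (c : K → ℝ) {τ : ℝ} (hτ : 0 < τ) :
    Tendsto (S.discreteMoment c τ 1) atTop (𝓝 (S.moments c τ).2.1.trace.re) := by
  have h := ((continuous_trace_re.comp (continuous_fst.comp continuous_snd)).tendsto _).comp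
    (S.tendsto_stateMoments c hτ)
  exact h.congr fun N => S.re_trace_stateMoment c τ 1 N

theorem tendsto_discreteMoment_two (c : K → ℝ) {τ : ℝ} (hτ : 0 < τ) :
    Tendsto (S.discreteMoment c τ 2) atTop (𝓝 (S.moments c τ).2.2.trace.re) := by
  have h := ((continuous_trace_re.comp (continuous_snd.comp continuous_snd)).tendsto _).comp
    (S.tendsto_stateMoments c hτ)
  exact h.congr fun N => S.re_trace_stateMoment c τ 2 N

theorem meanCurrent_eq (c : K → ℝ) {τ : ℝ} (hτ : 0 < τ) :
    S.meanCurrent c τ = (S.moments c τ).2.1.trace.re :=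
  (S.tendsto_discreteMoment_one c hτ).limUnder_eq

theorem currentMoment_two_eq (c : K → ℝ) {τ : ℝ} (hτ : 0 < τ) :
    S.currentMoment c τ 2 = (S.moments c τ).2.2.trace.re :=
  (S.tendsto_discreteMoment_two c hτ).limUnder_eq

theorem hasDerivAt_moments (c : K → ℝ) (t : ℝ) :
    HasDerivAt (S.moments c) (S.momentGen c (S.moments c t)) t :=
  hasDerivAt_flow (realCLM (S.momentGen c)) (S.ρ₀, 0, 0) t

theorem moments_zero (c : K → ℝ) : S.moments c 0 = (S.ρ₀, 0, 0) := flow_zero _ _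

end FeedbackSystem

/-! ### A lower bound on the variance of the current -/

theorem exists_isHermitian_hasDerivAt {n : Type*} [Finite n] {T : Matrix n n ℂ →ₗ[ℂ] Matrix n n ℂ}
    (hT : ∀ Z, T Zᴴ = (T Z)ᴴ) {B : Matrix n n ℂ} (hB : B.IsHermitian) :
    ∃ Y : ℝ → Matrix n n ℂ, Y 0 = 0 ∧ (∀ t, (Y t).IsHermitian) ∧
      ∀ t, HasDerivAt Y (T (Y t) + B) t := by
  cases nonempty_fintype n
  classical
  obtain ⟨u, hu0, hu⟩ := exists_hasDerivAt_affine (realCLM T) B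
  -- The Hermitian part of any solution solves the equation as well.
  refine ⟨fun t => (1 / 2 : ℝ) • (u t + star (u t)), by simp [hu0], fun t => ?_, fun t => ?_⟩
  · simp [Matrix.IsHermitian, Matrix.star_eq_conjTranspose, add_comm]
  · refine (((hu t).add (hu t).star).const_smul (1 / 2 : ℝ)).congr_deriv ?_
    have hBstar : star B = B := hB
    have hTstar : star (T (u t)) = T (star (u t)) := (hT (u t)).symm
    rw [← realCLM_apply T (_ • _), map_smul, map_add, star_add, hBstar, realCLM_apply,
      realCLM_apply, hTstar]
    module

section TraceLemmas

variable {n : Type*} [Fintype n]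

theorem hasDerivAt_re_trace {u : ℝ → Matrix n n ℂ} {u' : Matrix n n ℂ} {t : ℝ}
    (hu : HasDerivAt u u' t) : HasDerivAt (fun s => (u s).trace.re) u'.trace.re t := by
  classical
  exact (Complex.reCLM.comp
    (realCLM (Matrix.traceLinearMap n ℂ ℂ))).hasFDerivAt.comp_hasDerivAt t hu

theorem sq_re_trace_mul_le {N ρ : Matrix n n ℂ} (hN : N.IsHermitian) (hρ : ρ.PosSemidef)
    (htr : ρ.trace = 1) : (N * ρ).trace.re ^ 2 ≤ (N * N * ρ).trace.re := by
  classical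
  set a := (N * ρ).trace.re with ha
  have hvar := (Complex.nonneg_iff.1
    (hρ.mul_mul_conjTranspose_same (N - (a : ℂ) • 1)).trace_nonneg).1
  have hNρN : (N * ρ * N).trace = (N * N * ρ).trace := by
    rw [Matrix.trace_mul_comm, ← Matrix.mul_assoc]
  have hρN : (ρ * N).trace.re = a := by rw [Matrix.trace_mul_comm]
  rw [Matrix.conjTranspose_sub, hN, Matrix.conjTranspose_smul, Matrix.conjTranspose_one] at hvar
  simp only [Matrix.sub_mul, Matrix.mul_sub, Matrix.smul_mul, Matrix.mul_smul, Matrix.one_mul,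
    Matrix.mul_one, Matrix.trace_sub, Matrix.trace_smul, Complex.star_def, Complex.conj_ofReal,
    smul_eq_mul, Complex.sub_re, Complex.re_ofReal_mul, htr, hNρN, hρN, Complex.one_re,
    ← ha] at hvar
  linarith

end TraceLemmas

namespace FeedbackSystem

section

variable {n K : Type*} [Fintype n] [DecidableEq n] (S : FeedbackSystem n K)

theorem isPositiveMap_F (k : K) : IsPositiveMap (S.F k) :=
  (S.isUnitalCPTP_F k).completelyPositive.isPositiveMap

theorem isPositiveMap_jump (k : K) : IsPositiveMap (S.jump k) := fun X hX =>
  S.isPositiveMap_F k _ (isPositiveMap_conjMap _ X hX)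

/-- The operator `(c_k + F_k†[N]) L_k - L_k N`, with `F_k†` the trace adjoint of `F_k`. When `N` is
the expected future current, it measures by how much a jump in channel `k`, counted as `c_k`,
changes the expectation of the total current. -/
noncomputable def jumpDefect (c : K → ℝ) (N : Matrix n n ℂ) (k : K) : Matrix n n ℂ :=
  ((c k : ℂ) • 1 + traceAdjoint (S.F k) N) * S.L k - S.L k * N

theorem trace_jumpDefect (c : K → ℝ) {N : Matrix n n ℂ} (hN : N.IsHermitian) (X : Matrix n n ℂ)
    (k : K) :
    (S.jumpDefect c N k * X * (S.jumpDefect c N k)ᴴ).trace =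
      (c k : ℂ) ^ 2 * (S.L k * X * (S.L k)ᴴ).trace + 2 * ((c k : ℂ) * (N * S.jump k X).trace) -
        (c k : ℂ) * (S.L k * (N * X) * (S.L k)ᴴ).trace -
        (c k : ℂ) * (S.L k * (X * N) * (S.L k)ᴴ).trace -
        (N * S.jump k (N * X)).trace - (N * S.jump k (X * N)).trace +
        (traceAdjoint (S.F k) N * traceAdjoint (S.F k) N * (S.L k * X * (S.L k)ᴴ)).trace +
        (S.L k * N * X * N * (S.L k)ᴴ).trace := by
  simp only [jump_apply, ← trace_traceAdjoint_mul (S.F k) N]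
  have hYconj := traceAdjoint_conjTranspose (S.isPositiveMap_F k).map_conjTranspose N
  set Y := traceAdjoint (S.F k) N with hY
  have hYH : Yᴴ = Y := by rw [← hYconj, hN.eq, hY]
  have hcyc (Z : Matrix n n ℂ) : (Z * ((S.L k)ᴴ * Y)).trace = (Y * (Z * (S.L k)ᴴ)).trace := by
    rw [← Matrix.mul_assoc, Matrix.trace_mul_comm]
  have hD : S.jumpDefect c N k = (c k : ℂ) • S.L k + Y * S.L k - S.L k * N := by
    rw [jumpDefect, ← hY, Matrix.add_mul, Matrix.smul_mul, Matrix.one_mul]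
  have hDH : (S.jumpDefect c N k)ᴴ = (c k : ℂ) • (S.L k)ᴴ + (S.L k)ᴴ * Y - N * (S.L k)ᴴ := by
    rw [hD, Matrix.conjTranspose_sub, Matrix.conjTranspose_add, Matrix.conjTranspose_smul,
      Matrix.conjTranspose_mul, Matrix.conjTranspose_mul, hYH, hN.eq, Complex.star_def,
      Complex.conj_ofReal]
  rw [hDH, hD]
  simp only [Matrix.add_mul, Matrix.sub_mul, Matrix.mul_add, Matrix.mul_sub, Matrix.smul_mul,
    Matrix.mul_smul, Matrix.trace_add, Matrix.trace_sub, Matrix.trace_smul, smul_eq_mul, hcyc]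
  simp only [Matrix.mul_assoc]
  ring

theorem re_trace_jumpDefect_le (c : K → ℝ) {N X : Matrix n n ℂ} (hN : N.IsHermitian)
    (hX : X.PosSemidef) (k : K) :
    (S.jumpDefect c N k * X * (S.jumpDefect c N k)ᴴ).trace.re ≤
      c k ^ 2 * S.rate X k + 2 * (c k * (N * S.jump k X).trace.re) - c k * S.rate (N * X) k -
        c k * S.rate (X * N) k - (N * S.jump k (N * X)).trace.re -
        (N * S.jump k (X * N)).trace.re + (N * N * S.jump k X).trace.re +
        (S.L k * N * X * N * (S.L k)ᴴ).trace.re := by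
  have hkadison := (S.isPositiveMap_F k).kadison (S.isUnitalCPTP_F k).tracePreserving hN
    (hX.mul_mul_conjTranspose_same (S.L k))
  rw [← jump_apply] at hkadison
  rw [S.trace_jumpDefect c hN]
  simp only [Complex.sub_re, Complex.add_re, ← Complex.ofReal_pow, ← Complex.ofReal_ofNat,
    Complex.re_ofReal_mul, rate]
  linarith

variable [Fintype K]

theorem weightedJump_conjTranspose (c : K → ℝ) (Z : Matrix n n ℂ) :
    S.weightedJump c Zᴴ = (S.weightedJump c Z)ᴴ := by
  simp only [weightedJump_apply, Matrix.conjTranspose_sum, Matrix.conjTranspose_smul,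
    (S.isPositiveMap_jump _).map_conjTranspose, Complex.star_def, Complex.conj_ofReal]

theorem gen_conjTranspose (Z : Matrix n n ℂ) : S.gen Zᴴ = (S.gen Z)ᴴ := by
  simp only [gen_eq, Matrix.conjTranspose_sub, Matrix.conjTranspose_sum,
    (S.isPositiveMap_jump _).map_conjTranspose, Matrix.conjTranspose_add,
    Matrix.conjTranspose_mul, Matrix.conjTranspose_conjTranspose]
  rw [add_comm (Zᴴ * S.decayᴴ)]

theorem decay_add_conjTranspose : S.decay + S.decayᴴ = ∑ k, (S.L k)ᴴ * S.L k := by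
  rw [decay_conjTranspose, decay]
  module

theorem trace_gen (X : Matrix n n ℂ) : (S.gen X).trace = 0 := by
  have hjump : ∑ k, (S.jump k X).trace = ((S.decay + S.decayᴴ) * X).trace := by
    rw [decay_add_conjTranspose, Finset.sum_mul, Matrix.trace_sum]
    refine Finset.sum_congr rfl fun k _ => ?_
    rw [trace_jump, Matrix.trace_mul_comm, ← Matrix.mul_assoc]
  rw [gen_eq, Matrix.trace_sub, Matrix.trace_sum, hjump, Matrix.add_mul, Matrix.trace_add,
    Matrix.trace_add, Matrix.trace_mul_comm X, sub_self]

theorem re_trace_mul_gen (Q Z : Matrix n n ℂ) :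
    (Q * S.gen Z).trace.re =
      ∑ k, (Q * S.jump k Z).trace.re - (Q * (S.decay * Z + Z * S.decayᴴ)).trace.re := by
  rw [gen_eq, Matrix.mul_sub, Matrix.trace_sub, Finset.mul_sum, Matrix.trace_sum, Complex.sub_re,
    Complex.re_sum]

theorem re_trace_mul_weightedJump (c : K → ℝ) (Q Z : Matrix n n ℂ) :
    (Q * S.weightedJump c Z).trace.re = ∑ k, c k * (Q * S.jump k Z).trace.re := by
  simp only [weightedJump_apply, Finset.mul_sum, Matrix.trace_sum, Complex.re_sum,
    Matrix.mul_smul, Matrix.trace_smul, smul_eq_mul, Complex.re_ofReal_mul]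

theorem sum_trace_conj_L_mul (N X : Matrix n n ℂ) :
    ∑ k, (S.L k * N * X * N * (S.L k)ᴴ).trace =
      (N * (S.decay * (N * X) + N * X * S.decayᴴ)).trace +
        (N * (S.decay * (X * N) + X * N * S.decayᴴ)).trace -
        (N * N * (S.decay * X + X * S.decayᴴ)).trace := by
  have hleft : (N * (S.decay * (X * N))).trace = (N * N * (S.decay * X)).trace := by
    rw [← Matrix.mul_assoc S.decay, ← Matrix.mul_assoc N, Matrix.trace_mul_comm, ← Matrix.mul_assoc]
  have hright : (N * (N * X * S.decayᴴ)).trace = (N * N * (X * S.decayᴴ)).trace := by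
    simp only [Matrix.mul_assoc]
  have hmid : (N * (X * N * S.decayᴴ)).trace = (N * (S.decayᴴ * (N * X))).trace := by
    rw [← Matrix.mul_assoc N, Matrix.trace_mul_comm, ← Matrix.mul_assoc N X,
      ← Matrix.mul_assoc S.decayᴴ, Matrix.trace_mul_comm]
  have hL (k : K) : (S.L k * N * X * N * (S.L k)ᴴ).trace =
      (N * ((S.L k)ᴴ * S.L k * (N * X))).trace := by
    rw [Matrix.trace_mul_comm, ← Matrix.mul_assoc, Matrix.trace_mul_comm]
    simp only [Matrix.mul_assoc]
  simp only [Matrix.mul_add, Matrix.trace_add, hleft, hright, hmid, hL]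
  rw [← Matrix.trace_sum, ← Finset.mul_sum, ← Finset.sum_mul, ← decay_add_conjTranspose,
    Matrix.add_mul, Matrix.mul_add, Matrix.trace_add]
  ring

/-- The rate of change of the second moment of the predicted total current, when `X` is the state
and `N` the expected future current (see `IsFutureCurrent`). -/
noncomputable def secondMomentRate (c : K → ℝ) (N X : Matrix n n ℂ) : ℝ :=
  (S.weightedJump (fun k => c k ^ 2) X).trace.re + 2 * (N * S.weightedJump c X).trace.re -
    (S.weightedJump c (N * X)).trace.re - (S.weightedJump c (X * N)).trace.re -
    (N * S.gen (N * X)).trace.re - (N * S.gen (X * N)).trace.re + (N * N * S.gen X).trace.re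

theorem sum_re_trace_jumpDefect_le (c : K → ℝ) {N X : Matrix n n ℂ} (hN : N.IsHermitian)
    (hX : X.PosSemidef) :
    ∑ k, (S.jumpDefect c N k * X * (S.jumpDefect c N k)ᴴ).trace.re ≤ S.secondMomentRate c N X := by
  have hdecay := congrArg Complex.re (S.sum_trace_conj_L_mul N X)
  simp only [Complex.sub_re, Complex.add_re, Complex.re_sum] at hdecay
  simp only [secondMomentRate, re_trace_mul_gen, re_trace_mul_weightedJump, re_trace_weightedJump]
  refine (Finset.sum_le_sum fun k _ => S.re_trace_jumpDefect_le c hN hX k).trans_eq ?_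
  simp only [Finset.sum_add_distrib, Finset.sum_sub_distrib, ← Finset.mul_sum]
  linarith

/-- `N t` is the observable whose expectation in the state at time `t` is the mean current during
`[t, τ]`: a Hermitian solution of the inhomogeneous backward equation with final value `0`. -/
structure IsFutureCurrent (c : K → ℝ) (τ : ℝ) (N : ℝ → Matrix n n ℂ) : Prop where
  final : N τ = 0
  isHermitian : ∀ t, (N t).IsHermitian
  hasDerivAt : ∀ t,
    HasDerivAt N (-(traceAdjoint S.gen (N t) + traceAdjoint (S.weightedJump c) 1)) t

theorem exists_isFutureCurrent (c : K → ℝ) (τ : ℝ) : ∃ N, S.IsFutureCurrent c τ N := by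
  have hB : (traceAdjoint (S.weightedJump c) 1).IsHermitian := by
    rw [Matrix.IsHermitian, ← traceAdjoint_conjTranspose (S.weightedJump_conjTranspose c),
      Matrix.conjTranspose_one]
  obtain ⟨Y, hY0, hYh, hY⟩ :=
    exists_isHermitian_hasDerivAt (traceAdjoint_conjTranspose S.gen_conjTranspose) hB
  refine ⟨fun t => Y (τ - t), by rw [sub_self, hY0], fun t => hYh _, fun t => ?_⟩
  simpa [Function.comp_def, add_comm] using (hY (τ - t)).scomp t ((hasDerivAt_id t).const_sub τ)

theorem hasDerivAt_moments_fst (c : K → ℝ) (t : ℝ) :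
    HasDerivAt (fun t => (S.moments c t).1) (S.gen (S.moments c t).1) t :=
  (S.hasDerivAt_moments c t).fst

theorem hasDerivAt_moments_snd_fst (c : K → ℝ) (t : ℝ) :
    HasDerivAt (fun t => (S.moments c t).2.1)
      (S.gen (S.moments c t).2.1 + S.weightedJump c (S.moments c t).1) t :=
  HasFDerivAtFilter.fst (HasFDerivAtFilter.snd (S.hasDerivAt_moments c t))

theorem hasDerivAt_re_trace_moments_snd_fst (c : K → ℝ) (t : ℝ) :
    HasDerivAt (fun t => (S.moments c t).2.1.trace.re)
      (S.weightedJump c (S.moments c t).1).trace.re t := by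
  simpa [trace_gen] using hasDerivAt_re_trace (S.hasDerivAt_moments_snd_fst c t)

theorem hasDerivAt_re_trace_moments_snd_snd (c : K → ℝ) (t : ℝ) :
    HasDerivAt (fun t => (S.moments c t).2.2.trace.re)
      (2 * (S.weightedJump c (S.moments c t).2.1).trace.re +
        (S.weightedJump (fun k => c k ^ 2) (S.moments c t).1).trace.re) t := by
  simpa [trace_gen, momentGen_apply] using hasDerivAt_re_trace
    (HasFDerivAtFilter.snd (HasFDerivAtFilter.snd (S.hasDerivAt_moments c t)))

end

namespace IsFutureCurrent

variable {n K : Type*} [Fintype n] [DecidableEq n] [Fintype K] {S : FeedbackSystem n K}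
  {c : K → ℝ} {τ : ℝ} {N : ℝ → Matrix n n ℂ}

theorem hasDerivAt_re_trace_mul_fst (hN : S.IsFutureCurrent c τ N) (t : ℝ) :
    HasDerivAt (fun t => (N t * (S.moments c t).1).trace.re)
      (-(S.weightedJump c (S.moments c t).1).trace.re) t := by
  refine (hasDerivAt_re_trace
    ((hN.hasDerivAt t).mul (S.hasDerivAt_moments_fst c t))).congr_deriv ?_
  simp only [Matrix.neg_mul, Matrix.add_mul, Matrix.trace_add, Matrix.trace_neg,
    trace_traceAdjoint_mul, Matrix.one_mul, Complex.add_re, Complex.neg_re]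
  ring

theorem hasDerivAt_re_trace_mul_snd_fst (hN : S.IsFutureCurrent c τ N) (t : ℝ) :
    HasDerivAt (fun t => (N t * (S.moments c t).2.1).trace.re)
      ((N t * S.weightedJump c (S.moments c t).1).trace.re -
        (S.weightedJump c (S.moments c t).2.1).trace.re) t := by
  refine (hasDerivAt_re_trace
    ((hN.hasDerivAt t).mul (S.hasDerivAt_moments_snd_fst c t))).congr_deriv ?_
  simp only [Matrix.neg_mul, Matrix.add_mul, Matrix.mul_add, Matrix.trace_add, Matrix.trace_neg,
    trace_traceAdjoint_mul, Matrix.one_mul, Complex.add_re, Complex.neg_re]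
  ring

theorem hasDerivAt_re_trace_sq_mul_fst (hN : S.IsFutureCurrent c τ N) (t : ℝ) :
    HasDerivAt (fun t => (N t * N t * (S.moments c t).1).trace.re)
      (-(S.weightedJump c (N t * (S.moments c t).1)).trace.re -
        (S.weightedJump c ((S.moments c t).1 * N t)).trace.re -
        (N t * S.gen (N t * (S.moments c t).1)).trace.re -
        (N t * S.gen ((S.moments c t).1 * N t)).trace.re +
        (N t * N t * S.gen (S.moments c t).1).trace.re) t := by
  refine (hasDerivAt_re_trace (((hN.hasDerivAt t).mul (hN.hasDerivAt t)).mul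
    (S.hasDerivAt_moments_fst c t))).congr_deriv ?_
  set X := (S.moments c t).1
  have hleft (T : Matrix n n ℂ →ₗ[ℂ] Matrix n n ℂ) (Q : Matrix n n ℂ) :
      (traceAdjoint T Q * N t * X).trace = (Q * T (N t * X)).trace := by
    rw [Matrix.mul_assoc, trace_traceAdjoint_mul]
  have hright (T : Matrix n n ℂ →ₗ[ℂ] Matrix n n ℂ) (Q : Matrix n n ℂ) :
      (N t * traceAdjoint T Q * X).trace = (Q * T (X * N t)).trace := by
    rw [Matrix.mul_assoc, Matrix.trace_mul_comm, Matrix.mul_assoc, trace_traceAdjoint_mul]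
  simp only [Pi.mul_apply, Matrix.neg_mul, Matrix.mul_neg, Matrix.add_mul, Matrix.mul_add,
    Matrix.trace_add, Matrix.trace_neg, hleft, hright, Matrix.one_mul, Complex.add_re,
    Complex.neg_re]
  ring

theorem re_trace_mul_ρ₀ (hN : S.IsFutureCurrent c τ N) :
    (N 0 * S.ρ₀).trace.re = (S.moments c τ).2.1.trace.re := by
  have hd (t : ℝ) : HasDerivAt
      (fun t => (N t * (S.moments c t).1).trace.re + (S.moments c t).2.1.trace.re) 0 t :=
    ((hN.hasDerivAt_re_trace_mul_fst t).add
      (S.hasDerivAt_re_trace_moments_snd_fst c t)).congr_deriv (neg_add_cancel _)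
  simpa [hN.final, moments_zero] using
    is_const_of_deriv_eq_zero (fun t => (hd t).differentiableAt) (fun t => (hd t).deriv) 0 τ

theorem hasDerivAt_secondMoment (hN : S.IsFutureCurrent c τ N) (t : ℝ) :
    HasDerivAt (fun t => (S.moments c t).2.2.trace.re + 2 * (N t * (S.moments c t).2.1).trace.re +
      (N t * N t * (S.moments c t).1).trace.re)
      (S.secondMomentRate c (N t) (S.moments c t).1) t := by
  refine (((S.hasDerivAt_re_trace_moments_snd_snd c t).add
    ((hN.hasDerivAt_re_trace_mul_snd_fst t).const_mul 2)).add
    (hN.hasDerivAt_re_trace_sq_mul_fst t)).congr_deriv ?_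
  rw [secondMomentRate]
  ring

theorem integral_le_variance (hN : S.IsFutureCurrent c τ N) (hτ : 0 ≤ τ)
    (hpos : ∀ t ∈ Set.Icc 0 τ, (S.moments c t).1.PosSemidef) {φ : ℝ → ℝ}
    (hφ : MeasureTheory.IntegrableOn φ (Set.Icc 0 τ))
    (hle : ∀ t ∈ Set.Ioo 0 τ, φ t ≤ ∑ k, (S.jumpDefect c (N t) k * (S.moments c t).1 *
      (S.jumpDefect c (N t) k)ᴴ).trace.re) :
    ∫ t in (0 : ℝ)..τ, φ t ≤
      (S.moments c τ).2.2.trace.re - (S.moments c τ).2.1.trace.re ^ 2 := by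
  have hgrowth := intervalIntegral.integral_le_sub_of_hasDeriv_right_of_le hτ
    (fun t _ => (hN.hasDerivAt_secondMoment t).continuousAt.continuousWithinAt)
    (fun t _ => (hN.hasDerivAt_secondMoment t).hasDerivWithinAt) hφ
    (fun t ht => (hle t ht).trans
      (S.sum_re_trace_jumpDefect_le c (hN.isHermitian t) (hpos t (Set.Ioo_subset_Icc_self ht))))
  have hsq := sq_re_trace_mul_le (hN.isHermitian 0) S.posSemidef_ρ₀ S.trace_ρ₀
  rw [hN.re_trace_mul_ρ₀] at hsq
  simp only [hN.final, moments_zero, Matrix.zero_mul, Matrix.trace_zero,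
    Complex.zero_re, mul_zero, add_zero, zero_add] at hgrowth
  linarith

end IsFutureCurrent

end FeedbackSystem

/-! ### Linear response -/

section LinearPerturbation

open MeasureTheory

variable {E : Type*} [NormedAddCommGroup E] [NormedSpace ℝ E]

/-- `e^{tA} ∫₀ᵗ e^{-sA} B_s u_s ds`, the integral term of Duhamel's formula for
`u' = A u + B_t u`. With `u` a solution of `u' = A u` it is the first-order response of `u` to the
perturbation `B` of `A`. -/
noncomputable def duhamel (A : E →L[ℝ] E) (B : ℝ → E →L[ℝ] E) (u : ℝ → E) (t : ℝ) : E :=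
  NormedSpace.exp (t • A) (∫ s in (0 : ℝ)..t, NormedSpace.exp ((-s) • A) (B s (u s)))

theorem duhamel_zero {A : E →L[ℝ] E} {B : ℝ → E →L[ℝ] E} {u : ℝ → E} : duhamel A B u 0 = 0 := by
  rw [duhamel, intervalIntegral.integral_same, map_zero]

theorem norm_le_mul_exp {A : E →L[ℝ] E} {B : ℝ → E →L[ℝ] E} {v : ℝ → E} {τ κ θ t : ℝ}
    (hB : ∀ s ∈ Set.Icc 0 τ, ‖B s‖ ≤ κ) (hθ : |θ| ≤ 1)
    (hv : ∀ s ∈ Set.Icc 0 τ, HasDerivWithinAt v (A (v s) + θ • B s (v s)) (Set.Icc 0 τ) s)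
    (ht : t ∈ Set.Icc 0 τ) : ‖v t‖ ≤ ‖v 0‖ * Real.exp ((‖A‖ + κ) * τ) := by
  have hκ : 0 ≤ κ := (norm_nonneg _).trans (hB t ht)
  have hderiv (s) (hs : s ∈ Set.Icc 0 τ) : ‖A (v s) + θ • B s (v s)‖ ≤ (‖A‖ + κ) * ‖v s‖ + 0 := by
    rw [add_zero, add_mul]
    refine norm_add_le_of_le (A.le_opNorm _) ?_
    rw [norm_smul, ← one_mul (κ * _)]
    exact mul_le_mul hθ (ContinuousLinearMap.le_of_opNorm_le _ (hB s hs) _) (norm_nonneg _)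
      zero_le_one
  have hgronwall := norm_le_gronwallBound_of_norm_deriv_right_le
    (fun s hs => (hv s hs).continuousWithinAt)
    (fun s hs => (hv s ⟨hs.1, hs.2.le⟩).mono_of_mem_nhdsWithin (Icc_mem_nhdsGE_of_mem hs))
    le_rfl (fun s hs => hderiv s ⟨hs.1, hs.2.le⟩) t ht
  rw [gronwallBound_ε0, sub_zero] at hgronwall
  refine hgronwall.trans ?_
  gcongr
  exact ht.2

variable [CompleteSpace E]

theorem continuous_exp_smul (A : E →L[ℝ] E) :
    Continuous fun s : ℝ => NormedSpace.exp (s • A) :=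
  continuous_iff_continuousAt.2 fun t =>
    (hasDerivAt_exp_smul_const (𝕂 := ℝ) A t).continuousAt

theorem norm_exp_neg_smul_le (A : E →L[ℝ] E) {s τ : ℝ} (hs : s ∈ Set.Icc 0 τ) :
    ‖NormedSpace.exp ((-s) • A)‖ ≤ Real.exp (τ * ‖A‖) := by
  have hexp := norm_exp_smul_le (-A) hs.1
  rw [norm_neg, smul_neg, ← neg_smul] at hexp
  exact hexp.trans (Real.exp_le_exp.2 (mul_le_mul_of_nonneg_right hs.2 (norm_nonneg _)))

variable {A : E →L[ℝ] E} {B : ℝ → E →L[ℝ] E} {u v : ℝ → E} {τ κ C θ t : ℝ}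

theorem norm_exp_neg_smul_apply_le (hB : ∀ s ∈ Set.Icc 0 τ, ‖B s‖ ≤ κ)
    (hu : ∀ s ∈ Set.Icc 0 τ, ‖u s‖ ≤ C) {s : ℝ} (hs : s ∈ Set.Icc 0 τ) :
    ‖NormedSpace.exp ((-s) • A) (B s (u s))‖ ≤ Real.exp (τ * ‖A‖) * (κ * C) :=
  ContinuousLinearMap.le_of_opNorm_le_of_le _ (norm_exp_neg_smul_le A hs)
    (ContinuousLinearMap.le_of_opNorm_le_of_le _ (hB s hs) (hu s hs))

theorem intervalIntegrable_exp_neg_smul_apply (hτ : 0 ≤ τ)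
    (hBm : AEStronglyMeasurable B (volume.restrict (Set.Icc 0 τ)))
    (hB : ∀ s ∈ Set.Icc 0 τ, ‖B s‖ ≤ κ) (hu : ContinuousOn u (Set.Icc 0 τ)) :
    IntervalIntegrable (fun s => NormedSpace.exp ((-s) • A) (B s (u s))) volume 0 τ := by
  obtain ⟨C, hC⟩ := isCompact_Icc.exists_bound_of_continuousOn hu
  rw [intervalIntegrable_iff_integrableOn_Icc_of_le hτ]
  have hexp : AEStronglyMeasurable (fun s : ℝ => NormedSpace.exp ((-s) • A))
      (volume.restrict (Set.Icc 0 τ)) :=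
    ((continuous_exp_smul A).comp continuous_neg).aestronglyMeasurable.restrict
  have hBu : AEStronglyMeasurable (fun s => B s (u s)) (volume.restrict (Set.Icc 0 τ)) :=
    (ContinuousLinearMap.id ℝ (E →L[ℝ] E)).aestronglyMeasurable_comp₂ hBm
      (hu.aestronglyMeasurable_of_isCompact isCompact_Icc measurableSet_Icc)
  refine Integrable.of_bound
    ((ContinuousLinearMap.id ℝ (E →L[ℝ] E)).aestronglyMeasurable_comp₂ hexp hBu)
    (Real.exp (τ * ‖A‖) * (κ * C)) ?_
  filter_upwards [ae_restrict_mem measurableSet_Icc] with s hs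
  exact norm_exp_neg_smul_apply_le hB hC hs

theorem norm_duhamel_le (hB : ∀ s ∈ Set.Icc 0 τ, ‖B s‖ ≤ κ)
    (hu : ∀ s ∈ Set.Icc 0 τ, ‖u s‖ ≤ C) (ht : t ∈ Set.Icc 0 τ) :
    ‖duhamel A B u t‖ ≤ Real.exp (τ * ‖A‖) * (Real.exp (τ * ‖A‖) * (κ * C) * τ) := by
  have hbound (s) (hs : s ∈ Set.Icc 0 τ) := norm_exp_neg_smul_apply_le (A := A) hB hu hs
  refine ContinuousLinearMap.le_of_opNorm_le_of_le _ ((norm_exp_smul_le A ht.1).trans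
    (Real.exp_le_exp.2 (mul_le_mul_of_nonneg_right ht.2 (norm_nonneg _)))) ?_
  refine (intervalIntegral.norm_integral_le_of_norm_le_const fun s hs => ?_).trans
    (mul_le_mul_of_nonneg_left ?_ ((norm_nonneg _).trans (hbound t ht)))
  · rw [Set.uIoc_of_le ht.1] at hs
    exact hbound s ⟨hs.1.le, hs.2.trans ht.2⟩
  · rw [sub_zero, abs_of_nonneg ht.1]
    exact ht.2

theorem duhamel_sub (hBm : AEStronglyMeasurable B (volume.restrict (Set.Icc 0 τ)))
    (hB : ∀ s ∈ Set.Icc 0 τ, ‖B s‖ ≤ κ) (hu : ContinuousOn u (Set.Icc 0 τ))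
    (hv : ContinuousOn v (Set.Icc 0 τ)) (ht : t ∈ Set.Icc 0 τ) :
    duhamel A B (v - u) t = duhamel A B v t - duhamel A B u t := by
  have hsub : Set.Icc 0 t ⊆ Set.Icc 0 τ := Set.Icc_subset_Icc_right ht.2
  have hint {w : ℝ → E} (hw : ContinuousOn w (Set.Icc 0 τ)) :
      IntervalIntegrable (fun s => NormedSpace.exp ((-s) • A) (B s (w s))) volume 0 t :=
    intervalIntegrable_exp_neg_smul_apply ht.1 (hBm.mono_set hsub) (fun s hs => hB s (hsub hs))
      (hw.mono hsub)
  simp only [duhamel, ← map_sub, ← intervalIntegral.integral_sub (hint hv) (hint hu),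
    Pi.sub_apply]

theorem eq_flow_add_smul_duhamel
    (hBm : AEStronglyMeasurable B (volume.restrict (Set.Icc 0 τ)))
    (hB : ∀ s ∈ Set.Icc 0 τ, ‖B s‖ ≤ κ)
    (hv : ∀ s ∈ Set.Icc 0 τ, HasDerivWithinAt v (A (v s) + θ • B s (v s)) (Set.Icc 0 τ) s)
    (ht : t ∈ Set.Icc 0 τ) :
    v t = NormedSpace.exp (t • A) (v 0) + θ • duhamel A B v t := by
  have hint : IntervalIntegrable (fun s => NormedSpace.exp ((-s) • A) (θ • B s (v s)))
      volume 0 τ := by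
    simp only [map_smul]
    exact (intervalIntegrable_exp_neg_smul_apply (ht.1.trans ht.2) hBm hB
      fun s hs => (hv s hs).continuousWithinAt).smul θ
  have hduhamel := eq_flow_add_integral hv hint ht
  simpa only [map_smul, intervalIntegral.integral_smul, map_add, duhamel] using hduhamel

theorem hasDerivAt_duhamel_zero {v : ℝ → ℝ → E}
    (hBm : AEStronglyMeasurable B (volume.restrict (Set.Icc 0 τ)))
    (hB : ∀ s ∈ Set.Icc 0 τ, ‖B s‖ ≤ κ)
    (hu : ∀ s ∈ Set.Icc 0 τ, HasDerivWithinAt u (A (u s)) (Set.Icc 0 τ) s)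
    (hv : ∀ θ ∈ Set.Ioo (-1 : ℝ) 1, ∀ s ∈ Set.Icc 0 τ,
      HasDerivWithinAt (v θ) (A (v θ s) + θ • B s (v θ s)) (Set.Icc 0 τ) s)
    (h0 : ∀ θ ∈ Set.Ioo (-1 : ℝ) 1, v θ 0 = u 0) (ht : t ∈ Set.Icc 0 τ) :
    HasDerivAt (fun θ => v θ t) (duhamel A B u t) 0 := by
  have hdev (θ) (hθ : θ ∈ Set.Ioo (-1 : ℝ) 1) (s) (hs : s ∈ Set.Icc 0 τ) :
      v θ s - u s = θ • duhamel A B (v θ) s := by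
    rw [eq_flow_add_smul_duhamel hBm hB (hv θ hθ) hs, eq_flow hu hs, h0 θ hθ, add_sub_cancel_left]
  set b := Real.exp (τ * ‖A‖)
  set D := b * (b * (κ * (‖u 0‖ * Real.exp ((‖A‖ + κ) * τ))) * τ)
  have hdevle (θ) (hθ : θ ∈ Set.Ioo (-1 : ℝ) 1) (s) (hs : s ∈ Set.Icc 0 τ) :
      ‖(v θ - u) s‖ ≤ |θ| * D := by
    rw [Pi.sub_apply, hdev θ hθ s hs, norm_smul, Real.norm_eq_abs]
    refine mul_le_mul_of_nonneg_left ?_ (abs_nonneg θ)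
    refine norm_duhamel_le hB (fun r hr => ?_) hs
    rw [← h0 θ hθ]
    exact norm_le_mul_exp hB (abs_le.2 ⟨hθ.1.le, hθ.2.le⟩) (hv θ hθ) hr
  rw [hasDerivAt_iff_tendsto_slope, tendsto_iff_norm_sub_tendsto_zero]
  have hlim : Tendsto (fun θ : ℝ => b * (b * (κ * (|θ| * D)) * τ)) (𝓝[≠] 0) (𝓝 0) := by
    have hcont : Continuous fun θ : ℝ => b * (b * (κ * (|θ| * D)) * τ) := by fun_prop
    simpa using (hcont.tendsto 0).mono_left nhdsWithin_le_nhds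
  refine squeeze_zero' (Eventually.of_forall fun _ => norm_nonneg _) ?_ hlim
  have hnear : ∀ᶠ θ : ℝ in 𝓝[≠] 0, θ ∈ Set.Ioo (-1 : ℝ) 1 :=
    nhdsWithin_le_nhds (Ioo_mem_nhds neg_one_lt_zero one_pos)
  filter_upwards [hnear, self_mem_nhdsWithin] with θ hθ hθ0
  have hv0 : v 0 t = u t := sub_eq_zero.1 ((hdev 0 (by simp) t ht).trans (zero_smul ℝ _))
  have hslope : slope (fun θ => v θ t) 0 θ = duhamel A B (v θ) t := by
    rw [slope_def_module, hv0, hdev θ hθ t ht, sub_zero, smul_smul, inv_mul_cancel₀ hθ0, one_smul]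
  rw [hslope, ← duhamel_sub hBm hB (fun s hs => (hu s hs).continuousWithinAt)
    (fun s hs => (hv θ hθ s hs).continuousWithinAt) ht]
  exact norm_duhamel_le hB (hdevle θ hθ) ht

theorem continuousOn_duhamel (hτ : 0 ≤ τ)
    (hBm : AEStronglyMeasurable B (volume.restrict (Set.Icc 0 τ)))
    (hB : ∀ s ∈ Set.Icc 0 τ, ‖B s‖ ≤ κ) (hu : ContinuousOn u (Set.Icc 0 τ)) :
    ContinuousOn (duhamel A B u) (Set.Icc 0 τ) := by
  have hprimitive := intervalIntegral.continuousOn_primitive_interval'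
    (intervalIntegrable_exp_neg_smul_apply (A := A) hτ hBm hB hu) Set.left_mem_uIcc
  rw [Set.uIcc_of_le hτ] at hprimitive
  exact (continuous_exp_smul A).continuousOn.clm_apply hprimitive

theorem hasDerivAt_duhamel (hBm : AEStronglyMeasurable B (volume.restrict (Set.Icc 0 τ)))
    (hB : ∀ s ∈ Set.Icc 0 τ, ‖B s‖ ≤ κ) (hBc : ContinuousOn B (Set.Ioo 0 τ))
    (hu : ContinuousOn u (Set.Icc 0 τ)) (ht : t ∈ Set.Ioo 0 τ) :
    HasDerivAt (duhamel A B u) (A (duhamel A B u t) + B t (u t)) t := by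
  have hsub : Set.Icc 0 t ⊆ Set.Icc 0 τ := Set.Icc_subset_Icc_right ht.2.le
  have hcont : ContinuousOn (fun s => NormedSpace.exp ((-s) • A) (B s (u s))) (Set.Ioo 0 τ) :=
    ((continuous_exp_smul A).comp continuous_neg).continuousOn.clm_apply
      (hBc.clm_apply (hu.mono Set.Ioo_subset_Icc_self))
  have hintegral := intervalIntegral.integral_hasDerivAt_right
    (intervalIntegrable_exp_neg_smul_apply ht.1.le (hBm.mono_set hsub)
      (fun s hs => hB s (hsub hs)) (hu.mono hsub))
    (hcont.stronglyMeasurableAtFilter isOpen_Ioo t ht)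
    (hcont.continuousAt (isOpen_Ioo.mem_nhds ht))
  refine ((hasDerivAt_exp_smul_const' (𝕂 := ℝ) A t).clm_apply hintegral).congr_deriv ?_
  rw [exp_smul_exp_neg_smul, duhamel, mul_apply_eq_comp]

end LinearPerturbation

namespace FeedbackSystem

section

variable {n K : Type*} [Fintype n] [DecidableEq n] (S : FeedbackSystem n K)

theorem rate_nonneg {X : Matrix n n ℂ} (hX : X.PosSemidef) (k : K) : 0 ≤ S.rate X k :=
  (Complex.nonneg_iff.1 (hX.mul_mul_conjTranspose_same (S.L k)).trace_nonneg).1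

theorem rate_pos {X : Matrix n n ℂ} (hX : X.PosDef) {k : K} (hk : S.L k ≠ 0) :
    0 < S.rate X k := by
  refine lt_of_le_of_ne (S.rate_nonneg hX.posSemidef k) fun h => hk ?_
  have hpos := hX.posSemidef.mul_mul_conjTranspose_same (S.L k)
  have htrace : (S.L k * X * (S.L k)ᴴ).trace = 0 :=
    Complex.ext h.symm (Complex.nonneg_iff.1 hpos.trace_nonneg).2.symm
  obtain ⟨B, hB, rfl⟩ : ∃ B : Matrix n n ℂ, IsUnit B ∧ X = B * Bᴴ := by
    open scoped MatrixOrder in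
    obtain ⟨B, hB, hBX⟩ :=
      CStarAlgebra.isStrictlyPositive_iff_eq_star_mul_self.1 hX.isStrictlyPositive
    exact ⟨star B, hB.star, hBX.trans (by rw [← Matrix.star_eq_conjTranspose, star_star])⟩
  have hzero : (S.L k * B) * (S.L k * B)ᴴ = 0 := by
    rw [← hpos.trace_eq_zero_iff.1 htrace, Matrix.conjTranspose_mul]
    simp only [Matrix.mul_assoc]
  exact hB.mul_left_eq_zero.1 (Matrix.self_mul_conjTranspose_eq_zero.1 hzero)

theorem conjTranspose_L (k : K) : (S.L k)ᴴ = (Real.exp (S.Δs k / 2) : ℂ) • S.L (S.rev k) := by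
  conv_lhs => rw [S.localDetailedBalance k, Matrix.conjTranspose_smul,
    Matrix.conjTranspose_conjTranspose, Complex.star_def, Complex.conj_ofReal]

theorem L_rev (k : K) : S.L (S.rev k) = (Real.exp (-S.Δs k / 2) : ℂ) • (S.L k)ᴴ := by
  rw [conjTranspose_L, smul_smul, ← Complex.ofReal_mul, ← Real.exp_add, neg_div, neg_add_cancel,
    Real.exp_zero, Complex.ofReal_one, one_smul]

theorem L_rev_ne_zero {k : K} (hk : S.L k ≠ 0) : S.L (S.rev k) ≠ 0 := by
  intro h
  rw [S.localDetailedBalance k, h, Matrix.conjTranspose_zero, smul_zero] at hk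
  exact hk rfl

theorem rate_eq_zero {k : K} (hk : S.L k = 0) (X : Matrix n n ℂ) : S.rate X k = 0 := by
  simp [rate, hk]

theorem abs_bias_le_one {X : Matrix n n ℂ} (hX : X.PosSemidef) (k : K) : |S.bias X k| ≤ 1 := by
  have hk := S.rate_nonneg hX k
  have hrev := S.rate_nonneg hX (S.rev k)
  rw [bias, abs_div, abs_of_nonneg (add_nonneg hk hrev)]
  refine div_le_one_of_le₀ (abs_le.2 ⟨?_, ?_⟩) (add_nonneg hk hrev) <;> linarith

@[fun_prop]
theorem continuous_rate (k : K) : Continuous fun X : Matrix n n ℂ => S.rate X k := by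
  simp only [rate]
  fun_prop

theorem continuousAt_bias {X : Matrix n n ℂ} (hX : X.PosDef) (k : K) :
    ContinuousAt (fun X : Matrix n n ℂ => S.bias X k) X := by
  by_cases hk : S.L k = 0
  · have hrev : S.L (S.rev k) = 0 := by rw [L_rev, hk, Matrix.conjTranspose_zero, smul_zero]
    simp only [bias, S.rate_eq_zero hk, S.rate_eq_zero hrev]
    exact continuousAt_const
  · exact ((S.continuous_rate k).sub (S.continuous_rate _)).continuousAt.div
      ((S.continuous_rate k).add (S.continuous_rate _)).continuousAt
      (add_pos (S.rate_pos hX hk) (S.rate_pos hX (S.L_rev_ne_zero hk))).ne'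

theorem aestronglyMeasurable_bias {ρ : ℝ → Matrix n n ℂ} {τ : ℝ}
    (hρ : ContinuousOn ρ (Set.Icc 0 τ)) (k : K) :
    MeasureTheory.AEStronglyMeasurable (fun t => S.bias (ρ t) k)
      (MeasureTheory.volume.restrict (Set.Icc 0 τ)) := by
  have hrate (k : K) : AEMeasurable (fun t => S.rate (ρ t) k)
      (MeasureTheory.volume.restrict (Set.Icc 0 τ)) :=
    ((S.continuous_rate k).comp_continuousOn hρ).aemeasurable measurableSet_Icc
  exact (((hrate k).sub (hrate _)).div ((hrate k).add (hrate _))).aestronglyMeasurable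

/-- The Lindblad dissipator of the channel `k`, feedback included: the contribution of the channel
to the generator. -/
noncomputable def dissipator (k : K) : Matrix n n ℂ →ₗ[ℂ] Matrix n n ℂ :=
  S.jump k - (1 / 2 : ℂ) • (LinearMap.mulLeft ℂ ((S.L k)ᴴ * S.L k) +
    LinearMap.mulRight ℂ ((S.L k)ᴴ * S.L k))

theorem dissipator_apply (k : K) (X : Matrix n n ℂ) :
    S.dissipator k X = S.F k (S.L k * X * (S.L k)ᴴ) -
      (1 / 2 : ℂ) • ((S.L k)ᴴ * S.L k * X + X * ((S.L k)ᴴ * S.L k)) := by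
  simp [dissipator, jump_apply, Matrix.mul_assoc]

end

section

variable {n K : Type*} [Fintype n] [DecidableEq n] [Fintype K] (S : FeedbackSystem n K)

/-- The derivative at `θ = 0` of the generator with jump operators `√(1 + ℓ_k θ) L_k`, where `ℓ_k`
is the bias of channel `k` in the state `X`. -/
noncomputable def perturbation (X : Matrix n n ℂ) : Matrix n n ℂ →L[ℝ] Matrix n n ℂ :=
  ∑ k, S.bias X k • realCLM (S.dissipator k)

theorem perturbation_apply (X Y : Matrix n n ℂ) :
    S.perturbation X Y = ∑ k, S.bias X k • S.dissipator k Y := by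
  simp [perturbation]

theorem norm_perturbation_le {X : Matrix n n ℂ} (hX : X.PosSemidef) :
    ‖S.perturbation X‖ ≤ ∑ k, ‖realCLM (S.dissipator k)‖ := by
  refine norm_sum_le_of_le _ fun k _ => ?_
  rw [norm_smul]
  exact mul_le_of_le_one_left (norm_nonneg _) (S.abs_bias_le_one hX k)

theorem continuousAt_perturbation {X : Matrix n n ℂ} (hX : X.PosDef) :
    ContinuousAt S.perturbation X :=
  tendsto_finsetSum _ fun k _ => (S.continuousAt_bias hX k).smul_const _

theorem aestronglyMeasurable_perturbation {ρ : ℝ → Matrix n n ℂ} {τ : ℝ}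
    (hρ : ContinuousOn ρ (Set.Icc 0 τ)) :
    MeasureTheory.AEStronglyMeasurable (fun t => S.perturbation (ρ t))
      (MeasureTheory.volume.restrict (Set.Icc 0 τ)) :=
  Finset.aestronglyMeasurable_fun_sum _ fun k _ => (S.aestronglyMeasurable_bias hρ k).smul_const _

theorem generator_perturbed {X : Matrix n n ℂ} (hX : X.PosSemidef) {θ : ℝ} (hθ : |θ| ≤ 1)
    (Y : Matrix n n ℂ) :
    S.generator (fun k => (Real.sqrt (1 + S.bias X k * θ) : ℂ) • S.L k) Y =
      S.gen Y + θ • S.perturbation X Y := by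
  have hsqrt (k : K) : (Real.sqrt (1 + S.bias X k * θ) : ℂ) * (Real.sqrt (1 + S.bias X k * θ) : ℂ) =
      1 + (S.bias X k : ℂ) * θ := by
    have habs : |S.bias X k * θ| ≤ 1 := by
      rw [abs_mul]
      exact mul_le_one₀ (S.abs_bias_le_one hX k) (abs_nonneg θ) hθ
    exact_mod_cast Real.mul_self_sqrt (neg_le_iff_add_nonneg'.1 (abs_le.1 habs).1)
  rw [gen_apply, generator, generator, perturbation_apply, Finset.smul_sum, add_assoc,
    ← Finset.sum_add_distrib]
  congr 1
  refine Finset.sum_congr rfl fun k _ => ?_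
  rw [dissipator_apply, Matrix.conjTranspose_smul]
  simp only [Matrix.smul_mul, Matrix.mul_smul, smul_smul, Complex.star_def, Complex.conj_ofReal,
    hsqrt, map_smul, ← Complex.coe_smul]
  module

/-- The solution of the feedback master equation: `e^{t G} ρ₀`, with `G` the generator. -/
noncomputable def state (t : ℝ) : Matrix n n ℂ := NormedSpace.exp (t • realCLM S.gen) S.ρ₀

theorem IsEvolution.eq_state {S : FeedbackSystem n K} {τ : ℝ} {ρ : ℝ → Matrix n n ℂ}
    (hρ : S.IsEvolution τ ρ) {t : ℝ} (ht : t ∈ Set.Icc 0 τ) : ρ t = S.state t := by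
  rw [state, ← hρ.1]
  exact eq_flow (A := realCLM S.gen) hρ.2 ht

theorem hasDerivAt_state (t : ℝ) : HasDerivAt S.state (S.gen (S.state t)) t :=
  hasDerivAt_flow (realCLM S.gen) S.ρ₀ t

@[fun_prop]
theorem continuous_state : Continuous S.state :=
  continuous_iff_continuousAt.2 fun t => (S.hasDerivAt_state t).continuousAt

theorem moments_fst_eq_state (c : K → ℝ) {t : ℝ} (ht : 0 ≤ t) : (S.moments c t).1 = S.state t := by
  have h := eq_flow (A := realCLM S.gen) (u := fun t => (S.moments c t).1) (τ := t)
    (fun s _ => (S.hasDerivAt_moments_fst c s).hasDerivWithinAt) ⟨ht, le_rfl⟩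
  rwa [moments_zero] at h

/-- The first-order response of the state to the perturbation of the jump operators, in closed
form. -/
noncomputable def linearResponse : ℝ → Matrix n n ℂ :=
  duhamel (realCLM S.gen) (fun s => S.perturbation (S.state s)) S.state

theorem linearResponse_zero : S.linearResponse 0 = 0 := duhamel_zero

theorem continuousOn_linearResponse {τ : ℝ} (hτ : 0 ≤ τ)
    (hpos : ∀ t ∈ Set.Icc 0 τ, (S.state t).PosSemidef) :
    ContinuousOn S.linearResponse (Set.Icc 0 τ) :=
  continuousOn_duhamel hτ (S.aestronglyMeasurable_perturbation S.continuous_state.continuousOn)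
    (fun t ht => S.norm_perturbation_le (hpos t ht)) S.continuous_state.continuousOn

theorem hasDerivAt_linearResponse {τ : ℝ} (hpos : ∀ t ∈ Set.Icc 0 τ, (S.state t).PosSemidef)
    (hfull : ∀ t ∈ Set.Ioo 0 τ, (S.state t).PosDef) {t : ℝ} (ht : t ∈ Set.Ioo 0 τ) :
    HasDerivAt S.linearResponse
      (S.gen (S.linearResponse t) + S.perturbation (S.state t) (S.state t)) t :=
  hasDerivAt_duhamel (S.aestronglyMeasurable_perturbation S.continuous_state.continuousOn)
    (fun t ht => S.norm_perturbation_le (hpos t ht))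
    (fun t ht => ((S.continuousAt_perturbation (hfull t ht)).comp
      S.continuous_state.continuousAt).continuousWithinAt) S.continuous_state.continuousOn ht

theorem hasDerivAt_perturbedEvolution {τ : ℝ}
    (hpos : ∀ t ∈ Set.Icc 0 τ, (S.state t).PosSemidef) {ρp : ℝ → ℝ → Matrix n n ℂ}
    (hρp : ∀ θ ∈ Set.Ioo (-1 : ℝ) 1, S.IsPerturbedEvolution τ S.state θ (ρp θ)) {t : ℝ}
    (ht : t ∈ Set.Icc 0 τ) :
    HasDerivAt (fun θ => ρp θ t) (S.linearResponse t) 0 := by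
  refine hasDerivAt_duhamel_zero
    (S.aestronglyMeasurable_perturbation S.continuous_state.continuousOn)
    (fun t ht => S.norm_perturbation_le (hpos t ht))
    (fun s _ => (S.hasDerivAt_state s).hasDerivWithinAt) (fun θ hθ s hs => ?_)
    (fun θ hθ => (hρp θ hθ).1.trans (flow_zero _ _).symm) ht
  rw [realCLM_apply, ← S.generator_perturbed (hpos s hs) (abs_le.2 ⟨hθ.1.le, hθ.2.le⟩)]
  exact (hρp θ hθ).2 s hs

end

end FeedbackSystem

/-! ### Entropy balance -/

section DensityMatrix

variable {n : Type*} [Fintype n] [DecidableEq n]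

theorem norm_entry_le_l2_opNorm (X : Matrix n n ℂ) (i j : n) : ‖X i j‖ ≤ ‖X‖ := by
  have h := (PiLp.norm_apply_le _ i).trans
    (Matrix.l2_opNorm_mulVec X (EuclideanSpace.single j (1 : ℂ)))
  simpa using h

theorem abs_re_trace_le (X : Matrix n n ℂ) : |X.trace.re| ≤ Fintype.card n * ‖X‖ :=
  calc |X.trace.re| ≤ ‖∑ i, X i i‖ := Complex.abs_re_le_norm _
    _ ≤ ∑ _i : n, ‖X‖ := norm_sum_le_of_le _ fun i _ => norm_entry_le_l2_opNorm X i i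
    _ = Fintype.card n * ‖X‖ := by simp

variable {X : Matrix n n ℂ}

theorem eigenvalues_le_one (hX : X.PosSemidef) (htr : X.trace = 1) (i : n) :
    hX.1.eigenvalues i ≤ 1 := by
  have hsum : ∑ i, hX.1.eigenvalues i = 1 := by
    have h := hX.1.trace_eq_sum_eigenvalues
    rw [htr] at h
    exact Complex.ofReal_injective (by simpa using h.symm)
  rw [← hsum]
  exact Finset.single_le_sum (fun j _ => hX.eigenvalues_nonneg j) (Finset.mem_univ i)

theorem abs_vonNeumannEntropy_le (hX : X.PosSemidef) (htr : X.trace = 1) :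
    |vonNeumannEntropy X| ≤ Fintype.card n := by
  rw [vonNeumannEntropy_eq_cfc hX.1]
  have hnorm : ‖cfc Real.negMulLog X‖ ≤ 1 := by
    refine norm_cfc_le zero_le_one fun x hx => ?_
    rw [hX.1.spectrum_real_eq_range_eigenvalues] at hx
    obtain ⟨i, rfl⟩ := hx
    have hnonneg := hX.eigenvalues_nonneg i
    have hle := eigenvalues_le_one hX htr i
    rw [Real.norm_eq_abs, abs_of_nonneg (Real.negMulLog_nonneg hnonneg hle)]
    linarith [Real.negMulLog_le_one_sub_self hnonneg]
  exact (abs_re_trace_le _).trans (mul_le_of_le_one_right (Nat.cast_nonneg _) hnorm)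

theorem norm_log_le_neg_log_norm_det (hX : X.PosDef) (htr : X.trace = 1) :
    ‖cfc Real.log X‖ ≤ -Real.log ‖X.det‖ := by
  have hdet : ‖X.det‖ = ∏ i, hX.1.eigenvalues i := by
    rw [hX.1.det_eq_prod_eigenvalues, norm_prod]
    refine Finset.prod_congr rfl fun i _ => ?_
    rw [RCLike.norm_ofReal, abs_of_pos (hX.eigenvalues_pos i)]
  have hlog : -Real.log ‖X.det‖ = ∑ i, -Real.log (hX.1.eigenvalues i) := by
    rw [hdet, Real.log_prod fun i _ => (hX.eigenvalues_pos i).ne', Finset.sum_neg_distrib]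
  have hnonneg (i : n) : 0 ≤ -Real.log (hX.1.eigenvalues i) :=
    neg_nonneg.2 <| Real.log_nonpos (hX.eigenvalues_pos i).le <|
      eigenvalues_le_one hX.posSemidef htr i
  rw [hlog]
  refine norm_cfc_le (Finset.sum_nonneg fun i _ => hnonneg i) fun x hx => ?_
  rw [hX.1.spectrum_real_eq_range_eigenvalues] at hx
  obtain ⟨i, rfl⟩ := hx
  rw [Real.norm_eq_abs, abs_of_nonpos (neg_nonneg.1 (hnonneg i))]
  exact Finset.single_le_sum (fun j _ => hnonneg j) (Finset.mem_univ i)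

end DensityMatrix

theorem smul_inv_smul_of_posSemidef {n : Type*} [Fintype n] {Z : Matrix n n ℂ}
    (hZ : Z.PosSemidef) : (Z.trace.re : ℂ) • (((Z.trace.re)⁻¹ : ℂ) • Z) = Z := by
  by_cases hre : Z.trace.re = 0
  · have htrace : Z.trace = 0 := Complex.ext hre (Complex.nonneg_iff.1 hZ.trace_nonneg).2.symm
    rw [hZ.trace_eq_zero_iff.1 htrace, smul_zero, smul_zero]
  · exact smul_inv_smul₀ (Complex.ofReal_ne_zero.2 hre) Z

namespace FeedbackSystem

section

variable {n K : Type*} [Fintype n] [DecidableEq n] (S : FeedbackSystem n K) {X : Matrix n n ℂ}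

/-- The state conditioned on a jump in channel `k` out of `X`, before feedback. It is `0` if the
jump has rate `0`. -/
noncomputable def jumpState (X : Matrix n n ℂ) (k : K) : Matrix n n ℂ :=
  ((S.rate X k)⁻¹ : ℂ) • (S.L k * X * (S.L k)ᴴ)

theorem posSemidef_jumpState (hX : X.PosSemidef) (k : K) : (S.jumpState X k).PosSemidef := by
  refine (hX.mul_mul_conjTranspose_same (S.L k)).smul ?_
  rw [← Complex.ofReal_inv]
  exact_mod_cast inv_nonneg.2 (S.rate_nonneg hX k)

theorem trace_jumpState (hX : X.PosSemidef) {k : K} (hk : 0 < S.rate X k) :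
    (S.jumpState X k).trace = 1 := by
  have him := (Complex.nonneg_iff.1 (hX.mul_mul_conjTranspose_same (S.L k)).trace_nonneg).2
  have hrate : (S.L k * X * (S.L k)ᴴ).trace = S.rate X k := Complex.ext rfl him.symm
  rw [jumpState, Matrix.trace_smul, hrate, smul_eq_mul,
    inv_mul_cancel₀ (Complex.ofReal_ne_zero.2 hk.ne')]

theorem continuousWithinAt_jumpState (hX : X.PosDef) {k : K} (hk : S.L k ≠ 0) :
    ContinuousWithinAt (fun X => S.jumpState X k) {X | X.PosSemidef} X := by
  have hrate := (S.continuous_rate k).continuousWithinAt (s := {X | X.PosSemidef}) (x := X)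
  have hne : (S.rate X k : ℂ) ≠ 0 := Complex.ofReal_ne_zero.2 (S.rate_pos hX hk).ne'
  refine ContinuousWithinAt.smul
    ((Complex.continuous_ofReal.continuousAt.comp_continuousWithinAt hrate).inv₀ hne) ?_
  exact (by fun_prop : Continuous fun X : Matrix n n ℂ => S.L k * X * (S.L k)ᴴ).continuousWithinAt

theorem outcomeProb_some {h : ℝ} (hh : 0 ≤ h) (k : K) [Fintype K] :
    S.outcomeProb X h (some k) = h * S.rate X k := by
  rw [outcomeProb, S.kraus_some_conj hh, Matrix.trace_smul, smul_eq_mul, Complex.re_ofReal_mul,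
    rate]

theorem rate_rev (X : Matrix n n ℂ) (k : K) :
    S.rate X (S.rev k) = Real.exp (-S.Δs k) * (S.L k * (S.L k)ᴴ * X).trace.re := by
  have hexp : (Real.exp (-S.Δs k / 2) : ℂ) * (Real.exp (-S.Δs k / 2) : ℂ) =
      (Real.exp (-S.Δs k) : ℂ) := by
    rw [← Complex.ofReal_mul, ← Real.exp_add, add_halves]
  rw [rate, L_rev, Matrix.conjTranspose_smul, Matrix.conjTranspose_conjTranspose]
  simp only [Matrix.smul_mul, Matrix.mul_smul, smul_smul, Complex.star_def, Complex.conj_ofReal,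
    hexp, Matrix.trace_smul, smul_eq_mul, Complex.re_ofReal_mul]
  rw [Matrix.trace_mul_comm _ (S.L k), ← Matrix.mul_assoc]

theorem rate_mul_log_le (hX : X.PosDef) (k : K) :
    S.rate X k * Real.log (S.rate X k / S.rate X (S.rev k)) ≤
      (S.L k * (X * cfc Real.log X) * (S.L k)ᴴ).trace.re -
        (S.L k * X * (S.L k)ᴴ * cfc Real.log X).trace.re + S.Δs k * S.rate X k := by
  by_cases hk : S.L k = 0
  · simp [hk, S.rate_eq_zero hk]
  have hrate := S.rate_pos hX hk
  have hrev := S.rate_pos hX (S.L_rev_ne_zero hk)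
  have hratio := div_pos hrate hrev
  -- The choice of the constant makes the left-hand side of Klein's inequality vanish.
  have hklein := (isPositiveMap_conjMap (S.L k)).klein hX hX
    (mul_pos hratio (Real.exp_pos (-S.Δs k)))
  simp only [conjMap_apply, Matrix.mul_one] at hklein
  rw [mul_assoc (S.rate X k / S.rate X (S.rev k)), ← S.rate_rev, div_mul_cancel₀ _ hrev.ne',
    Real.log_mul hratio.ne' (Real.exp_pos _).ne', Real.log_exp, ← rate, sub_self] at hklein
  linarith

end

section

variable {n K : Type*} [Fintype n] [DecidableEq n] [Fintype K] (S : FeedbackSystem n K)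
  {X : Matrix n n ℂ}

theorem measuredState_some {h : ℝ} (hh : 0 < h) (X : Matrix n n ℂ) (k : K) :
    S.measuredState X h (some k) = S.jumpState X k := by
  have hne : (h : ℂ) ≠ 0 := Complex.ofReal_ne_zero.2 hh.ne'
  rw [measuredState, S.kraus_some_conj hh.le, S.outcomeProb_some hh.le, jumpState, smul_smul,
    Complex.ofReal_mul, _root_.mul_inv_rev, mul_assoc, inv_mul_cancel₀ hne, mul_one]

/-- The generator of the dynamics without feedback. It is also the generator of the measurement
step alone. -/
noncomputable def bareGen : Matrix n n ℂ →ₗ[ℂ] Matrix n n ℂ :=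
  ∑ k, conjMap (S.L k) - (LinearMap.mulLeft ℂ S.decay + LinearMap.mulRight ℂ S.decayᴴ)

theorem bareGen_apply (X : Matrix n n ℂ) :
    S.bareGen X = ∑ k, S.L k * X * (S.L k)ᴴ - (S.decay * X + X * S.decayᴴ) := by
  simp [bareGen, conjMap_apply]

theorem trace_bareGen (X : Matrix n n ℂ) : (S.bareGen X).trace = 0 := by
  have h := S.trace_gen X
  rw [gen_eq, Matrix.trace_sub, Matrix.trace_sum] at h
  rw [bareGen_apply, Matrix.trace_sub, Matrix.trace_sum, ← h]
  simp only [trace_jump]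

theorem bareGen_conjTranspose (Z : Matrix n n ℂ) : S.bareGen Zᴴ = (S.bareGen Z)ᴴ := by
  simp only [bareGen_apply, Matrix.conjTranspose_sub, Matrix.conjTranspose_sum,
    Matrix.conjTranspose_add, Matrix.conjTranspose_mul, Matrix.conjTranspose_conjTranspose,
    Matrix.mul_assoc]
  rw [add_comm (Zᴴ * S.decayᴴ)]

theorem sum_kraus_conj {h : ℝ} (hh : 0 ≤ h) (X : Matrix n n ℂ) :
    ∑ a, S.kraus h a * X * (S.kraus h a)ᴴ =
      X + (h : ℂ) • S.bareGen X + ((h : ℂ) ^ 2) • conjMap S.decay X := by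
  have hnone : S.kraus h none * X * (S.kraus h none)ᴴ =
      X - (h : ℂ) • (S.decay * X + X * S.decayᴴ) + ((h : ℂ) ^ 2) • (S.decay * X * S.decayᴴ) :=
    S.stepMap_none h X
  rw [Fintype.sum_option, hnone, bareGen_apply, conjMap_apply]
  simp only [S.kraus_some_conj hh, ← Finset.smul_sum, smul_sub]
  abel

theorem outcomeProb_smul_measuredState (hX : X.PosSemidef) (h : ℝ) (a : Option K) :
    (S.outcomeProb X h a : ℂ) • S.measuredState X h a = S.kraus h a * X * (S.kraus h a)ᴴ :=
  smul_inv_smul_of_posSemidef (hX.mul_mul_conjTranspose_same _)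

theorem outcomeProb_smul_feedback (hX : X.PosSemidef) (h : ℝ) (a : Option K) :
    (S.outcomeProb X h a : ℂ) • S.feedback a (S.measuredState X h a) = S.stepMap h a X := by
  rw [← feedback_kraus, ← S.outcomeProb_smul_measuredState hX]
  cases a with
  | none => rfl
  | some k => exact (map_smul (S.F k) _ _).symm

/-- The rate at which the feedback raises the entropy of the system conditioned on the jump record.
Like `mutualInfoRate` it does not count the change of the entropy of the mean state. -/
noncomputable def feedbackEntropyRate (X : Matrix n n ℂ) : ℝ :=
  ∑ k, S.rate X k *
    (vonNeumannEntropy (S.F k (S.jumpState X k)) - vonNeumannEntropy (S.jumpState X k))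

theorem feedbackEntropyRate_nonneg (hX : X.PosSemidef) : 0 ≤ S.feedbackEntropyRate X :=
  Finset.sum_nonneg fun k _ => mul_nonneg (S.rate_nonneg hX k) <| sub_nonneg.2 <|
    (isPositiveMap_F S k).vonNeumannEntropy_le (S.isUnitalCPTP_F k).tracePreserving
      (S.isUnitalCPTP_F k).unital (S.posSemidef_jumpState hX k)

theorem mutualInfoChange_eq (hX : X.PosSemidef) {h : ℝ} (hh : 0 < h) :
    S.mutualInfoChange X h =
      vonNeumannEntropy (X + (h : ℂ) • S.gen X + ((h : ℂ) ^ 2) • conjMap S.decay X) -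
      vonNeumannEntropy (X + (h : ℂ) • S.bareGen X + ((h : ℂ) ^ 2) • conjMap S.decay X) -
      h * S.feedbackEntropyRate X := by
  rw [mutualInfoChange, holevoInformation, holevoInformation]
  simp only [S.outcomeProb_smul_measuredState hX, S.outcomeProb_smul_feedback hX]
  rw [S.sum_stepMap hh.le, S.sum_kraus_conj hh.le, Fintype.sum_option, Fintype.sum_option]
  simp only [S.outcomeProb_some hh.le, S.measuredState_some hh, feedback, feedbackEntropyRate,
    mul_sub, Finset.sum_sub_distrib, Finset.mul_sum, mul_assoc]
  ring

theorem tendsto_mutualInfoChange (hX : X.PosDef) :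
    Tendsto (fun h => S.mutualInfoChange X h / h) (𝓝[>] 0)
      (𝓝 (-((S.gen X - S.bareGen X) * (cfc Real.log X + 1)).trace.re -
        S.feedbackEntropyRate X)) := by
  have hlim (A : Matrix n n ℂ) : Tendsto
      (fun h : ℝ => X + (h : ℂ) • A + ((h : ℂ) ^ 2) • conjMap S.decay X) (𝓝[>] 0) (𝓝 X) := by
    have hcont : Continuous fun h : ℝ =>
        X + (h : ℂ) • A + ((h : ℂ) ^ 2) • conjMap S.decay X := by
      fun_prop
    simpa using (hcont.tendsto 0).mono_left (nhdsWithin_le_nhds (s := Set.Ioi 0))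
  have hherm {A : Matrix n n ℂ} (hA : A.IsHermitian) (h : ℝ) :
      (X + (h : ℂ) • A + ((h : ℂ) ^ 2) • conjMap S.decay X).IsHermitian := by
    have hconj := (isPositiveMap_conjMap S.decay X hX.posSemidef).1
    exact (hX.1.add (hA.smul (Complex.conj_ofReal h))).add
      (hconj.smul (IsSelfAdjoint.pow (Complex.conj_ofReal h) 2))
  have hgen : (S.gen X).IsHermitian := by rw [Matrix.IsHermitian, ← gen_conjTranspose, hX.1]
  have hbare : (S.bareGen X).IsHermitian := by
    rw [Matrix.IsHermitian, ← bareGen_conjTranspose, hX.1]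
  have hslope := tendsto_vonNeumannEntropy_slope (h := fun h : ℝ => h) hX (hlim (S.gen X))
    (hlim (S.bareGen X)) (Eventually.of_forall (hherm hgen)) (Eventually.of_forall (hherm hbare))
    self_mem_nhdsWithin ((tendsto_const_nhds (x := S.gen X - S.bareGen X)).congr' ?_)
  · refine (hslope.sub_const (S.feedbackEntropyRate X)).congr' ?_
    filter_upwards [self_mem_nhdsWithin] with h (hh : 0 < h)
    rw [S.mutualInfoChange_eq hX.posSemidef hh, sub_div _ (h * _), mul_div_cancel_left₀ _ hh.ne']
  · filter_upwards [self_mem_nhdsWithin] with h (hh : 0 < h)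
    rw [add_sub_add_right_eq_sub, add_sub_add_left_eq_sub, ← smul_sub, Complex.coe_smul,
      inv_smul_smul₀ hh.ne']

theorem mutualInfoRate_eq (hX : X.PosDef) :
    S.mutualInfoRate X =
      -((S.gen X - S.bareGen X) * (cfc Real.log X + 1)).trace.re - S.feedbackEntropyRate X :=
  (S.tendsto_mutualInfoChange hX).limUnder_eq

theorem abs_feedbackEntropyRate_le (hX : X.PosSemidef) :
    |S.feedbackEntropyRate X| ≤ ∑ k, S.rate X k * (2 * Fintype.card n) := by
  refine (Finset.abs_sum_le_sum_abs _ _).trans (Finset.sum_le_sum fun k _ => ?_)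
  rw [abs_mul, abs_of_nonneg (S.rate_nonneg hX k)]
  rcases (S.rate_nonneg hX k).eq_or_lt with hzero | hpos
  · rw [← hzero, zero_mul, zero_mul]
  · refine mul_le_mul_of_nonneg_left ?_ hpos.le
    have htrace := S.trace_jumpState hX hpos
    have hbefore := abs_vonNeumannEntropy_le (S.posSemidef_jumpState hX k) htrace
    have hafter := abs_vonNeumannEntropy_le (S.isPositiveMap_F k _ (S.posSemidef_jumpState hX k))
      (((S.isUnitalCPTP_F k).tracePreserving _).trans htrace)
    exact (abs_sub _ _).trans (by linarith)

theorem continuousWithinAt_feedbackEntropyRate (hX : X.PosDef) :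
    ContinuousWithinAt S.feedbackEntropyRate {X | X.PosSemidef} X := by
  refine tendsto_finsetSum _ fun k _ => ?_
  by_cases hk : S.L k = 0
  · simp only [S.rate_eq_zero hk, zero_mul]
    exact tendsto_const_nhds
  have hω := S.continuousWithinAt_jumpState hX hk
  have hFω : ContinuousWithinAt (fun X => S.F k (S.jumpState X k)) {X | X.PosSemidef} X :=
    (realCLM (S.F k)).continuous.continuousAt.comp_continuousWithinAt hω
  refine (S.continuous_rate k).continuousWithinAt.mul (Tendsto.sub ?_ ?_)
  · exact tendsto_vonNeumannEntropy hFω (eventually_nhdsWithin_of_forall fun Y hY =>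
        (S.isPositiveMap_F k _ (S.posSemidef_jumpState hY k)).1)
      (S.isPositiveMap_F k _ (S.posSemidef_jumpState hX.posSemidef k)).1
  · exact tendsto_vonNeumannEntropy hω
      (eventually_nhdsWithin_of_forall fun Y hY => (S.posSemidef_jumpState hY k).1)
      (S.posSemidef_jumpState hX.posSemidef k).1

theorem trace_state (t : ℝ) : (S.state t).trace = 1 := by
  have hderiv (t : ℝ) : HasDerivAt (fun t => (S.state t).trace) 0 t := by
    refine ((realCLM (Matrix.traceLinearMap n ℂ ℂ)).hasFDerivAt.comp_hasDerivAt t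
      (S.hasDerivAt_state t)).congr_deriv ?_
    simp [trace_gen]
  have hconst := is_const_of_deriv_eq_zero (fun t => (hderiv t).differentiableAt)
    (fun t => (hderiv t).deriv) t 0
  rw [hconst, state, flow_zero, S.trace_ρ₀]

theorem analyticAt_det_state (t : ℝ) : AnalyticAt ℝ (fun t => (S.state t).det) t := by
  have hexp : AnalyticAt ℝ (fun t : ℝ => NormedSpace.exp (t • realCLM S.gen)) t :=
    AnalyticAt.comp (f := fun t : ℝ => t • realCLM S.gen)
      (NormedSpace.exp_analytic (𝕂 := ℝ) (t • realCLM S.gen))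
      (((1 : ℝ →L[ℝ] ℝ).smulRight (realCLM S.gen)).analyticAt t)
  have hentry (i j : n) : AnalyticAt ℝ (fun t : ℝ => S.state t i j) t :=
    AnalyticAt.comp (f := fun t : ℝ => NormedSpace.exp (t • realCLM S.gen))
      (((realCLM (Matrix.entryLinearMap ℂ ℂ i j)).comp
        (ContinuousLinearMap.apply ℝ (Matrix n n ℂ) S.ρ₀)).analyticAt _) hexp
  simp only [Matrix.det_apply']
  exact Finset.analyticAt_fun_sum _ fun σ _ =>
    analyticAt_const.mul (Finset.analyticAt_fun_prod _ fun i _ => hentry _ _)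

theorem intervalIntegrable_log_norm_det_state (τ : ℝ) :
    IntervalIntegrable (fun t => Real.log ‖(S.state t).det‖) MeasureTheory.volume 0 τ :=
  MeromorphicOn.intervalIntegrable_log_norm fun t _ => (S.analyticAt_det_state t).meromorphicAt

-- The state may lose rank at the endpoints, where its logarithm is unbounded. As the state is
-- analytic in time, its logarithm is still dominated by the integrable function `log |det|`.
theorem intervalIntegrable_trace_mul_log {τ : ℝ} (hτ : 0 ≤ τ)
    (hfull : ∀ t ∈ Set.Ioo 0 τ, (S.state t).PosDef) {B : ℝ → Matrix n n ℂ} (hB : Continuous B) :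
    IntervalIntegrable (fun t => (B t * cfc Real.log (S.state t)).trace.re)
      MeasureTheory.volume 0 τ := by
  obtain ⟨C, hC⟩ := isCompact_Icc.exists_bound_of_continuousOn (hB.continuousOn (s := Set.Icc 0 τ))
  have hlog := ((S.intervalIntegrable_log_norm_det_state τ).neg.const_mul C).const_mul
    (Fintype.card n : ℝ)
  rw [intervalIntegrable_iff_integrableOn_Ioo_of_le hτ] at hlog ⊢
  have hcont : ContinuousOn (fun t => (B t * cfc Real.log (S.state t)).trace.re) (Set.Ioo 0 τ) :=
    continuous_trace_re.comp_continuousOn (hB.continuousOn.mul fun t ht =>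
      tendsto_log S.continuous_state.continuousWithinAt
        (eventually_nhdsWithin_of_forall fun s hs => (hfull s hs).1) (hfull t ht))
  refine hlog.mono' (hcont.aestronglyMeasurable measurableSet_Ioo) ?_
  filter_upwards [MeasureTheory.ae_restrict_mem measurableSet_Ioo] with t ht
  have hBt := hC t ⟨ht.1.le, ht.2.le⟩
  refine (abs_re_trace_le _).trans (mul_le_mul_of_nonneg_left ?_ (Nat.cast_nonneg _))
  exact (norm_mul_le _ _).trans (mul_le_mul hBt
    (norm_log_le_neg_log_norm_det (hfull t ht) (S.trace_state t)) (norm_nonneg _)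
    ((norm_nonneg _).trans hBt))

theorem intervalIntegrable_feedbackEntropyRate {τ : ℝ} (hτ : 0 ≤ τ)
    (hfull : ∀ t ∈ Set.Ioo 0 τ, (S.state t).PosDef) :
    IntervalIntegrable (fun t => S.feedbackEntropyRate (S.state t)) MeasureTheory.volume 0 τ := by
  have hbound : Continuous fun t => ∑ k, S.rate (S.state t) k * (2 * Fintype.card n) := by
    fun_prop
  have hint := hbound.intervalIntegrable (μ := MeasureTheory.volume) 0 τ
  rw [intervalIntegrable_iff_integrableOn_Ioo_of_le hτ] at hint ⊢
  have hcont : ContinuousOn (fun t => S.feedbackEntropyRate (S.state t)) (Set.Ioo 0 τ) :=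
    fun t ht => (S.continuousWithinAt_feedbackEntropyRate (hfull t ht)).comp
      S.continuous_state.continuousWithinAt fun s hs => (hfull s hs).posSemidef
  refine hint.mono' (hcont.aestronglyMeasurable measurableSet_Ioo) ?_
  filter_upwards [MeasureTheory.ae_restrict_mem measurableSet_Ioo] with t ht
  exact S.abs_feedbackEntropyRate_le (hfull t ht).posSemidef

theorem hasDerivWithinAt_vonNeumannEntropy {t : ℝ} (ht : (S.state t).PosDef)
    (hherm : ∀ᶠ s in 𝓝 t, (S.state s).IsHermitian) :
    HasDerivWithinAt (fun t => vonNeumannEntropy (S.state t))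
      (-(S.gen (S.state t) * (cfc Real.log (S.state t) + 1)).trace.re) (Set.Ioi t) t := by
  rw [hasDerivWithinAt_iff_tendsto_slope' (Set.notMem_Ioi.2 le_rfl)]
  have hderiv := (S.hasDerivAt_state t).hasDerivWithinAt (s := Set.Ioi t)
  rw [hasDerivWithinAt_iff_tendsto_slope' (Set.notMem_Ioi.2 le_rfl)] at hderiv
  have hslope := tendsto_vonNeumannEntropy_slope (h := fun s => s - t) ht
    (S.continuous_state.continuousWithinAt (s := Set.Ioi t) (x := t))
    (tendsto_const_nhds (x := S.state t)) (nhdsWithin_le_nhds hherm)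
    (Eventually.of_forall fun _ => ht.1)
    (eventually_nhdsWithin_of_forall fun s hs => sub_pos.2 hs)
    (hderiv.congr fun s => slope_def_module _ _ _)
  exact hslope.congr fun s => (slope_def_field _ _ _).symm

/-- The integrand of `entropyProduction`, in closed form for full-rank `X`: the entropy changes of
the system and of the environment due to the dynamics without feedback, and the entropy which the
feedback adds to the conditional states. -/
noncomputable def entropyProductionRate (X : Matrix n n ℂ) : ℝ :=
  -(S.bareGen X * (cfc Real.log X + 1)).trace.re + ∑ k, S.Δs k * S.rate X k +
    S.feedbackEntropyRate X

theorem trace_bareGen_mul_log_add_one (hX : X.IsHermitian) :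
    (S.bareGen X * (cfc Real.log X + 1)).trace =
      ∑ k, (S.L k * X * (S.L k)ᴴ * cfc Real.log X).trace -
        ∑ k, (S.L k * (X * cfc Real.log X) * (S.L k)ᴴ).trace := by
  have hcomm : X * cfc Real.log X = cfc Real.log X * X := by
    have h := (cfc_commute_cfc (fun x : ℝ => x) Real.log X).eq
    rwa [cfc_id' ℝ X hX.isSelfAdjoint] at h
  have hright : (X * S.decayᴴ * cfc Real.log X).trace =
      (S.decayᴴ * (X * cfc Real.log X)).trace := by
    rw [Matrix.trace_mul_comm, ← Matrix.mul_assoc, ← hcomm, Matrix.trace_mul_comm]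
  have hdecay : (S.decay * X * cfc Real.log X + X * S.decayᴴ * cfc Real.log X).trace =
      ∑ k, (S.L k * (X * cfc Real.log X) * (S.L k)ᴴ).trace := by
    rw [Matrix.trace_add, hright, Matrix.mul_assoc, ← Matrix.trace_add, ← Matrix.add_mul,
      decay_add_conjTranspose, Finset.sum_mul, Matrix.trace_sum]
    refine Finset.sum_congr rfl fun k _ => ?_
    rw [Matrix.mul_assoc, Matrix.trace_mul_comm]
  rw [Matrix.mul_add, Matrix.mul_one, Matrix.trace_add, trace_bareGen, add_zero, bareGen_apply,
    Matrix.sub_mul, Matrix.trace_sub, Finset.sum_mul, Matrix.trace_sum, Matrix.add_mul, hdecay]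

theorem sum_rate_mul_log_le (hX : X.PosDef) :
    ∑ k, S.rate X k * Real.log (S.rate X k / S.rate X (S.rev k)) ≤ S.entropyProductionRate X := by
  have hsum := Finset.sum_le_sum fun k (_ : k ∈ Finset.univ) => S.rate_mul_log_le hX k
  rw [Finset.sum_add_distrib, Finset.sum_sub_distrib] at hsum
  rw [entropyProductionRate, S.trace_bareGen_mul_log_add_one hX.1, Complex.sub_re, Complex.re_sum,
    Complex.re_sum]
  linarith [S.feedbackEntropyRate_nonneg hX.posSemidef]

end

end FeedbackSystem

theorem isClosed_posSemidef {n : Type*} [Finite n] :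
    IsClosed {X : Matrix n n ℂ | X.PosSemidef} := by
  cases nonempty_fintype n
  classical
  open scoped MatrixOrder in
  simpa only [Matrix.nonneg_iff_posSemidef] using
    CStarAlgebra.isClosed_nonneg (A := Matrix n n ℂ)

namespace FeedbackSystem

section

variable {n K : Type*} [Fintype n] [DecidableEq n] [Fintype K] (S : FeedbackSystem n K) {τ : ℝ}

theorem posSemidef_state (hτ : 0 < τ) (hfull : ∀ t ∈ Set.Ioo 0 τ, (S.state t).PosDef) :
    ∀ t ∈ Set.Icc 0 τ, (S.state t).PosSemidef := by
  have hclosure : closure (Set.Ioo 0 τ) ⊆ S.state ⁻¹' {X | X.PosSemidef} :=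
    closure_minimal (fun t ht => (hfull t ht).posSemidef)
      (isClosed_posSemidef.preimage S.continuous_state)
  rwa [closure_Ioo hτ.ne] at hclosure

theorem intervalIntegrable_trace_mul_log_add_one (hτ : 0 ≤ τ)
    (hfull : ∀ t ∈ Set.Ioo 0 τ, (S.state t).PosDef) (T : Matrix n n ℂ →ₗ[ℂ] Matrix n n ℂ) :
    IntervalIntegrable (fun t => (T (S.state t) * (cfc Real.log (S.state t) + 1)).trace.re)
      MeasureTheory.volume 0 τ := by
  have hT : Continuous fun t => T (S.state t) :=
    (realCLM T).continuous.comp S.continuous_state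
  simp only [Matrix.mul_add, Matrix.mul_one, Matrix.trace_add, Complex.add_re]
  exact (S.intervalIntegrable_trace_mul_log hτ hfull hT).add
    ((continuous_trace_re.comp hT).intervalIntegrable _ _)

theorem intervalIntegrable_mutualInfoRate (hτ : 0 ≤ τ)
    (hfull : ∀ t ∈ Set.Ioo 0 τ, (S.state t).PosDef) :
    IntervalIntegrable (fun t => S.mutualInfoRate (S.state t)) MeasureTheory.volume 0 τ := by
  have hint := ((S.intervalIntegrable_trace_mul_log_add_one hτ hfull (S.gen - S.bareGen)).neg).sub
    (S.intervalIntegrable_feedbackEntropyRate hτ hfull)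
  rw [intervalIntegrable_iff_integrableOn_Ioo_of_le hτ] at hint ⊢
  exact hint.congr_fun (fun t ht => (S.mutualInfoRate_eq (hfull t ht)).symm) measurableSet_Ioo

theorem intervalIntegrable_sum_mul_rate (a : K → ℝ) :
    IntervalIntegrable (fun t => ∑ k, a k * S.rate (S.state t) k) MeasureTheory.volume 0 τ :=
  Continuous.intervalIntegrable (by fun_prop) 0 τ

theorem intervalIntegrable_entropyProductionRate (hτ : 0 ≤ τ)
    (hfull : ∀ t ∈ Set.Ioo 0 τ, (S.state t).PosDef) :
    IntervalIntegrable (fun t => S.entropyProductionRate (S.state t)) MeasureTheory.volume 0 τ :=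
  ((S.intervalIntegrable_trace_mul_log_add_one hτ hfull S.bareGen).neg.add
    (S.intervalIntegrable_sum_mul_rate S.Δs)).add
      (S.intervalIntegrable_feedbackEntropyRate hτ hfull)

theorem integral_entropyFlow_eq (hτ : 0 < τ) (hfull : ∀ t ∈ Set.Ioo 0 τ, (S.state t).PosDef) :
    ∫ t in (0 : ℝ)..τ, -(S.gen (S.state t) * (cfc Real.log (S.state t) + 1)).trace.re =
      vonNeumannEntropy (S.state τ) - vonNeumannEntropy (S.state 0) := by
  have hpos := S.posSemidef_state hτ hfull
  exact intervalIntegral.integral_eq_sub_of_hasDeriv_right_of_le hτ.le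
    (fun t ht => tendsto_vonNeumannEntropy S.continuous_state.continuousWithinAt
      (eventually_nhdsWithin_of_forall fun s hs => (hpos s hs).1) (hpos t ht).1)
    (fun t ht => S.hasDerivWithinAt_vonNeumannEntropy (hfull t ht)
      (Filter.mem_of_superset (isOpen_Ioo.mem_nhds ht) fun s hs => (hfull s hs).1))
    (S.intervalIntegrable_trace_mul_log_add_one hτ.le hfull S.gen).neg

theorem entropyProduction_eq (hτ : 0 < τ) (hfull : ∀ t ∈ Set.Ioo 0 τ, (S.state t).PosDef) :
    S.entropyProduction τ S.state = ∫ t in (0 : ℝ)..τ, S.entropyProductionRate (S.state t) := by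
  have hgen : IntervalIntegrable
      (fun t => -(S.gen (S.state t) * (cfc Real.log (S.state t) + 1)).trace.re)
      MeasureTheory.volume 0 τ :=
    (S.intervalIntegrable_trace_mul_log_add_one hτ.le hfull S.gen).neg
  have henv := S.intervalIntegrable_sum_mul_rate (τ := τ) S.Δs
  have hinfo := S.intervalIntegrable_mutualInfoRate hτ.le hfull
  rw [entropyProduction, totalEntropyProduction, ← S.integral_entropyFlow_eq hτ hfull,
    ← intervalIntegral.integral_add hgen henv,
    ← intervalIntegral.integral_sub (hgen.add henv) hinfo]
  refine intervalIntegral.integral_congr_Ioo_of_le hτ.le fun t ht => ?_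
  simp only [S.mutualInfoRate_eq (hfull t ht), entropyProductionRate, Matrix.sub_mul,
    Matrix.trace_sub, Complex.sub_re]
  ring

end

/-! ### Information and entropy production -/

section

variable {n K : Type*} [Fintype n] [DecidableEq n] (S : FeedbackSystem n K) {X : Matrix n n ℂ}

theorem rate_rev_eq_zero {k : K} (hk : S.L k = 0) (X : Matrix n n ℂ) :
    S.rate X (S.rev k) = 0 :=
  S.rate_eq_zero (by rw [S.L_rev, hk, Matrix.conjTranspose_zero, smul_zero]) X

theorem bias_rev (X : Matrix n n ℂ) (k : K) : S.bias X (S.rev k) = -S.bias X k := by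
  rw [bias, bias, S.rev_rev, ← neg_div, neg_sub, add_comm]

theorem bias_mul_rate_add_rate_rev (hX : X.PosSemidef) (k : K) :
    S.bias X k * (S.rate X k + S.rate X (S.rev k)) = S.rate X k - S.rate X (S.rev k) := by
  have hk := S.rate_nonneg hX k
  have hrev := S.rate_nonneg hX (S.rev k)
  by_cases hzero : S.rate X k + S.rate X (S.rev k) = 0
  · rw [hzero, mul_zero]
    linarith
  · rw [bias, div_mul_cancel₀ _ hzero]

end

section

variable {n K : Type*} [Fintype n] [DecidableEq n] [Fintype K] (S : FeedbackSystem n K)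
  {X : Matrix n n ℂ}

theorem sum_comp_rev (f : K → ℝ) : ∑ k, f (S.rev k) = ∑ k, f k :=
  Equiv.sum_comp (Function.Involutive.toPerm S.rev S.rev_rev) f

theorem two_mul_sum_eq_sum_add_rev (f : K → ℝ) :
    2 * ∑ k, f k = ∑ k, (f k + f (S.rev k)) := by
  rw [Finset.sum_add_distrib, S.sum_comp_rev, two_mul]

theorem sum_mul_rate_eq {c : K → ℝ} (hc : ∀ k, c (S.rev k) = -c k) (hX : X.PosSemidef) :
    ∑ k, c k * S.rate X k = ∑ k, S.bias X k * (c k * S.rate X k) := by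
  refine mul_left_cancel₀ two_ne_zero ?_
  rw [S.two_mul_sum_eq_sum_add_rev, S.two_mul_sum_eq_sum_add_rev]
  refine Finset.sum_congr rfl fun k _ => ?_
  rw [hc, bias_rev]
  linear_combination (-c k) * S.bias_mul_rate_add_rate_rev hX k

/-- The rate at which the trajectories acquire Fisher information about the strength of the
perturbation of the jump operators, in the state `X`. -/
noncomputable def informationRate (X : Matrix n n ℂ) : ℝ := ∑ k, S.bias X k ^ 2 * S.rate X k

theorem informationRate_nonneg (hX : X.PosSemidef) : 0 ≤ S.informationRate X :=
  Finset.sum_nonneg fun k _ => mul_nonneg (sq_nonneg _) (S.rate_nonneg hX k)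

theorem informationRate_le_sum_rate (hX : X.PosSemidef) : S.informationRate X ≤ ∑ k, S.rate X k :=
  Finset.sum_le_sum fun k _ => mul_le_of_le_one_left (S.rate_nonneg hX k)
    ((sq_le_one_iff_abs_le_one _).2 (S.abs_bias_le_one hX k))

theorem two_mul_informationRate (X : Matrix n n ℂ) :
    2 * S.informationRate X = ∑ k, (S.rate X k - S.rate X (S.rev k)) ^ 2 /
      (S.rate X k + S.rate X (S.rev k)) := by
  rw [informationRate, S.two_mul_sum_eq_sum_add_rev]
  refine Finset.sum_congr rfl fun k _ => ?_
  rw [bias_rev, neg_sq, ← mul_add, bias]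
  by_cases hzero : S.rate X k + S.rate X (S.rev k) = 0
  · simp [hzero]
  · field_simp

theorem sum_sub_rate_rev_mul_log (X : Matrix n n ℂ) :
    ∑ k, (S.rate X k - S.rate X (S.rev k)) * Real.log (S.rate X k / S.rate X (S.rev k)) =
      2 * ∑ k, S.rate X k * Real.log (S.rate X k / S.rate X (S.rev k)) := by
  rw [S.two_mul_sum_eq_sum_add_rev]
  refine Finset.sum_congr rfl fun k _ => ?_
  rw [S.rev_rev, ← inv_div (S.rate X k), Real.log_inv]
  ring

theorem informationRate_le_of_sq_div_add_le (hX : X.PosDef) {a b : ℝ}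
    (h : ∀ r s : ℝ, 0 < r → 0 < s →
      (r - s) ^ 2 / (r + s) ≤ a * (r + s) + b * ((r - s) * Real.log (r / s))) :
    S.informationRate X ≤
      a * ∑ k, S.rate X k + b * ∑ k, S.rate X k * Real.log (S.rate X k / S.rate X (S.rev k)) := by
  have hsum : 2 * S.informationRate X ≤ ∑ k, (a * (S.rate X k + S.rate X (S.rev k)) +
      b * ((S.rate X k - S.rate X (S.rev k)) * Real.log (S.rate X k / S.rate X (S.rev k)))) := by
    rw [S.two_mul_informationRate]
    refine Finset.sum_le_sum fun k _ => ?_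
    by_cases hk : S.L k = 0
    · simp [S.rate_eq_zero hk, S.rate_rev_eq_zero hk]
    · exact h _ _ (S.rate_pos hX hk) (S.rate_pos hX (S.L_rev_ne_zero hk))
  rw [Finset.sum_add_distrib, ← Finset.mul_sum, ← Finset.mul_sum, S.sum_sub_rate_rev_mul_log,
    ← S.two_mul_sum_eq_sum_add_rev] at hsum
  linarith

theorem two_mul_informationRate_le (hX : X.PosDef) :
    2 * S.informationRate X ≤ S.entropyProductionRate X := by
  have hlog := S.sum_rate_mul_log_le hX
  have hinfo := S.informationRate_le_of_sq_div_add_le hX (a := 0) (b := 1 / 2) fun r s hr hs => by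
    linarith [sq_div_add_le_mul_log hr hs]
  linarith

theorem informationRate_le_tangent {x₀ m : ℝ} (hm : 0 ≤ m)
    (h : ∀ r s : ℝ, 0 < r → 0 < s → (r - s) ^ 2 / (r + s) ≤ (r + s) * Real.tanh x₀ ^ 2 +
      m * (1 / 2 * ((r - s) * Real.log (r / s)) - x₀ * Real.tanh x₀ * (r + s)))
    (hX : X.PosDef) :
    S.informationRate X ≤ Real.tanh x₀ ^ 2 * ∑ k, S.rate X k +
      m * (1 / 2 * S.entropyProductionRate X - x₀ * Real.tanh x₀ * ∑ k, S.rate X k) := by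
  have hlog := mul_le_mul_of_nonneg_left (S.sum_rate_mul_log_le hX) hm
  have hinfo := S.informationRate_le_of_sq_div_add_le hX (b := m / 2)
    (a := Real.tanh x₀ ^ 2 - m * (x₀ * Real.tanh x₀)) fun r s hr hs => by linarith [h r s hr hs]
  linarith

end

end FeedbackSystem

/-! ### The Cramér–Rao inequality -/

theorem sq_le_mul_of_forall_two_mul_sub_le {a b d : ℝ}
    (h : ∀ x, 2 * x * a - x ^ 2 * b ≤ d) : a ^ 2 ≤ d * b := by
  have hdiscrim : discrim b (-(2 * a)) d ≤ 0 := discrim_le_zero fun x => by linarith [h x]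
  rw [discrim] at hdiscrim
  linarith

section TraceLemmas

variable {n : Type*} [Fintype n] {N X : Matrix n n ℂ}

theorem re_trace_mul_conjTranspose (hN : N.IsHermitian) (Z : Matrix n n ℂ) :
    (N * Zᴴ).trace.re = (N * Z).trace.re := by
  rw [Matrix.trace_mul_comm N Z, ← Complex.conj_re, ← Complex.star_def,
    ← Matrix.trace_conjTranspose, Matrix.conjTranspose_mul, Matrix.conjTranspose_conjTranspose,
    hN.eq, Matrix.trace_mul_comm, Matrix.trace_mul_comm]

theorem two_mul_re_trace_sub_le (hX : X.PosSemidef) (L T : Matrix n n ℂ) (y : ℝ) :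
    2 * y * (T * X * Lᴴ).trace.re - y ^ 2 * (L * X * Lᴴ).trace.re ≤ (T * X * Tᴴ).trace.re := by
  have hnonneg := (Complex.nonneg_iff.1
    (hX.mul_mul_conjTranspose_same (T - (y : ℂ) • L)).trace_nonneg).1
  have hLT : (L * X * Tᴴ).trace.re = (T * X * Lᴴ).trace.re := by
    rw [← Complex.conj_re, ← Complex.star_def, ← Matrix.trace_conjTranspose]
    simp only [Matrix.conjTranspose_mul, Matrix.conjTranspose_conjTranspose, hX.1.eq,
      Matrix.mul_assoc]
  rw [Matrix.conjTranspose_sub, Matrix.conjTranspose_smul] at hnonneg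
  simp only [Matrix.sub_mul, Matrix.mul_sub, Matrix.smul_mul, Matrix.mul_smul, Matrix.trace_sub,
    Matrix.trace_smul, Complex.star_def, Complex.conj_ofReal, smul_eq_mul, Complex.sub_re,
    Complex.re_ofReal_mul, hLT] at hnonneg
  linarith

end TraceLemmas

namespace FeedbackSystem

section

variable {n K : Type*} [Fintype n] [DecidableEq n] (S : FeedbackSystem n K)

theorem re_trace_mul_dissipator {N X : Matrix n n ℂ} (hN : N.IsHermitian) (hX : X.IsHermitian)
    (k : K) :
    (N * S.dissipator k X).trace.re =
      (traceAdjoint (S.F k) N * S.L k * X * (S.L k)ᴴ).trace.re -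
        (S.L k * N * X * (S.L k)ᴴ).trace.re := by
  have hconj : (N * (X * ((S.L k)ᴴ * S.L k))).trace.re = (N * ((S.L k)ᴴ * S.L k * X)).trace.re := by
    rw [← re_trace_mul_conjTranspose hN]
    simp only [Matrix.conjTranspose_mul, Matrix.conjTranspose_conjTranspose, hX.eq]
  have hcyc : (S.L k * N * X * (S.L k)ᴴ).trace = (N * (X * ((S.L k)ᴴ * S.L k))).trace := by
    rw [Matrix.mul_assoc, Matrix.mul_assoc, Matrix.trace_mul_comm]
    simp only [Matrix.mul_assoc]
  have hfeedback : (N * S.F k (S.L k * X * (S.L k)ᴴ)).trace =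
      (traceAdjoint (S.F k) N * S.L k * X * (S.L k)ᴴ).trace := by
    rw [← trace_traceAdjoint_mul]
    simp only [Matrix.mul_assoc]
  have hhalf : (1 / 2 : ℂ) = ((1 / 2 : ℝ) : ℂ) := by norm_num
  rw [dissipator_apply, Matrix.mul_sub, Matrix.mul_smul, Matrix.mul_add, Matrix.trace_sub,
    Matrix.trace_smul, Matrix.trace_add, hfeedback, hcyc, smul_eq_mul, hhalf, Complex.sub_re,
    Complex.re_ofReal_mul, Complex.add_re, ← hconj]
  ring

theorem re_trace_jumpDefect_mul (c : K → ℝ) {N X : Matrix n n ℂ} (hN : N.IsHermitian)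
    (hX : X.IsHermitian) (k : K) :
    (S.jumpDefect c N k * X * (S.L k)ᴴ).trace.re =
      c k * S.rate X k + (N * S.dissipator k X).trace.re := by
  rw [S.re_trace_mul_dissipator hN hX, jumpDefect, rate]
  simp only [Matrix.sub_mul, Matrix.add_mul, Matrix.smul_mul, Matrix.one_mul, Matrix.trace_sub,
    Matrix.trace_add, Matrix.trace_smul, smul_eq_mul, Complex.sub_re, Complex.add_re,
    Complex.re_ofReal_mul]
  ring

end

section

variable {n K : Type*} [Fintype n] [DecidableEq n] [Fintype K] (S : FeedbackSystem n K)
  {c : K → ℝ} {τ : ℝ}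

/-- The contribution of the state `X` to the response of the mean current to the perturbation of
the jump operators, when `N` is the expected future current: a perturbed jump changes the current
by its own count and by its effect on the future current. -/
noncomputable def responseRate (c : K → ℝ) (N X : Matrix n n ℂ) : ℝ :=
  ∑ k, S.bias X k * (c k * S.rate X k + (N * S.dissipator k X).trace.re)

theorem two_mul_responseRate_sub_le (c : K → ℝ) {N X : Matrix n n ℂ} (hN : N.IsHermitian)
    (hX : X.PosSemidef) (x : ℝ) :
    2 * x * S.responseRate c N X - x ^ 2 * S.informationRate X ≤
      ∑ k, (S.jumpDefect c N k * X * (S.jumpDefect c N k)ᴴ).trace.re := by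
  rw [responseRate, informationRate, Finset.mul_sum, Finset.mul_sum, ← Finset.sum_sub_distrib]
  refine Finset.sum_le_sum fun k _ => le_of_eq_of_le ?_
    (two_mul_re_trace_sub_le hX (S.L k) (S.jumpDefect c N k) (x * S.bias X k))
  rw [S.re_trace_jumpDefect_mul c hN hX.1, rate]
  ring

theorem intervalIntegrable_bias_mul (hτ : 0 ≤ τ)
    (hpos : ∀ t ∈ Set.Icc 0 τ, (S.state t).PosSemidef) (k : K) {f : ℝ → ℝ}
    (hf : IntervalIntegrable f MeasureTheory.volume 0 τ) :
    IntervalIntegrable (fun t => S.bias (S.state t) k * f t) MeasureTheory.volume 0 τ := by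
  rw [intervalIntegrable_iff_integrableOn_Icc_of_le hτ] at hf ⊢
  exact hf.bdd_mul (S.aestronglyMeasurable_bias S.continuous_state.continuousOn k)
    (MeasureTheory.ae_restrict_of_forall_mem measurableSet_Icc fun t ht =>
      S.abs_bias_le_one (hpos t ht) k)

theorem intervalIntegrable_sum_bias_mul (hτ : 0 ≤ τ)
    (hpos : ∀ t ∈ Set.Icc 0 τ, (S.state t).PosSemidef) {f : K → ℝ → ℝ}
    (hf : ∀ k, IntervalIntegrable (f k) MeasureTheory.volume 0 τ) :
    IntervalIntegrable (fun t => ∑ k, S.bias (S.state t) k * f k t)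
      MeasureTheory.volume 0 τ := by
  simpa only [Finset.sum_fn] using
    IntervalIntegrable.sum Finset.univ fun k _ => S.intervalIntegrable_bias_mul hτ hpos k (hf k)

theorem intervalIntegrable_informationRate (hτ : 0 ≤ τ)
    (hpos : ∀ t ∈ Set.Icc 0 τ, (S.state t).PosSemidef) :
    IntervalIntegrable (fun t => S.informationRate (S.state t)) MeasureTheory.volume 0 τ := by
  simp only [informationRate, sq, mul_assoc]
  exact S.intervalIntegrable_sum_bias_mul hτ hpos fun k => S.intervalIntegrable_bias_mul hτ hpos k
    (Continuous.intervalIntegrable (by fun_prop) 0 τ)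

theorem meanCurrent_eq_integral (c : K → ℝ) (hτ : 0 < τ) :
    S.meanCurrent c τ = ∫ t in (0 : ℝ)..τ, ∑ k, c k * S.rate (S.state t) k := by
  rw [intervalIntegral.integral_eq_sub_of_hasDerivAt_of_le hτ.le
    (fun t _ => (S.hasDerivAt_re_trace_moments_snd_fst c t).continuousAt.continuousWithinAt)
    (fun t ht => (S.hasDerivAt_re_trace_moments_snd_fst c t).congr_deriv <| by
      rw [re_trace_weightedJump, S.moments_fst_eq_state c ht.1.le])
    (S.intervalIntegrable_sum_mul_rate c), S.meanCurrent_eq c hτ, moments_zero]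
  simp

theorem meanCurrent_eq_integral_bias_mul (hc : ∀ k, c (S.rev k) = -c k) (hτ : 0 < τ)
    (hpos : ∀ t ∈ Set.Icc 0 τ, (S.state t).PosSemidef) :
    S.meanCurrent c τ =
      ∫ t in (0 : ℝ)..τ, ∑ k, S.bias (S.state t) k * (c k * S.rate (S.state t) k) := by
  rw [S.meanCurrent_eq_integral c hτ]
  refine intervalIntegral.integral_congr fun t ht => ?_
  rw [Set.uIcc_of_le hτ.le] at ht
  exact S.sum_mul_rate_eq hc (hpos t ht)

theorem intervalIntegrable_sum_mul_rate_linearResponse (c : K → ℝ) (hτ : 0 ≤ τ)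
    (hpos : ∀ t ∈ Set.Icc 0 τ, (S.state t).PosSemidef) :
    IntervalIntegrable (fun t => ∑ k, c k * S.rate (S.linearResponse t) k)
      MeasureTheory.volume 0 τ := by
  have hcont : Continuous fun X : Matrix n n ℂ => ∑ k, c k * S.rate X k := by fun_prop
  exact (hcont.comp_continuousOn
    (S.continuousOn_linearResponse hτ hpos)).intervalIntegrable_of_Icc hτ

namespace IsFutureCurrent

variable {S} {N : ℝ → Matrix n n ℂ}

theorem continuous (hN : S.IsFutureCurrent c τ N) : Continuous N :=
  continuous_iff_continuousAt.2 fun t => (hN.hasDerivAt t).continuousAt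

theorem hasDerivAt_re_trace_mul_linearResponse (hN : S.IsFutureCurrent c τ N)
    (hfull : ∀ t ∈ Set.Ioo 0 τ, (S.state t).PosDef)
    (hpos : ∀ t ∈ Set.Icc 0 τ, (S.state t).PosSemidef) {t : ℝ} (ht : t ∈ Set.Ioo 0 τ) :
    HasDerivAt (fun t => (N t * S.linearResponse t).trace.re)
      (∑ k, S.bias (S.state t) k * (N t * S.dissipator k (S.state t)).trace.re -
        ∑ k, c k * S.rate (S.linearResponse t) k) t := by
  refine (hasDerivAt_re_trace
    ((hN.hasDerivAt t).mul (S.hasDerivAt_linearResponse hpos hfull ht))).congr_deriv ?_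
  rw [← re_trace_weightedJump, perturbation_apply]
  simp only [Matrix.neg_mul, Matrix.add_mul, Matrix.mul_add, Matrix.trace_add, Matrix.trace_neg,
    trace_traceAdjoint_mul, Matrix.one_mul, Complex.add_re, Complex.neg_re, Finset.mul_sum,
    Matrix.mul_smul, Matrix.trace_sum, Matrix.trace_smul, Complex.re_sum, Complex.smul_re,
    smul_eq_mul]
  ring

theorem continuous_re_trace_mul_dissipator (hN : S.IsFutureCurrent c τ N) (k : K) :
    Continuous fun t => (N t * S.dissipator k (S.state t)).trace.re :=
  continuous_trace_re.comp <| hN.continuous.mul <|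
    (realCLM (S.dissipator k)).continuous.comp S.continuous_state

theorem integral_sum_mul_rate_linearResponse (hN : S.IsFutureCurrent c τ N) (hτ : 0 ≤ τ)
    (hfull : ∀ t ∈ Set.Ioo 0 τ, (S.state t).PosDef)
    (hpos : ∀ t ∈ Set.Icc 0 τ, (S.state t).PosSemidef) :
    ∫ t in (0 : ℝ)..τ, ∑ k, c k * S.rate (S.linearResponse t) k =
      ∫ t in (0 : ℝ)..τ, ∑ k, S.bias (S.state t) k *
        (N t * S.dissipator k (S.state t)).trace.re := by
  have hbias := S.intervalIntegrable_sum_bias_mul hτ hpos fun k =>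
    (hN.continuous_re_trace_mul_dissipator k).intervalIntegrable 0 τ
  have hrate := S.intervalIntegrable_sum_mul_rate_linearResponse c hτ hpos
  have hftc := intervalIntegral.integral_eq_sub_of_hasDerivAt_of_le hτ
    (continuous_trace_re.comp_continuousOn
      (hN.continuous.continuousOn.mul (S.continuousOn_linearResponse hτ hpos)))
    (fun t ht => hN.hasDerivAt_re_trace_mul_linearResponse hfull hpos ht) (hbias.sub hrate)
  rw [intervalIntegral.integral_sub hbias hrate] at hftc
  simp only [Function.comp_apply, Pi.mul_apply, hN.final, linearResponse_zero, Matrix.zero_mul,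
    Matrix.mul_zero, sub_self] at hftc
  exact (sub_eq_zero.1 hftc).symm

theorem intervalIntegrable_responseRate (hN : S.IsFutureCurrent c τ N) (hτ : 0 ≤ τ)
    (hpos : ∀ t ∈ Set.Icc 0 τ, (S.state t).PosSemidef) :
    IntervalIntegrable (fun t => S.responseRate c (N t) (S.state t)) MeasureTheory.volume 0 τ :=
  S.intervalIntegrable_sum_bias_mul hτ hpos fun k => Continuous.intervalIntegrable
    (Continuous.add (by fun_prop) (hN.continuous_re_trace_mul_dissipator k)) 0 τ

theorem integral_responseRate (hN : S.IsFutureCurrent c τ N) (hc : ∀ k, c (S.rev k) = -c k)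
    (hτ : 0 < τ) (hfull : ∀ t ∈ Set.Ioo 0 τ, (S.state t).PosDef) :
    ∫ t in (0 : ℝ)..τ, S.responseRate c (N t) (S.state t) =
      S.meanCurrent c τ + ∫ t in (0 : ℝ)..τ, ∑ k, c k * S.rate (S.linearResponse t) k := by
  have hpos := S.posSemidef_state hτ hfull
  rw [S.meanCurrent_eq_integral_bias_mul hc hτ hpos,
    hN.integral_sum_mul_rate_linearResponse hτ.le hfull hpos, ← intervalIntegral.integral_add]
  · simp only [responseRate, mul_add, Finset.sum_add_distrib]
  · exact S.intervalIntegrable_sum_bias_mul hτ.le hpos fun k =>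
      Continuous.intervalIntegrable (by fun_prop) 0 τ
  · exact S.intervalIntegrable_sum_bias_mul hτ.le hpos fun k =>
      (hN.continuous_re_trace_mul_dissipator k).intervalIntegrable 0 τ

end IsFutureCurrent

theorem sq_meanCurrent_add_response_le (hc : ∀ k, c (S.rev k) = -c k) (hτ : 0 < τ)
    (hfull : ∀ t ∈ Set.Ioo 0 τ, (S.state t).PosDef) :
    (S.meanCurrent c τ + ∫ t in (0 : ℝ)..τ, ∑ k, c k * S.rate (S.linearResponse t) k) ^ 2 ≤
      S.varCurrent c τ * ∫ t in (0 : ℝ)..τ, S.informationRate (S.state t) := by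
  have hpos := S.posSemidef_state hτ hfull
  obtain ⟨N, hN⟩ := S.exists_isFutureCurrent c τ
  have hresp := hN.intervalIntegrable_responseRate hτ.le hpos
  have hinfo := S.intervalIntegrable_informationRate hτ.le hpos
  refine sq_le_mul_of_forall_two_mul_sub_le fun x => ?_
  have hint := (hresp.const_mul (2 * x)).sub (hinfo.const_mul (x ^ 2))
  have hmoments (t : ℝ) (ht : t ∈ Set.Icc 0 τ) := S.moments_fst_eq_state c ht.1
  have hvar := hN.integral_le_variance hτ.le (fun t ht => (hmoments t ht).symm ▸ hpos t ht)
    ((intervalIntegrable_iff_integrableOn_Icc_of_le hτ.le).1 hint) fun t ht => by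
      rw [hmoments t (Set.Ioo_subset_Icc_self ht)]
      exact S.two_mul_responseRate_sub_le c (hN.isHermitian t) (hfull t ht).posSemidef x
  rwa [intervalIntegral.integral_sub (hresp.const_mul _) (hinfo.const_mul _),
    intervalIntegral.integral_const_mul, intervalIntegral.integral_const_mul,
    hN.integral_responseRate hc hτ hfull, ← S.meanCurrent_eq c hτ, ← S.currentMoment_two_eq c hτ,
    ← varCurrent] at hvar

end

end FeedbackSystem

/-! ### The uncertainty relation -/

namespace FeedbackSystem

section

variable {n K : Type*} [Fintype n] [DecidableEq n] [Fintype K] (S : FeedbackSystem n K)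
  {c : K → ℝ} {τ : ℝ}

theorem sq_meanCurrent_le (hc : ∀ k, c (S.rev k) = -c k) (hτ : 0 < τ)
    (hpos : ∀ t ∈ Set.Icc 0 τ, (S.state t).PosSemidef) :
    S.meanCurrent c τ ^ 2 ≤ (∫ t in (0 : ℝ)..τ, ∑ k, c k ^ 2 * S.rate (S.state t) k) *
      ∫ t in (0 : ℝ)..τ, S.informationRate (S.state t) := by
  have hinfo := S.intervalIntegrable_informationRate hτ.le hpos
  have hmean := S.intervalIntegrable_sum_mul_rate c (τ := τ)
  refine sq_le_mul_of_forall_two_mul_sub_le fun x => ?_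
  rw [S.meanCurrent_eq_integral c hτ, ← intervalIntegral.integral_const_mul,
    ← intervalIntegral.integral_const_mul,
    ← intervalIntegral.integral_sub (hmean.const_mul _) (hinfo.const_mul _)]
  refine intervalIntegral.integral_mono_on hτ.le ((hmean.const_mul _).sub (hinfo.const_mul _))
    (S.intervalIntegrable_sum_mul_rate fun k => c k ^ 2) fun t ht => ?_
  rw [S.sum_mul_rate_eq hc (hpos t ht), informationRate, Finset.mul_sum, Finset.mul_sum,
    ← Finset.sum_sub_distrib]
  refine Finset.sum_le_sum fun k _ => ?_
  linarith [mul_nonneg (sq_nonneg (c k - x * S.bias (S.state t) k)) (S.rate_nonneg (hpos t ht) k)]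

theorem integral_informationRate_pos (hc : ∀ k, c (S.rev k) = -c k) (hτ : 0 < τ)
    (hpos : ∀ t ∈ Set.Icc 0 τ, (S.state t).PosSemidef) (hJ : S.meanCurrent c τ ≠ 0) :
    0 < ∫ t in (0 : ℝ)..τ, S.informationRate (S.state t) := by
  refine (intervalIntegral.integral_nonneg hτ.le fun t ht =>
    S.informationRate_nonneg (hpos t ht)).lt_of_ne' fun hzero => hJ ?_
  have hsq := S.sq_meanCurrent_le hc hτ hpos
  rw [hzero, mul_zero] at hsq
  exact sq_nonpos_iff _ |>.1 hsq

theorem intervalIntegrable_sum_rate :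
    IntervalIntegrable (fun t => ∑ k, S.rate (S.state t) k) MeasureTheory.volume 0 τ := by
  simpa only [one_mul] using S.intervalIntegrable_sum_mul_rate fun _ => 1

theorem integral_informationRate_le_activity (hτ : 0 ≤ τ)
    (hpos : ∀ t ∈ Set.Icc 0 τ, (S.state t).PosSemidef) :
    ∫ t in (0 : ℝ)..τ, S.informationRate (S.state t) ≤ S.activity τ S.state :=
  intervalIntegral.integral_mono_on hτ (S.intervalIntegrable_informationRate hτ hpos)
    S.intervalIntegrable_sum_rate fun t ht => S.informationRate_le_sum_rate (hpos t ht)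

theorem two_mul_integral_informationRate_le (hτ : 0 < τ)
    (hfull : ∀ t ∈ Set.Ioo 0 τ, (S.state t).PosDef) :
    2 * ∫ t in (0 : ℝ)..τ, S.informationRate (S.state t) ≤ S.entropyProduction τ S.state := by
  rw [S.entropyProduction_eq hτ hfull, ← intervalIntegral.integral_const_mul]
  exact intervalIntegral.integral_mono_on_of_le_Ioo hτ.le
    ((S.intervalIntegrable_informationRate hτ.le (S.posSemidef_state hτ hfull)).const_mul 2)
    (S.intervalIntegrable_entropyProductionRate hτ.le hfull)
    fun t ht => S.two_mul_informationRate_le (hfull t ht)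

/-- The bound on the rates is linear in activity and entropy production with `x₀ = Phi (Σ / 2A)`
fixed in advance, so it survives integration; at this `x₀` the term multiplied by `m` vanishes. -/
theorem integral_informationRate_le (hτ : 0 < τ) (hfull : ∀ t ∈ Set.Ioo 0 τ, (S.state t).PosDef)
    (hA : 0 < S.activity τ S.state) (hE : 0 < S.entropyProduction τ S.state) :
    ∫ t in (0 : ℝ)..τ, S.informationRate (S.state t) ≤ S.activity τ S.state *
      Real.tanh (Phi (S.entropyProduction τ S.state / (2 * S.activity τ S.state))) ^ 2 := by
  set s := S.entropyProduction τ S.state / (2 * S.activity τ S.state) with hs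
  have hspos : 0 < s := div_pos hE (mul_pos two_pos hA)
  obtain ⟨m, hm, htangent⟩ := exists_sq_div_add_le_tangent (Phi_pos hspos)
  have hrate := S.intervalIntegrable_sum_rate (τ := τ)
  have hentropy := S.intervalIntegrable_entropyProductionRate hτ.le hfull
  have hdiff := (hentropy.const_mul (1 / 2)).sub (hrate.const_mul (Phi s * Real.tanh (Phi s)))
  refine (intervalIntegral.integral_mono_on_of_le_Ioo hτ.le
    (S.intervalIntegrable_informationRate hτ.le (S.posSemidef_state hτ hfull))
    ((hrate.const_mul (Real.tanh (Phi s) ^ 2)).add (hdiff.const_mul m))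
    fun t ht => S.informationRate_le_tangent hm htangent (hfull t ht)).trans_eq ?_
  rw [intervalIntegral.integral_add (hrate.const_mul _) (hdiff.const_mul _),
    intervalIntegral.integral_const_mul, intervalIntegral.integral_const_mul,
    intervalIntegral.integral_sub (hentropy.const_mul _) (hrate.const_mul _),
    intervalIntegral.integral_const_mul, intervalIntegral.integral_const_mul,
    ← S.entropyProduction_eq hτ hfull, Phi_mul_tanh_Phi hspos.le, ← activity, hs]
  field_simp
  ring

theorem activity_pos (hc : ∀ k, c (S.rev k) = -c k) (hτ : 0 < τ)
    (hpos : ∀ t ∈ Set.Icc 0 τ, (S.state t).PosSemidef) (hJ : S.meanCurrent c τ ≠ 0) :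
    0 < S.activity τ S.state :=
  (S.integral_informationRate_pos hc hτ hpos hJ).trans_le
    (S.integral_informationRate_le_activity hτ.le hpos)

theorem entropyProduction_pos (hc : ∀ k, c (S.rev k) = -c k) (hτ : 0 < τ)
    (hfull : ∀ t ∈ Set.Ioo 0 τ, (S.state t).PosDef) (hJ : S.meanCurrent c τ ≠ 0) :
    0 < S.entropyProduction τ S.state :=
  (mul_pos two_pos (S.integral_informationRate_pos hc hτ (S.posSemidef_state hτ hfull) hJ)).trans_le
    (S.two_mul_integral_informationRate_le hτ hfull)

section Response

variable {ρp : ℝ → ℝ → Matrix n n ℂ}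

theorem eqOn_response (hpos : ∀ t ∈ Set.Icc 0 τ, (S.state t).PosSemidef)
    (hρp : ∀ θ ∈ Set.Ioo (-1 : ℝ) 1, S.IsPerturbedEvolution τ S.state θ (ρp θ)) :
    Set.EqOn (response ρp) S.linearResponse (Set.Icc 0 τ) :=
  fun _ ht => (S.hasDerivAt_perturbedEvolution hpos hρp ht).deriv

theorem intervalIntegrable_sum_mul_rate_response (c : K → ℝ) (hτ : 0 ≤ τ)
    (hpos : ∀ t ∈ Set.Icc 0 τ, (S.state t).PosSemidef)
    (hρp : ∀ θ ∈ Set.Ioo (-1 : ℝ) 1, S.IsPerturbedEvolution τ S.state θ (ρp θ)) :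
    IntervalIntegrable (fun t => ∑ k, c k * S.rate (response ρp t) k)
      MeasureTheory.volume 0 τ := by
  refine (S.intervalIntegrable_sum_mul_rate_linearResponse c hτ hpos).congr fun t ht => ?_
  rw [Set.uIoc_of_le hτ] at ht
  simp only [S.eqOn_response hpos hρp (Set.Ioc_subset_Icc_self ht)]

theorem one_add_correction_mul_meanCurrent (hτ : 0 ≤ τ)
    (hpos : ∀ t ∈ Set.Icc 0 τ, (S.state t).PosSemidef)
    (hρp : ∀ θ ∈ Set.Ioo (-1 : ℝ) 1, S.IsPerturbedEvolution τ S.state θ (ρp θ))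
    (hJ : S.meanCurrent c τ ≠ 0) :
    (1 + S.correction c τ ρp) * S.meanCurrent c τ =
      S.meanCurrent c τ + ∫ t in (0 : ℝ)..τ, ∑ k, c k * S.rate (S.linearResponse t) k := by
  rw [correction, add_mul, one_mul, div_mul_cancel₀ _ hJ]
  congr 1
  refine intervalIntegral.integral_congr fun t ht => ?_
  rw [Set.uIcc_of_le hτ] at ht
  simp only [S.eqOn_response hpos hρp ht]

end Response

namespace IsEvolution

variable {S} {ρ : ℝ → Matrix n n ℂ}

theorem posDef_state (hρ : S.IsEvolution τ ρ) (hfull : ∀ t ∈ Set.Ioo 0 τ, (ρ t).PosDef) :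
    ∀ t ∈ Set.Ioo 0 τ, (S.state t).PosDef :=
  fun t ht => hρ.eq_state (Set.Ioo_subset_Icc_self ht) ▸ hfull t ht

theorem isPerturbedEvolution_state (hρ : S.IsEvolution τ ρ) {θ : ℝ} {ρθ : ℝ → Matrix n n ℂ}
    (hρθ : S.IsPerturbedEvolution τ ρ θ ρθ) : S.IsPerturbedEvolution τ S.state θ ρθ :=
  ⟨hρθ.1, fun t ht => hρ.eq_state ht ▸ hρθ.2 t ht⟩

theorem integral_eq_state (hρ : S.IsEvolution τ ρ) (hτ : 0 ≤ τ) (f : Matrix n n ℂ → ℝ) :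
    ∫ t in (0 : ℝ)..τ, f (ρ t) = ∫ t in (0 : ℝ)..τ, f (S.state t) :=
  intervalIntegral.integral_congr fun t ht => by
    rw [Set.uIcc_of_le hτ] at ht
    simp only [hρ.eq_state ht]

theorem activity_eq_state (hρ : S.IsEvolution τ ρ) (hτ : 0 ≤ τ) :
    S.activity τ ρ = S.activity τ S.state :=
  hρ.integral_eq_state hτ fun X => ∑ k, S.rate X k

theorem entropyProduction_eq_state (hρ : S.IsEvolution τ ρ) (hτ : 0 ≤ τ) :
    S.entropyProduction τ ρ = S.entropyProduction τ S.state := by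
  rw [entropyProduction, entropyProduction, totalEntropyProduction, totalEntropyProduction,
    hρ.eq_state ⟨hτ, le_rfl⟩, hρ.eq_state ⟨le_rfl, hτ⟩, hρ.integral_eq_state hτ S.mutualInfoRate,
    hρ.integral_eq_state hτ fun X => ∑ k, S.Δs k * S.rate X k]

theorem intervalIntegrable_mutualInfoRate (hρ : S.IsEvolution τ ρ) (hτ : 0 ≤ τ)
    (hfull : ∀ t ∈ Set.Ioo 0 τ, (ρ t).PosDef) :
    IntervalIntegrable (fun t => S.mutualInfoRate (ρ t)) MeasureTheory.volume 0 τ := by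
  refine (S.intervalIntegrable_mutualInfoRate hτ (hρ.posDef_state hfull)).congr fun t ht => ?_
  rw [Set.uIoc_of_le hτ] at ht
  simp only [hρ.eq_state (Set.Ioc_subset_Icc_self ht)]

end IsEvolution

end

end FeedbackSystem

theorem mul_div_sq_mul_sq_le_div_sq {a J V I A E x y : ℝ} (hJ : J ≠ 0) (hA : 0 < A) (hE : 0 < E)
    (hI : 0 < I) (hV : (a * J) ^ 2 ≤ V * I) (hIA : I ≤ A * y ^ 2) (hxy : x * y = E / (2 * A)) :
    a ^ 2 * (4 * A / E ^ 2) * x ^ 2 ≤ V / J ^ 2 := by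
  have hVpos : 0 ≤ V := nonneg_of_mul_nonneg_left ((sq_nonneg _).trans hV) hI
  have hfactor : 4 * A / E ^ 2 * x ^ 2 * I ≤ 1 := by
    calc 4 * A / E ^ 2 * x ^ 2 * I ≤ 4 * A / E ^ 2 * x ^ 2 * (A * y ^ 2) := by gcongr
      _ = (2 * A / E * (x * y)) ^ 2 := by ring
      _ = 1 := by rw [hxy]; field_simp
  rw [le_div_iff₀ (by positivity)]
  calc a ^ 2 * (4 * A / E ^ 2) * x ^ 2 * J ^ 2 = (4 * A / E ^ 2 * x ^ 2) * (a * J) ^ 2 := by ring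
    _ ≤ (4 * A / E ^ 2 * x ^ 2) * (V * I) := by gcongr
    _ = V * (4 * A / E ^ 2 * x ^ 2 * I) := by ring
    _ ≤ V := mul_le_of_le_one_right hVpos hfactor

theorem two_mul_sq_div_le {A E : ℝ} (hA : 0 < A) (hE : 0 < E) (a : ℝ) :
    2 * a ^ 2 / E ≤ a ^ 2 * (4 * A / E ^ 2) * Phi (E / (2 * A)) ^ 2 := by
  calc 2 * a ^ 2 / E = a ^ 2 * (4 * A / E ^ 2) * (E / (2 * A)) := by field_simp; ring
    _ ≤ a ^ 2 * (4 * A / E ^ 2) * Phi (E / (2 * A)) ^ 2 := by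
      gcongr
      exact le_Phi_sq (by positivity)

theorem mainTheorem1 {n K : Type*} [Fintype n] [DecidableEq n] [Fintype K]
    (S : FeedbackSystem n K)
    (c : K → ℝ) (hc : ∀ k, c (S.rev k) = -c k)
    (τ : ℝ) (hτ : 0 < τ)
    (ρ : ℝ → Matrix n n ℂ) (hρ : S.IsEvolution τ ρ)
    (hfull : ∀ t ∈ Set.Ioo 0 τ, (ρ t).PosDef)
    (ρp : ℝ → ℝ → Matrix n n ℂ)
    (hρp : ∀ θ ∈ Set.Ioo (-1 : ℝ) 1, S.IsPerturbedEvolution τ ρ θ (ρp θ)) :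
    -- the quantities defined by limits, derivatives and integrals are well defined
    (Tendsto (S.discreteMoment c τ 1) atTop (𝓝 (S.meanCurrent c τ)) ∧
      Tendsto (S.discreteMoment c τ 2) atTop (𝓝 (S.currentMoment c τ 2)) ∧
      (∀ t ∈ Set.Ioo 0 τ, Tendsto (fun h => S.mutualInfoChange (ρ t) h / h) (𝓝[>] 0)
        (𝓝 (S.mutualInfoRate (ρ t)))) ∧
      IntervalIntegrable (fun t => S.mutualInfoRate (ρ t)) MeasureTheory.volume 0 τ ∧
      (∀ t ∈ Set.Icc 0 τ, DifferentiableAt ℝ (fun θ => ρp θ t) 0) ∧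
      IntervalIntegrable (fun t => ∑ k, c k * S.rate (FeedbackSystem.response ρp t) k)
        MeasureTheory.volume 0 τ) ∧
    -- the uncertainty relation
    (S.meanCurrent c τ ≠ 0 →
      0 < S.activity τ ρ ∧
      0 < S.entropyProduction τ ρ ∧
      S.varCurrent c τ / S.meanCurrent c τ ^ 2 ≥
        (1 + S.correction c τ ρp) ^ 2 *
          (4 * S.activity τ ρ / S.entropyProduction τ ρ ^ 2) *
          Phi (S.entropyProduction τ ρ / (2 * S.activity τ ρ)) ^ 2 ∧
      (1 + S.correction c τ ρp) ^ 2 *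
          (4 * S.activity τ ρ / S.entropyProduction τ ρ ^ 2) *
          Phi (S.entropyProduction τ ρ / (2 * S.activity τ ρ)) ^ 2 ≥
        2 * (1 + S.correction c τ ρp) ^ 2 / S.entropyProduction τ ρ) := by
  have hfull' := hρ.posDef_state hfull
  have hpos := S.posSemidef_state hτ hfull'
  have hρp' (θ : ℝ) (hθ : θ ∈ Set.Ioo (-1 : ℝ) 1) := hρ.isPerturbedEvolution_state (hρp θ hθ)
  refine ⟨⟨?_, ?_, fun t ht => ?_, hρ.intervalIntegrable_mutualInfoRate hτ.le hfull,
    fun t ht => (S.hasDerivAt_perturbedEvolution hpos hρp' ht).differentiableAt,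
    S.intervalIntegrable_sum_mul_rate_response c hτ.le hpos hρp'⟩, fun hJ => ?_⟩
  · exact S.meanCurrent_eq c hτ ▸ S.tendsto_discreteMoment_one c hτ
  · exact S.currentMoment_two_eq c hτ ▸ S.tendsto_discreteMoment_two c hτ
  · exact S.mutualInfoRate_eq (hfull t ht) ▸ S.tendsto_mutualInfoChange (hfull t ht)
  rw [hρ.activity_eq_state hτ.le, hρ.entropyProduction_eq_state hτ.le]
  have hA := S.activity_pos hc hτ hpos hJ
  have hE := S.entropyProduction_pos hc hτ hfull' hJ
  have hvar := S.sq_meanCurrent_add_response_le hc hτ hfull'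
  rw [← S.one_add_correction_mul_meanCurrent hτ.le hpos hρp' hJ] at hvar
  exact ⟨hA, hE, mul_div_sq_mul_sq_le_div_sq hJ hA hE
    (S.integral_informationRate_pos hc hτ hpos hJ) hvar
    (S.integral_informationRate_le hτ hfull' hA hE)
    (Phi_mul_tanh_Phi (div_pos hE (mul_pos two_pos hA)).le), two_mul_sq_div_le hA hE _⟩
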